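/- Let $d\ge1$, let $\Omega\subseteq\mathbb R^d$ be a non-empty open set, and let $L$ be a self-adjoint operator on the complex space $L^2(\Omega)$. Put $p^*=\frac{d+2}{d-2}$ if $d\ge3$ and $p^*=\infty$ if $d=1,2$. Consider one of the following two cases. (A) (Energy-subcritical case.) $1<p<p^*$, and for every $2\le q<p^*+1$ there are constants $C>0$ and $0\le\omega<1$ with $$\|e^{-tL}\|_{L^2(\Omega)\to L^q(\Omega)}\le C\,t^{-\frac d2\left(\frac12-\frac1q\right)}e^{\omega t}\qquad(t>0).$$ In this case let $\mathcal E(L)=H^1(L)=\{f\in L^2(\Omega):\|f\|_{H^1(L)}<\infty\}$ with $\|f\|_{H^1(L)}=\|(I+L)^{1/2}f\|_{L^2(\Omega)}$. (B) (Energy-critical case.) $d\ge3$, $p=p^*$, $L$ is non-negative, and $e^{-tL}$ has an integral kernel $K_L(t;x,y)$ for which there are constants $c,C>0$ with $$|K_L(t;x,y)|\le C\,t^{-\frac d2}e^{-\frac{|x-y|^2}{ct}}\qquad\text{for all }t>0\text{ and a.e. }x,y\in\Omega.$$ In this case let $\mathcal E(L)=\dot H^1(L)=\{f\in\mathcal Z'(L):\|f\|_{\dot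 H^1(L)}<\infty\}$ with $\|f\|_{\dot H^1(L)}=\|L^{1/2}f\|_{L^2(\Omega)}$. Here $\mathcal Z(L)$ is the space of all $f$ with $L^Mf\in L^1(\Omega)\cap\mathcal D(L)$ for every $M\in\mathbb Z$, with the topology given by the seminorms $\|L^Mf\|_{L^1(\Omega)}$; $\mathcal Z'(L)$ is the space of continuous conjugate-linear functionals on $\mathcal Z(L)$, where a function $u$ is identified with $g\mapsto\int_\Omega u\,\overline g\,dx$ and $L^{1/2}$ acts on $\mathcal Z'(L)$ by duality. The $L^{p+1}(\Omega)$ norm of an element of $\mathcal Z'(L)$ is that of the function representing it ($\infty$ if there is none). In both cases set $$E_L(u)=\tfrac12\|u\|_{\mathcal E(L)}^2-\tfrac1{p+1}\|u\|_{L^{p+1}(\Omega)}^{p+1},\qquad J_L(u)=\|u\|_{\mathcal E(L)}^2-\|u\|_{L^{p+1}(\Omega)}^{p+1},$$ $$\mathcal N_L=\{u\in\mathcal E(L)\setminus\{0\}:J_L(u)=0\},\qquad l_L=\inf_{u\in\mathcal E(L)\setminus\{0\}}\ \max_{\lambda\ge0}E_L(\lambda u),$$ and let $S_{p+1}$ be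 the best (smallest) constant $C\ge0$ in the Sobolev inequality $$\|f\|_{L^{p+1}(\Omega)}\le C\|f\|_{\mathcal E(L)}\qquad\text{for all } f\in\mathcal E(L).$$ Then this best constant exists and $0<S_{p+1}<\infty$, the maximum in the definition of $l_L$ is attained for every $u\in\mathcal E(L)\setminus\{0\}$, and $$l_L=\inf_{f\in\mathcal N_L}E_L(f)=\frac{p-1}{2(p+1)}\,S_{p+1}^{-\frac{2(p+1)}{p-1}}.$$ -/

import Mathlib

open MeasureTheory Filter Topology Set
open scoped ENNReal

noncomputable section

/-! ### Operators on a Hilbert space -/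

section Operators

variable {H : Type*} [NormedAddCommGroup H] [InnerProductSpace ℂ H] [CompleteSpace H]

/-- `A` is a non-negative self-adjoint (in general unbounded) operator. -/
def IsNonnegSelfAdjoint (A : H →ₗ.[ℂ] H) : Prop :=
  IsSelfAdjoint A ∧ ∀ x : A.domain, 0 ≤ (inner ℂ (A x) (x : H)).re

/-- `B` is the non-negative self-adjoint square root of `A`: `B ∘ B = A`, domains included. -/
def IsOpSqrt (A B : H →ₗ.[ℂ] H) : Prop :=
  IsNonnegSelfAdjoint B ∧
    ∀ x y : H, (x, y) ∈ A.graph ↔ ∃ z : H, (x, z) ∈ B.graph ∧ (z, y) ∈ B.graph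

open Classical in
/-- The operator `A^{1/2}`, i.e. the (unique) non-negative self-adjoint square root of a
non-negative self-adjoint operator `A`. (For any other `A` without such a root: the operator with
domain `{0}`.) -/
def opSqrt (A : H →ₗ.[ℂ] H) : H →ₗ.[ℂ] H :=
  if h : ∃ B, IsOpSqrt A B then h.choose else ⊥

/-- `T` is the semigroup `(e^{-tL})_{t ≥ 0}`: a strongly continuous semigroup of bounded operators
whose infinitesimal generator is exactly `-L` (graph of `L` = all pairs `(f, g)` such that
`(f - T t f) / t → g` as `t → 0+`). -/
structure IsSemigroupOf (L : H →ₗ.[ℂ] H) (T : ℝ → H →L[ℂ] H) : Prop where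
  map_zero : T 0 = 1
  map_add : ∀ s t : ℝ, 0 ≤ s → 0 ≤ t → T (s + t) = T s * T t
  tendsto_zero : ∀ f : H, Tendsto (fun t : ℝ => T t f) (𝓝[>] 0) (𝓝 f)
  generator : ∀ f g : H,
    (f, g) ∈ L.graph ↔ Tendsto (fun t : ℝ => t⁻¹ • (f - T t f)) (𝓝[>] 0) (𝓝 g)

end Operators

/-! ### The two assumptions on `L` -/

/-- The complex Hilbert space `L²(Ω)`. -/
abbrev L2 {d : ℕ} (Ω : Set (EuclideanSpace ℝ (Fin d))) : Type :=
  Lp ℂ 2 (volume.restrict Ω)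

/-- The Sobolev critical exponent `p^*`: `(d+2)/(d-2)` if `d ≥ 3` and `∞` if `d = 1, 2`. -/
def critExp (d : ℕ) : EReal :=
  if 3 ≤ d then ((((d : ℝ) + 2) / ((d : ℝ) - 2) : ℝ) : EReal) else ⊤

/-- `L` is self-adjoint on `L²(Ω)` and for any `2 ≤ q < p^* + 1` there are `C > 0`, `0 ≤ ω < 1`
with `‖e^{-tL}‖_{L² → L^q} ≤ C t^{-(d/2)(1/2-1/q)} e^{ωt}` for all `t > 0`. -/
def AssumptionA {d : ℕ} (Ω : Set (EuclideanSpace ℝ (Fin d))) (L : L2 Ω →ₗ.[ℂ] L2 Ω) : Prop :=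
  IsSelfAdjoint L ∧
  ∃ T : ℝ → L2 Ω →L[ℂ] L2 Ω, IsSemigroupOf L T ∧
    ∀ q : ℝ, 2 ≤ q → (q : EReal) < critExp d + 1 →
      ∃ C ω : ℝ, 0 < C ∧ 0 ≤ ω ∧ ω < 1 ∧
        ∀ t : ℝ, 0 < t → ∀ f : L2 Ω,
          eLpNorm (T t f) (ENNReal.ofReal q) (volume.restrict Ω) ≤
            ENNReal.ofReal
              (C * t ^ (-((d : ℝ) / 2 * (1 / 2 - 1 / q))) * Real.exp (ω * t)) * ‖f‖ₑ

/-- `L` is non-negative and self-adjoint on `L²(Ω)`, and `e^{-tL}` has an integral kernel `K t x y`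
with `|K t x y| ≤ C t^{-d/2} e^{-|x-y|²/(ct)}` for all `t > 0` and a.e. `x, y ∈ Ω`. -/
def AssumptionB {d : ℕ} (Ω : Set (EuclideanSpace ℝ (Fin d))) (L : L2 Ω →ₗ.[ℂ] L2 Ω) : Prop :=
  IsNonnegSelfAdjoint L ∧
  ∃ (T : ℝ → L2 Ω →L[ℂ] L2 Ω)
    (K : ℝ → EuclideanSpace ℝ (Fin d) → EuclideanSpace ℝ (Fin d) → ℂ),
    IsSemigroupOf L T ∧
    (∀ t : ℝ, 0 < t → AEStronglyMeasurable (Function.uncurry (K t))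
      ((volume.restrict Ω).prod (volume.restrict Ω))) ∧
    (∀ t : ℝ, 0 < t → ∀ f : L2 Ω, ∀ᵐ x ∂(volume.restrict Ω),
      (T t f : EuclideanSpace ℝ (Fin d) → ℂ) x = ∫ y in Ω, K t x y * f y) ∧
    ∃ c C : ℝ, 0 < c ∧ 0 < C ∧ ∀ t : ℝ, 0 < t →
      ∀ᵐ z ∂((volume.restrict Ω).prod (volume.restrict Ω)),
        ‖K t z.1 z.2‖ ≤ C * t ^ (-((d : ℝ) / 2)) * Real.exp (-(‖z.1 - z.2‖ ^ 2 / (c * t)))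

/-! ### The energy spaces -/

section Spaces

variable {d : ℕ} {Ω : Set (EuclideanSpace ℝ (Fin d))}

/-- `‖f‖_{H¹(L)} = ‖(I+L)^{1/2} f‖_{L²}` for `f ∈ L²(Ω)`; it is `∞` outside of the domain of
`(I+L)^{1/2}`. The space `H¹(L)` consists of the `f ∈ L²(Ω)` of finite norm. -/
def h1Norm (L : L2 Ω →ₗ.[ℂ] L2 Ω) (f : L2 Ω) : ℝ≥0∞ :=
  ⨅ (g : L2 Ω) (_ : (f, g) ∈ (opSqrt ((LinearMap.id : L2 Ω →ₗ[ℂ] L2 Ω) +ᵥ L)).graph), ‖g‖ₑ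

/-- The `L^q(Ω)` norm of `f ∈ L²(Ω)`, in `[0, ∞]`. -/
def lqNorm (q : ℝ≥0∞) (f : L2 Ω) : ℝ≥0∞ :=
  eLpNorm f q (volume.restrict Ω)

/-- The test space `𝒵(L)`, of all `f` with `L^m f ∈ L¹(Ω) ∩ D(L)` for every integer `m`. Its
elements are recorded as the whole sequence `F m = L^m f`, `m ∈ ℤ` (so `f = F 0`); the sequence is
determined by `f` when `L` is injective. -/
def TestSpace (L : L2 Ω →ₗ.[ℂ] L2 Ω) : Submodule ℂ (ℤ → L2 Ω) where
  carrier := {F | ∀ m : ℤ, (F m, F (m + 1)) ∈ L.graph ∧ MemLp (F m) 1 (volume.restrict Ω)}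
  add_mem' := by
    intro F G hF hG m
    refine ⟨L.graph.add_mem (hF m).1 (hG m).1, ?_⟩
    exact (memLp_congr_ae (Lp.coeFn_add (F m) (G m))).2 ((hF m).2.add (hG m).2)
  zero_mem' := by
    intro m
    refine ⟨L.graph.zero_mem, ?_⟩
    exact (memLp_congr_ae (Lp.coeFn_zero ℂ 2 (volume.restrict Ω))).2 MemLp.zero
  smul_mem' := by
    intro c F hF m
    refine ⟨L.graph.smul_mem c (hF m).1, ?_⟩
    exact (memLp_congr_ae (Lp.coeFn_smul c (F m))).2 ((hF m).2.const_smul c)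

/-- The topological dual `𝒵'(L)`: the conjugate-linear functionals on `𝒵(L)` that are continuous
for the topology given by the seminorms `f ↦ ‖L^m f‖_{L¹}`, `m ∈ ℤ`. A function `u` is seen as the
functional `f ↦ ∫ u · conj f`. -/
def TestDual (L : L2 Ω →ₗ.[ℂ] L2 Ω) :
    Submodule ℂ (TestSpace L →ₛₗ[starRingEnd ℂ] ℂ) where
  carrier := {φ | ∃ (C : ℝ) (n : ℤ), ∀ F : TestSpace L,
    ‖φ F‖ ≤ C * ∑ m ∈ Finset.Icc (-n) n, (eLpNorm (F.1 m) 1 (volume.restrict Ω)).toReal}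
  add_mem' := by
    rintro φ ψ ⟨C, n, h⟩ ⟨D, k, h'⟩
    refine ⟨|C| + |D|, max n k, fun F => ?_⟩
    have key : ∀ (E : ℝ) (i : ℤ), i ≤ max n k →
        E * ∑ m ∈ Finset.Icc (-i) i, (eLpNorm (F.1 m) 1 (volume.restrict Ω)).toReal ≤
        |E| * ∑ m ∈ Finset.Icc (-max n k) (max n k),
          (eLpNorm (F.1 m) 1 (volume.restrict Ω)).toReal := by
      intro E i hi
      refine mul_le_mul (le_abs_self E) ?_
        (Finset.sum_nonneg fun _ _ => ENNReal.toReal_nonneg) (abs_nonneg E)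
      exact Finset.sum_le_sum_of_subset_of_nonneg
        (Finset.Icc_subset_Icc (neg_le_neg hi) hi) (fun _ _ _ => ENNReal.toReal_nonneg)
    calc ‖(φ + ψ) F‖ ≤ ‖φ F‖ + ‖ψ F‖ := norm_add_le _ _
      _ ≤ _ := by
        rw [add_mul]
        exact add_le_add ((h F).trans (key C n (le_max_left _ _)))
          ((h' F).trans (key D k (le_max_right _ _)))
  zero_mem' := ⟨0, 0, fun F => by simp⟩
  smul_mem' := by
    rintro c φ ⟨C, n, h⟩
    refine ⟨‖c‖ * C, n, fun F => ?_⟩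
    calc ‖(c • φ) F‖ = ‖c‖ * ‖φ F‖ := by simp
      _ ≤ ‖c‖ * (C * _) := mul_le_mul_of_nonneg_left (h F) (norm_nonneg c)
      _ = _ := by ring

/-- `L^{1/2} φ = h` in `𝒵'(L)`, where `h ∈ L²(Ω)`: `⟨φ, L^{1/2} g⟩ = ⟨h, g⟩` for all `g` in the
domain of `L^{1/2}` with `L^{1/2} g ∈ 𝒵(L)`. -/
def IsSqrtImage (L : L2 Ω →ₗ.[ℂ] L2 Ω) (φ : TestDual L) (h : L2 Ω) : Prop :=
  ∀ (F : TestSpace L) (g : L2 Ω), (g, F.1 0) ∈ (opSqrt L).graph → φ.1 F = inner ℂ g h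

/-- `‖φ‖_{Ḣ¹(L)} = ‖L^{1/2} φ‖_{L²}` for `φ ∈ 𝒵'(L)`; it is `∞` if `L^{1/2} φ` is not in `L²(Ω)`.
The space `Ḣ¹(L)` consists of the `φ ∈ 𝒵'(L)` of finite norm. -/
def homH1Norm (L : L2 Ω →ₗ.[ℂ] L2 Ω) (φ : TestDual L) : ℝ≥0∞ :=
  ⨅ (h : L2 Ω) (_ : IsSqrtImage L φ h), ‖h‖ₑ

/-- The `L^q(Ω)` norm of `φ ∈ 𝒵'(L)`: the norm of the function `u ∈ L^q(Ω)` that represents `φ`,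
and `∞` if there is none. -/
def dualLpNorm (L : L2 Ω →ₗ.[ℂ] L2 Ω) (q : ℝ≥0∞) (φ : TestDual L) : ℝ≥0∞ :=
  ⨅ (u : Lp ℂ q (volume.restrict Ω))
    (_ : ∀ F : TestSpace L, φ.1 F = ∫ x in Ω, u x * starRingEnd ℂ (F.1 0 x)),
    eLpNorm u q (volume.restrict Ω)

end Spaces

/-! ### The variational quantities

`N` stands for the norm `‖·‖_{ℰ(L)}` of the energy space `ℰ(L) = {u | N u < ∞}` and `P` for the norm
of `L^{p+1}(Ω)`; both take values in `[0, ∞]` on an ambient vector space `V`. -/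

section Variational

variable {V : Type*} [AddCommGroup V] [Module ℂ V]

/-- `ℰ(L) \ {0}` -/
def energyPunctured (N : V → ℝ≥0∞) : Set V := {u | N u ≠ ∞ ∧ u ≠ 0}

/-- `E_L(u) = ½ ‖u‖_ℰ² - (p+1)⁻¹ ‖u‖_{L^{p+1}}^{p+1}` -/
def energy (N P : V → ℝ≥0∞) (p : ℝ) (u : V) : ℝ :=
  1 / 2 * (N u).toReal ^ 2 - 1 / (p + 1) * (P u).toReal ^ (p + 1)

/-- `J_L(u) = ‖u‖_ℰ² - ‖u‖_{L^{p+1}}^{p+1}` -/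
def nehariFunctional (N P : V → ℝ≥0∞) (p : ℝ) (u : V) : ℝ :=
  (N u).toReal ^ 2 - (P u).toReal ^ (p + 1)

/-- The Nehari manifold `𝒩_L`. -/
def nehariManifold (N P : V → ℝ≥0∞) (p : ℝ) : Set V :=
  {u | u ∈ energyPunctured N ∧ nehariFunctional N P p u = 0}

/-- The mountain pass level `l_L = inf_{u ∈ ℰ(L) \ {0}} sup_{s ≥ 0} E_L(s u)`, in `[-∞, ∞]`. -/
def mountainPassLevel (N P : V → ℝ≥0∞) (p : ℝ) : EReal :=
  ⨅ u ∈ energyPunctured N, ⨆ s ∈ Ici (0 : ℝ), (energy N P p ((s : ℂ) • u) : EReal)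

/-- The admissible constants in the Sobolev inequality `‖f‖_{L^{p+1}} ≤ C ‖f‖_ℰ`, `f ∈ ℰ(L)`. -/
def sobolevConstants (N P : V → ℝ≥0∞) : Set ℝ :=
  {C | 0 ≤ C ∧ ∀ f : V, N f ≠ ∞ → P f ≤ ENNReal.ofReal C * N f}

/-- The best constant `S_{p+1}` of the Sobolev inequality. -/
def sobolevBest (N P : V → ℝ≥0∞) : ℝ := sInf (sobolevConstants N P)

end Variational

end

/-! ### The variational problem -/

section VariationalProblem

/-! Along the ray through `u` the energy is `s²n²/2 - s^(p+1) b^(p+1)/(p+1)`, where `n` and `b` are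
the energy norm and the `L^(p+1)` norm of `u`. If both are positive and finite, the maximum is
reached where the ray meets the Nehari manifold, and equals `κ (n/b)^θ` with `κ = (p-1)/(2(p+1))`
and `θ = 2(p+1)/(p-1)`. Taking the infimum over `u` replaces `n/b` by the inverse of the best
Sobolev constant. This needs only homogeneity, definiteness, a non-trivial energy space and some
Sobolev inequality, the content of `IsSobolevPair`; the conclusion is `IsSobolevPair.mountainPass`.

The analytic work is the inequality `‖f‖_q ≤ K ‖M^(1/2) f‖_2`, with `q = p + 1`, `M = 1 + L` in the
subcritical case and `M = L` in the critical one. By duality it follows from `∫ |⟨v, e^(-tM) v⟩| dt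
≤ K² ‖v‖_r²`, with `r` conjugate to `q` (`IsSemigroupOf.eLpNorm_le_of_lintegral_inner_le`).

In the subcritical case the `L² → L^q` bound, used twice, gives an integrand of size `t^(-2γ)
e^(-(1-ω)t)`, and `2γ < 1` holds because `p < p*`. At the critical exponent `2γ = 1` and this
integral diverges. There the Gaussian kernel is used through a Hardy-Littlewood-Sobolev argument:
pairs `(x, y)` are split by the relative size of `v x` and `v y`, and the time integral is estimated
for each `x` separately (`IsUltracontractiveKernel.lintegral_lintegral_mul_le`).

In the critical case elements of the energy space are functionals, so the inequality is carried over
by approximation: the range of `L^(1/2)` is dense and the approximants converge in `L^q`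
(`exists_lp_limit`). Moreover the space could be trivial if the test space were;
`IsDominatedBy.exists_orbit` produces a non-zero test element by a Mittag-Leffler argument. -/

lemma exists_fibering_parameter {p n b : ℝ} (hp : 1 < p) (hn : 0 < n) (hb : 0 < b) :
    ∃ s₀ : ℝ, 0 < s₀ ∧ (s₀ * n) ^ 2 = (n / b) ^ (2 * (p + 1) / (p - 1)) ∧
      (s₀ * b) ^ (p + 1) = (n / b) ^ (2 * (p + 1) / (p - 1)) := by
  have h1 : p - 1 ≠ 0 := by linarith
  obtain ⟨x, rfl⟩ : ∃ x, n = Real.exp x := ⟨Real.log n, (Real.exp_log hn).symm⟩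
  obtain ⟨y, rfl⟩ : ∃ y, b = Real.exp y := ⟨Real.log b, (Real.exp_log hb).symm⟩
  -- This is `s₀ = (n² / b^(p+1))^(1/(p-1))`, the positive solution of `(s n)² = (s b)^(p+1)`. In
  -- exponential coordinates both identities become linear.
  refine ⟨Real.exp ((2 * x - (p + 1) * y) / (p - 1)), Real.exp_pos _, ?_, ?_⟩
  · rw [← Real.exp_sub, ← Real.exp_add, ← Real.exp_mul, ← Real.exp_nat_mul]
    congr 1; push_cast; field_simp; ring
  · rw [← Real.exp_sub, ← Real.exp_add, ← Real.exp_mul, ← Real.exp_mul]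
    congr 1; field_simp; ring

/-- In the variable `τ = s / s₀` the left side is `A (τ²/2 - τ^(p+1)/(p+1))`. Bernoulli's inequality
for `(τ²)^((p+1)/2)` about `τ² = 1` says that this is largest at `τ = 1`. -/
lemma fibering_le {p s₀ n b A s : ℝ} (hp : 1 < p) (hs₀ : 0 < s₀) (hb : 0 ≤ b)
    (h1 : (s₀ * n) ^ 2 = A) (h2 : (s₀ * b) ^ (p + 1) = A) (hs : 0 ≤ s) :
    1 / 2 * (s * n) ^ 2 - 1 / (p + 1) * (s * b) ^ (p + 1) ≤ (p - 1) / (2 * (p + 1)) * A := by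
  obtain ⟨τ, hτ, rfl⟩ : ∃ τ, 0 ≤ τ ∧ s = τ * s₀ := ⟨s / s₀, by positivity, by field_simp⟩
  have hA : 0 ≤ A := h1 ▸ sq_nonneg _
  rw [mul_assoc, mul_assoc, mul_pow, h1, Real.mul_rpow hτ (by positivity), h2]
  have hB := one_add_mul_self_le_rpow_one_add (s := τ ^ 2 - 1) (by nlinarith)
    (p := (p + 1) / 2) (by linarith)
  rw [add_sub_cancel, ← Real.rpow_natCast, ← Real.rpow_mul hτ] at hB
  rw [show ((2 : ℕ) : ℝ) * ((p + 1) / 2) = p + 1 by push_cast; ring] at hB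
  have h3 : (p - 1) / (2 * (p + 1)) * A - (1 / 2 * (τ ^ 2 * A) - 1 / (p + 1) * (τ ^ (p + 1) * A))
      = A / (p + 1) * (τ ^ (p + 1) - (1 + (p + 1) / 2 * (τ ^ 2 - 1))) := by
    field_simp; ring
  have h4 : 0 ≤ A / (p + 1) * (τ ^ (p + 1) - (1 + (p + 1) / 2 * (τ ^ 2 - 1))) := by
    refine mul_nonneg (by positivity) ?_
    have : τ ^ 2 = τ ^ ((2 : ℕ) : ℝ) := (Real.rpow_natCast _ _).symm
    rw [this]; linarith
  linarith

variable {V : Type*} [AddCommGroup V] [Module ℂ V] {N P : V → ℝ≥0∞}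

/-- The structural properties of the energy norm `N` and of the Lebesgue norm `P` on which the
variational characterisation of the mountain pass level rests. -/
structure IsSobolevPair (N P : V → ℝ≥0∞) : Prop where
  smul_left : ∀ s : ℝ, 0 < s → ∀ u, N ((s : ℂ) • u) = ENNReal.ofReal s * N u
  smul_right : ∀ s : ℝ, 0 < s → ∀ u, P ((s : ℂ) • u) = ENNReal.ofReal s * P u
  zero_left : N 0 = 0
  zero_right : P 0 = 0
  left_ne_zero : ∀ u ∈ energyPunctured N, N u ≠ 0
  right_ne_zero : ∀ u ∈ energyPunctured N, P u ≠ 0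
  nonempty : (energyPunctured N).Nonempty
  bounded : ∃ C : ℝ, 0 ≤ C ∧ ∀ f, N f ≠ ∞ → P f ≤ ENNReal.ofReal C * N f

namespace IsSobolevPair

lemma right_ne_top (h : IsSobolevPair N P) {u : V} (hu : N u ≠ ∞) : P u ≠ ∞ := by
  obtain ⟨C, -, hC⟩ := h.bounded
  exact ne_top_of_le_ne_top (ENNReal.mul_ne_top ENNReal.ofReal_ne_top hu) (hC u hu)

lemma left_pos (h : IsSobolevPair N P) {u : V} (hu : u ∈ energyPunctured N) : 0 < (N u).toReal :=
  ENNReal.toReal_pos (h.left_ne_zero u hu) hu.1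

lemma right_pos (h : IsSobolevPair N P) {u : V} (hu : u ∈ energyPunctured N) :
    0 < (P u).toReal :=
  ENNReal.toReal_pos (h.right_ne_zero u hu) (h.right_ne_top hu.1)

lemma mem_sobolevConstants_iff (h : IsSobolevPair N P) {C : ℝ} :
    C ∈ sobolevConstants N P ↔
      0 ≤ C ∧ ∀ u ∈ energyPunctured N, (P u).toReal ≤ C * (N u).toReal := by
  refine and_congr_right fun hC => ⟨fun H u hu => ?_, fun H u hu => ?_⟩
  · have := ENNReal.toReal_mono (ENNReal.mul_ne_top ENNReal.ofReal_ne_top hu.1) (H u hu.1)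
    rwa [ENNReal.toReal_mul, ENNReal.toReal_ofReal hC] at this
  · rcases eq_or_ne u 0 with rfl | h0
    · simp [h.zero_right]
    · have := H u ⟨hu, h0⟩
      rw [← ENNReal.ofReal_toReal (h.right_ne_top hu), ← ENNReal.ofReal_toReal hu,
        ← ENNReal.ofReal_mul hC]
      exact ENNReal.ofReal_le_ofReal this

/-- Admissible constants are the non-negative upper bounds of the quotients `P u / N u`, so they
form a closed half-line and the infimum is attained. -/
lemma isLeast_sobolevBest (h : IsSobolevPair N P) :
    IsLeast (sobolevConstants N P) (sobolevBest N P) := by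
  have hne : (sobolevConstants N P).Nonempty := h.bounded
  have hbd : BddBelow (sobolevConstants N P) := ⟨0, fun C hC => hC.1⟩
  refine ⟨h.mem_sobolevConstants_iff.2 ⟨le_csInf hne fun C hC => hC.1, fun u hu => ?_⟩,
    fun C hC => csInf_le hbd hC⟩
  rw [← div_le_iff₀ (h.left_pos hu)]
  refine le_csInf hne fun C hC => ?_
  rw [div_le_iff₀ (h.left_pos hu)]
  exact (h.mem_sobolevConstants_iff.1 hC).2 u hu

lemma sobolevBest_pos (h : IsSobolevPair N P) : 0 < sobolevBest N P := by
  obtain ⟨u, hu⟩ := h.nonempty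
  have := (h.mem_sobolevConstants_iff.1 h.isLeast_sobolevBest.1).2 u hu
  by_contra hS
  nlinarith [h.left_pos hu, h.right_pos hu]

lemma energy_smul (h : IsSobolevPair N P) {p s : ℝ} (hp : 1 < p) (hs : 0 ≤ s) (u : V) :
    energy N P p ((s : ℂ) • u) =
      1 / 2 * (s * (N u).toReal) ^ 2 - 1 / (p + 1) * (s * (P u).toReal) ^ (p + 1) := by
  -- Homogeneity is only postulated for `s > 0`; at `s = 0` the values of the norms at zero are
  -- used.
  rcases hs.eq_or_lt with rfl | hs'
  · simp [energy, h.zero_left, h.zero_right, Real.zero_rpow (show p + 1 ≠ 0 by linarith)]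
  · rw [energy, h.smul_left s hs', h.smul_right s hs', ENNReal.toReal_mul, ENNReal.toReal_mul,
      ENNReal.toReal_ofReal hs]

lemma smul_mem (h : IsSobolevPair N P) {s : ℝ} (hs : 0 < s) {u : V}
    (hu : u ∈ energyPunctured N) : (s : ℂ) • u ∈ energyPunctured N := by
  refine ⟨?_, smul_ne_zero (by exact_mod_cast hs.ne') hu.2⟩
  rw [h.smul_left s hs]
  exact ENNReal.mul_ne_top ENNReal.ofReal_ne_top hu.1

/-- The maximum of the energy along a ray. -/
lemma exists_isMaxOn (h : IsSobolevPair N P) {p : ℝ} (hp : 1 < p) {u : V}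
    (hu : u ∈ energyPunctured N) :
    ∃ s₀ : ℝ, 0 < s₀ ∧ IsMaxOn (fun s : ℝ => energy N P p ((s : ℂ) • u)) (Ici 0) s₀ ∧
      (s₀ : ℂ) • u ∈ nehariManifold N P p ∧ energy N P p ((s₀ : ℂ) • u) =
        (p - 1) / (2 * (p + 1)) *
          ((N u).toReal / (P u).toReal) ^ (2 * (p + 1) / (p - 1)) := by
  obtain ⟨s₀, hs₀, h1, h2⟩ := exists_fibering_parameter hp (h.left_pos hu) (h.right_pos hu)
  have hE : energy N P p ((s₀ : ℂ) • u) = (p - 1) / (2 * (p + 1)) *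
      ((N u).toReal / (P u).toReal) ^ (2 * (p + 1) / (p - 1)) := by
    rw [h.energy_smul hp hs₀.le, h1, h2]
    have : p + 1 ≠ 0 := by linarith
    field_simp; ring
  refine ⟨s₀, hs₀, fun s hs => ?_, ⟨h.smul_mem hs₀ hu, ?_⟩, hE⟩
  · simp only [mem_ofPred_eq]
    rw [hE, h.energy_smul hp hs]
    exact fibering_le hp hs₀ ENNReal.toReal_nonneg h1 h2 hs
  · rw [nehariFunctional, h.smul_left s₀ hs₀, h.smul_right s₀ hs₀, ENNReal.toReal_mul,
      ENNReal.toReal_mul, ENNReal.toReal_ofReal hs₀.le, h1, h2, sub_self]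

lemma iSup_energy_smul (h : IsSobolevPair N P) {p : ℝ} (hp : 1 < p) {u : V}
    (hu : u ∈ energyPunctured N) :
    ⨆ s ∈ Ici (0 : ℝ), (energy N P p ((s : ℂ) • u) : EReal) =
      (((p - 1) / (2 * (p + 1)) *
        ((N u).toReal / (P u).toReal) ^ (2 * (p + 1) / (p - 1)) : ℝ) : EReal) := by
  obtain ⟨s₀, hs₀, hmax, -, hE⟩ := h.exists_isMaxOn hp hu
  rw [← hE]
  refine le_antisymm (iSup₂_le fun s hs => EReal.coe_le_coe_iff.2 (hmax hs)) ?_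
  exact le_iSup₂_of_le (f := fun (s : ℝ) _ => (energy N P p ((s : ℂ) • u) : EReal)) s₀ hs₀.le le_rfl

/-- A point of the Nehari manifold maximises the energy on its own ray, with parameter `s₀ = 1`, and
every ray through a non-zero element of finite energy norm meets the manifold. -/
lemma mountainPassLevel_eq_iInf_nehari (h : IsSobolevPair N P) {p : ℝ} (hp : 1 < p) :
    mountainPassLevel N P p = ⨅ f ∈ nehariManifold N P p, (energy N P p f : EReal) := by
  refine le_antisymm (le_iInf₂ fun f hf => ?_) (le_iInf₂ fun u hu => ?_)
  · refine iInf₂_le_of_le f hf.1 (iSup₂_le fun s hs => EReal.coe_le_coe_iff.2 ?_)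
    have hJ : (N f).toReal ^ 2 = (P f).toReal ^ (p + 1) := sub_eq_zero.1 hf.2
    rw [h.energy_smul hp hs]
    refine (fibering_le hp one_pos ENNReal.toReal_nonneg (by rw [one_mul])
      (by rw [one_mul, ← hJ]) hs).trans (le_of_eq ?_)
    rw [energy, ← hJ]
    have : p + 1 ≠ 0 := by linarith
    field_simp; ring
  · obtain ⟨s₀, hs₀, -, hmem, -⟩ := h.exists_isMaxOn hp hu
    exact iInf₂_le_of_le _ hmem
      (le_iSup₂_of_le (f := fun (s : ℝ) _ => (energy N P p ((s : ℂ) • u) : EReal)) s₀ hs₀.le le_rfl)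

lemma mountainPassLevel_eq_sobolevBest (h : IsSobolevPair N P) {p : ℝ} (hp : 1 < p) :
    mountainPassLevel N P p = (((p - 1) / (2 * (p + 1)) *
      sobolevBest N P ^ (-(2 * (p + 1) / (p - 1))) : ℝ) : EReal) := by
  have hS := h.sobolevBest_pos
  have hθ : 0 < 2 * (p + 1) / (p - 1) := div_pos (by linarith) (by linarith)
  set θ := 2 * (p + 1) / (p - 1)
  have hκ : 0 < (p - 1) / (2 * (p + 1)) := div_pos (by linarith) (by linarith)
  set κ := (p - 1) / (2 * (p + 1))
  have hinv : ∀ x : ℝ, 0 < x → x ^ (-θ) = x⁻¹ ^ θ := fun x hx => by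
    rw [Real.rpow_neg hx.le, Real.inv_rpow hx.le]
  refine le_antisymm ?_ (le_iInf₂ fun u hu => ?_)
  -- The Sobolev quotient need not be maximised by any `u`. For a level `c` above the claimed value,
  -- continuity gives `C` below the best constant with `κ C^(-θ) < c`; as `C` is not admissible,
  -- some `u` violates its inequality, and the maximum on its ray is at most `c`.
  · refine EReal.le_of_forall_lt_iff_le.1 fun c hc => ?_
    have hlt : κ * sobolevBest N P ^ (-θ) < c := by exact_mod_cast hc
    have hcont : ContinuousAt (fun x : ℝ => κ * x ^ (-θ)) (sobolevBest N P) :=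
      (Real.continuousAt_rpow_const _ _ (Or.inl hS.ne')).const_mul κ
    obtain ⟨C, ⟨hCc, hC0⟩, hCS⟩ := (((hcont.eventually_lt_const hlt).and
      (lt_mem_nhds hS)).filter_mono nhdsWithin_le_nhds |>.and
      (self_mem_nhdsWithin : Iio (sobolevBest N P) ∈ 𝓝[<] _)).exists
    have hnot : C ∉ sobolevConstants N P := fun hC =>
      absurd (h.isLeast_sobolevBest.2 hC) (not_le.2 hCS)
    rw [h.mem_sobolevConstants_iff] at hnot
    push Not at hnot
    obtain ⟨u, hu, hlt'⟩ := hnot hC0.le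
    refine iInf₂_le_of_le u hu ?_
    rw [h.iSup_energy_smul hp hu]
    refine EReal.coe_le_coe_iff.2 (le_trans ?_ hCc.le)
    rw [hinv C hC0]
    have := h.right_pos hu
    have := h.left_pos hu
    refine mul_le_mul_of_nonneg_left (Real.rpow_le_rpow (by positivity) ?_ hθ.le) hκ.le
    rw [div_le_iff₀ (h.right_pos hu), inv_mul_eq_div, le_div_iff₀ hC0]
    linarith
  · rw [h.iSup_energy_smul hp hu, EReal.coe_le_coe_iff, hinv _ hS]
    have := h.right_pos hu
    refine mul_le_mul_of_nonneg_left (Real.rpow_le_rpow (by positivity) ?_ hθ.le) hκ.le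
    rw [le_div_iff₀ this, inv_mul_eq_div, div_le_iff₀ hS, mul_comm]
    exact (h.mem_sobolevConstants_iff.1 h.isLeast_sobolevBest.1).2 u hu

/-- The mountain pass level, the Nehari level and the best Sobolev constant. -/
theorem mountainPass (h : IsSobolevPair N P) {p : ℝ} (hp : 1 < p) :
    IsLeast (sobolevConstants N P) (sobolevBest N P) ∧ 0 < sobolevBest N P ∧
      (∀ u ∈ energyPunctured N,
        ∃ s₀ ∈ Ici (0 : ℝ), IsMaxOn (fun s : ℝ => energy N P p ((s : ℂ) • u)) (Ici 0) s₀) ∧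
      mountainPassLevel N P p = ⨅ f ∈ nehariManifold N P p, (energy N P p f : EReal) ∧
      mountainPassLevel N P p =
        (((p - 1) / (2 * (p + 1)) *
          sobolevBest N P ^ (-(2 * (p + 1) / (p - 1))) : ℝ) : EReal) := by
  refine ⟨h.isLeast_sobolevBest, h.sobolevBest_pos, fun u hu => ?_,
    h.mountainPassLevel_eq_iInf_nehari hp, h.mountainPassLevel_eq_sobolevBest hp⟩
  obtain ⟨s₀, hs₀, hmax, -, -⟩ := h.exists_isMaxOn hp hu
  exact ⟨s₀, hs₀.le, hmax⟩

end IsSobolevPair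

end VariationalProblem

/-! ### Self-adjoint operators, resolvents and square roots -/

section SelfAdjointOperators

variable {H : Type*} [NormedAddCommGroup H] [InnerProductSpace ℂ H] [CompleteSpace H]

local notation "⟪" x ", " y "⟫" => inner ℂ x y

/-- Self-adjointness in terms of the graph. -/
lemma LinearPMap.isSelfAdjoint_iff_graph {A : H →ₗ.[ℂ] H} :
    IsSelfAdjoint A ↔ Dense (A.domain : Set H) ∧
      ∀ x y : H, (x, y) ∈ A.graph ↔ ∀ a b : H, (a, b) ∈ A.graph → ⟪b, x⟫ = ⟪a, y⟫ := by
  have key : Dense (A.domain : Set H) → ∀ x y : H, (x, y) ∈ (LinearPMap.adjoint A).graph ↔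
      ∀ a b : H, (a, b) ∈ A.graph → ⟪b, x⟫ = ⟪a, y⟫ := fun hd x y => by
    rw [LinearPMap.adjoint_graph_eq_graph_adjoint hd, Submodule.mem_adjoint_iff]
    simp only [sub_eq_zero]
  constructor
  · intro hA
    refine ⟨hA.dense_domain, fun x y => ?_⟩
    rw [← key hA.dense_domain, LinearPMap.isSelfAdjoint_def.1 hA]
  · rintro ⟨hd, h⟩
    rw [LinearPMap.isSelfAdjoint_def]
    refine LinearPMap.eq_of_eq_graph ?_
    ext ⟨x, y⟩
    rw [key hd, h]

lemma IsSelfAdjoint.inner_graph {A : H →ₗ.[ℂ] H} (hA : IsSelfAdjoint A) {a b x y : H}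
    (hab : (a, b) ∈ A.graph) (hxy : (x, y) ∈ A.graph) : ⟪b, x⟫ = ⟪a, y⟫ :=
  ((LinearPMap.isSelfAdjoint_iff_graph.1 hA).2 x y).1 hxy a b hab

lemma LinearPMap.mem_graph_id_vadd {A : H →ₗ.[ℂ] H} {x y : H} :
    (x, y) ∈ ((LinearMap.id : H →ₗ[ℂ] H) +ᵥ A).graph ↔ (x, y - x) ∈ A.graph := by
  simp only [LinearPMap.mem_graph_iff]
  constructor
  · rintro ⟨z, rfl, rfl⟩
    exact ⟨z, rfl, by simp [LinearPMap.vadd_apply]⟩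
  · rintro ⟨z, rfl, h⟩
    exact ⟨z, rfl, by simp [LinearPMap.vadd_apply, h]⟩

lemma IsNonnegSelfAdjoint.re_inner_nonneg {A : H →ₗ.[ℂ] H} (hA : IsNonnegSelfAdjoint A) {x y : H}
    (h : (x, y) ∈ A.graph) : 0 ≤ (⟪x, y⟫).re := by
  obtain ⟨z, rfl, rfl⟩ := (LinearPMap.mem_graph_iff _).1 h
  have := hA.2 z
  rwa [← inner_conj_symm, Complex.conj_re] at this

lemma IsSelfAdjoint.isNonneg_of_graph {A : H →ₗ.[ℂ] H} (hA : IsSelfAdjoint A)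
    (h : ∀ x y : H, (x, y) ∈ A.graph → 0 ≤ (⟪x, y⟫).re) : IsNonnegSelfAdjoint A := by
  refine ⟨hA, fun x => ?_⟩
  rw [← inner_conj_symm, Complex.conj_re]
  exact h _ _ (A.mem_graph x)

/-- The sum of the identity and a self-adjoint operator is self-adjoint. -/
lemma IsSelfAdjoint.id_vadd {A : H →ₗ.[ℂ] H} (hA : IsSelfAdjoint A) :
    IsSelfAdjoint ((LinearMap.id : H →ₗ[ℂ] H) +ᵥ A) := by
  rw [LinearPMap.isSelfAdjoint_iff_graph] at hA ⊢
  refine ⟨hA.1, fun x y => ?_⟩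
  rw [LinearPMap.mem_graph_id_vadd, hA.2]
  constructor
  · intro h a b hab
    have := h a _ (LinearPMap.mem_graph_id_vadd.1 hab)
    rwa [inner_sub_left, inner_sub_right, sub_left_inj] at this
  · intro h a b hab
    have := h a (b + a) (LinearPMap.mem_graph_id_vadd.2 (by simpa using hab))
    rw [inner_add_left] at this
    rw [inner_sub_right, ← this, add_sub_cancel_right]

/-- `R` is the resolvent `(ε + A)⁻¹`. -/
structure IsResolvent (A : H →ₗ.[ℂ] H) (ε : ℝ) (R : H →L[ℂ] H) : Prop where
  mem_graph : ∀ v, (R v, v - (ε : ℂ) • R v) ∈ A.graph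
  apply_eq : ∀ f g, (f, g) ∈ A.graph → R ((ε : ℂ) • f + g) = f

lemma norm_sq_add_le_of_re_inner_nonneg {f g : H} {ε : ℝ} (hε : 0 < ε) (h : 0 ≤ (⟪f, g⟫).re) :
    ε ^ 2 * ‖f‖ ^ 2 + ‖g‖ ^ 2 ≤ ‖(ε : ℂ) • f + g‖ ^ 2 := by
  rw [@norm_add_sq ℂ, norm_smul, inner_smul_left]
  simp only [Complex.norm_real, Real.norm_eq_abs, Complex.conj_ofReal, RCLike.re_to_complex,
    Complex.re_ofReal_mul, mul_pow, sq_abs]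
  nlinarith [mul_nonneg hε.le h]

/-- Non-negative self-adjoint operators have resolvents `(ε + A)⁻¹` for all `ε > 0`. -/
lemma IsNonnegSelfAdjoint.exists_isResolvent {A : H →ₗ.[ℂ] H} (hA : IsNonnegSelfAdjoint A)
    {ε : ℝ} (hε : 0 < ε) : ∃ R, IsResolvent A ε R := by
  have hcl : IsClosed (A.graph : Set (H × H)) := hA.1.isClosed
  have : CompleteSpace A.graph := hcl.completeSpace_coe
  -- `ε + A` becomes a bounded operator on the complete space `A.graph`. Positivity bounds it from
  -- below, so it is injective with closed range.
  let Λ : A.graph →L[ℂ] H :=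
    (((ε : ℂ) • ContinuousLinearMap.fst ℂ H H) + ContinuousLinearMap.snd ℂ H H).comp
      A.graph.subtypeL
  have hΛ : ∀ z : A.graph, Λ z = (ε : ℂ) • z.1.1 + z.1.2 := fun z => rfl
  have hnn : ∀ z : A.graph, 0 ≤ (⟪z.1.1, z.1.2⟫).re := fun z => hA.re_inner_nonneg z.2
  have hanti : AntilipschitzWith (Real.toNNReal (max ε⁻¹ 1)) Λ := by
    refine Λ.antilipschitz_of_bound fun z => ?_
    rw [Real.coe_toNNReal _ (le_max_of_le_right zero_le_one), hΛ]
    have h := norm_sq_add_le_of_re_inner_nonneg hε (hnn z)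
    have h1 : ε * ‖z.1.1‖ ≤ ‖(ε : ℂ) • z.1.1 + z.1.2‖ :=
      abs_le_of_sq_le_sq' (by nlinarith [sq_nonneg ‖z.1.2‖]) (norm_nonneg _) |>.2
    have h2 : ‖z.1.2‖ ≤ ‖(ε : ℂ) • z.1.1 + z.1.2‖ :=
      abs_le_of_sq_le_sq' (by nlinarith [mul_nonneg (sq_nonneg ε) (sq_nonneg ‖z.1.1‖)])
        (norm_nonneg _) |>.2
    refine max_le (c := max ε⁻¹ 1 * _) ?_ ?_
    · calc ‖z.1.1‖ = ε⁻¹ * (ε * ‖z.1.1‖) := by field_simp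
        _ ≤ max ε⁻¹ 1 * _ := mul_le_mul (le_max_left _ _) h1 (by positivity) (by positivity)
    · calc ‖z.1.2‖ = 1 * ‖z.1.2‖ := (one_mul _).symm
        _ ≤ max ε⁻¹ 1 * _ := mul_le_mul (le_max_right _ _) h2 (by positivity) (by positivity)
  have hinj : Λ.ker = ⊥ := LinearMap.ker_eq_bot.2 hanti.injective
  have hrange : Λ.range = ⊤ := by
    have hc : IsClosed (Λ.range : Set H) := by
      exact hanti.isClosed_range Λ.uniformContinuous
    have : CompleteSpace Λ.range := hc.completeSpace_coe
    rw [← Submodule.orthogonal_eq_bot_iff, Submodule.eq_bot_iff]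
    intro v hv
    have hv' : ∀ a b, (a, b) ∈ A.graph → ⟪(ε : ℂ) • a + b, v⟫ = 0 := fun a b hab =>
      (Submodule.mem_orthogonal _ _).1 hv _ ⟨⟨(a, b), hab⟩, rfl⟩
    -- A vector orthogonal to the range of `ε + A` satisfies `A v = -ε v` by self-adjointness, and
    -- non-negativity then forces `v = 0`.
    have hg : (v, -((ε : ℂ) • v)) ∈ A.graph := by
      rw [(LinearPMap.isSelfAdjoint_iff_graph.1 hA.1).2]
      intro a b hab
      have := hv' a b hab
      rw [inner_add_left, inner_smul_left, Complex.conj_ofReal] at this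
      rw [inner_neg_right, inner_smul_right]
      linear_combination this
    have h1 := hA.re_inner_nonneg hg
    rw [inner_neg_right, inner_smul_right, inner_self_eq_norm_sq_to_K] at h1
    have h2 : (((ε : ℂ) * ((‖v‖ : ℝ) : ℂ) ^ 2)).re = ε * ‖v‖ ^ 2 := by norm_cast
    rw [Complex.neg_re] at h1
    have h3 : 0 ≤ -(ε * ‖v‖ ^ 2) := by rw [← h2]; exact h1
    have h4 : ‖v‖ ^ 2 ≤ 0 := by nlinarith [sq_nonneg ‖v‖]
    exact norm_eq_zero.1 (pow_eq_zero_iff two_ne_zero |>.1 (le_antisymm h4 (sq_nonneg _)))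
  let e := ContinuousLinearEquiv.ofBijective Λ hinj hrange
  have he : ∀ z, e z = (ε : ℂ) • z.1.1 + z.1.2 := fun z => rfl
  refine ⟨(ContinuousLinearMap.fst ℂ H H).comp (A.graph.subtypeL.comp
    (e.symm : H →L[ℂ] A.graph)), fun v => ?_, fun f g hfg => ?_⟩
  · have h1 : v - (ε : ℂ) • (e.symm v).1.1 = (e.symm v).1.2 := by
      rw [sub_eq_iff_eq_add', ← he, e.apply_symm_apply]
    have h2 := (e.symm v).2
    simp only [ContinuousLinearMap.comp_apply, ContinuousLinearEquiv.coe_coe,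
      Submodule.subtypeL_apply, ContinuousLinearMap.coe_fst', h1]
    exact h2
  · have h1 : e.symm ((ε : ℂ) • f + g) = ⟨(f, g), hfg⟩ := by
      rw [ContinuousLinearEquiv.symm_apply_eq]; rfl
    exact congrArg (fun z : A.graph => z.1.1) h1

namespace IsResolvent

variable {A : H →ₗ.[ℂ] H} {ε μ : ℝ} {R S : H →L[ℂ] H}

lemma apply_eq_of_mem (h : IsResolvent A ε R) {f v : H} (hf : (f, v - (ε : ℂ) • f) ∈ A.graph) :
    R v = f := by simpa using h.apply_eq _ _ hf

lemma eq_zero_of_apply_eq_zero (h : IsResolvent A ε R) {v : H} (hv : R v = 0) : v = 0 := by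
  have := h.mem_graph v
  rw [hv, smul_zero, sub_zero] at this
  exact A.graph_fst_eq_zero_snd this rfl

/-- The resolvent identity. -/
lemma sub_eq (h : IsResolvent A ε R) (h' : IsResolvent A μ S) (v : H) :
    R v - S v = ((μ - ε : ℝ) : ℂ) • R (S v) := by
  have h1 := A.graph.sub_mem (h.mem_graph v) (h'.mem_graph v)
  rw [← map_smul]
  refine (h.apply_eq _ _ h1).symm.trans (congrArg R ?_)
  push_cast
  module

/-- The resolvent identity with the two roles exchanged expresses `R S` and `S R` through the same
difference. It carries no information when `ε = μ`, where the resolvents coincide. -/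
lemma commute (h : IsResolvent A ε R) (h' : IsResolvent A μ S) : R * S = S * R := by
  rcases eq_or_ne ε μ with rfl | hne
  · have : R = S := by ext v; rw [h.apply_eq_of_mem (h'.mem_graph v)]
    rw [this]
  ext v
  have h1 := h.sub_eq h' v
  have h2 := h'.sub_eq h v
  have h3 : ((μ - ε : ℝ) : ℂ) • (R (S v) - S (R v)) = 0 := by
    rw [smul_sub, ← h1, show (μ - ε : ℝ) = -(ε - μ) by ring, Complex.ofReal_neg, neg_smul, ← h2]
    abel
  have h4 : ((μ - ε : ℝ) : ℂ) ≠ 0 := by exact_mod_cast sub_ne_zero.2 hne.symm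
  exact sub_eq_zero.1 ((smul_eq_zero.1 h3).resolve_left h4)

lemma inner_symm (h : IsResolvent A ε R) (hA : IsSelfAdjoint A) (u v : H) :
    ⟪R u, v⟫ = ⟪u, R v⟫ := by
  have := hA.inner_graph (h.mem_graph u) (h.mem_graph v)
  rw [inner_sub_left, inner_sub_right, inner_smul_left, inner_smul_right,
    Complex.conj_ofReal, sub_left_inj] at this
  exact this.symm

lemma re_inner_nonneg (h : IsResolvent A ε R) (hA : IsNonnegSelfAdjoint A) (hε : 0 ≤ ε) (v : H) :
    0 ≤ (⟪R v, v⟫).re := by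
  have h1 := hA.re_inner_nonneg (h.mem_graph v)
  rw [inner_sub_right, inner_smul_right, Complex.sub_re, Complex.re_ofReal_mul] at h1
  have h2 : 0 ≤ (⟪R v, R v⟫).re := inner_self_nonneg (𝕜 := ℂ)
  nlinarith [mul_nonneg hε h2]

/-- This gives `R ≤ 1`: the quantity equals `⟨v - R v, R v⟩ + ‖v - R v‖²`, whose first term is the
quadratic form of `A` at `R v`. -/
lemma re_inner_sub_nonneg (h : IsResolvent A 1 R) (hA : IsNonnegSelfAdjoint A) (v : H) :
    0 ≤ (⟪v - R v, v⟫).re := by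
  have h0 := h.mem_graph v
  rw [Complex.ofReal_one, one_smul] at h0
  have h1 := hA.re_inner_nonneg h0
  rw [← inner_conj_symm, Complex.conj_re] at h1
  have h2 : 0 ≤ (⟪v - R v, v - R v⟫).re := inner_self_nonneg (𝕜 := ℂ)
  rw [inner_sub_right, Complex.sub_re] at h2
  linarith

end IsResolvent

/-- Non-negative self-adjoint operators have non-negative self-adjoint square roots. -/
lemma IsNonnegSelfAdjoint.exists_isOpSqrt {M : H →ₗ.[ℂ] H} (hM : IsNonnegSelfAdjoint M) :
    ∃ B, IsOpSqrt M B := by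
  obtain ⟨R, hR⟩ := hM.exists_isResolvent one_pos
  have hR0 : 0 ≤ R := by
    rw [ContinuousLinearMap.nonneg_iff_isPositive]
    exact ⟨fun u v => hR.inner_symm hM.1 u v, fun v => hR.re_inner_nonneg hM zero_le_one v⟩
  have hR1 : R ≤ 1 := by
    rw [ContinuousLinearMap.le_def]
    refine ⟨fun u v => ?_, fun v => hR.re_inner_sub_nonneg hM v⟩
    simpa [inner_sub_left, inner_sub_right] using hR.inner_symm hM.1 u v
  have hsa : IsSelfAdjoint R := IsSelfAdjoint.of_nonneg hR0
  have hs0 : ∀ x ∈ spectrum ℝ R, 0 ≤ x := fun x hx => spectrum_nonneg_of_nonneg hR0 hx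
  have hs1 : ∀ x ∈ spectrum ℝ R, x ≤ 1 := by
    have h := cfc_le_one_iff (fun x : ℝ => x) R
    rw [cfc_id' ℝ R] at h
    exact h.1 hR1
  -- With `R = (1 + M)⁻¹` one has `M = (1 - R) R⁻¹`, so the root should be `√(1 - R) (√R)⁻¹`. The
  -- bounded calculus of `R` supplies both factors, and the unbounded root is described by the graph
  -- of all `(A z, C z)`.
  set A : H →L[ℂ] H := cfc (fun x : ℝ => √x) R with hAdef
  set C : H →L[ℂ] H := cfc (fun x : ℝ => √(1 - x)) R with hCdef
  have hc1 : ContinuousOn (fun x : ℝ => √x) (spectrum ℝ R) := by fun_prop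
  have hc2 : ContinuousOn (fun x : ℝ => √(1 - x)) (spectrum ℝ R) := by fun_prop
  have hAA : A * A = R := by
    rw [hAdef, ← cfc_mul _ _ R hc1 hc1]
    conv_rhs => rw [← cfc_id' ℝ R]
    exact cfc_congr fun x hx => Real.mul_self_sqrt (hs0 x hx)
  have hCC : C * C = 1 - R := by
    rw [hCdef, ← cfc_mul _ _ R hc2 hc2]
    have : (1 : H →L[ℂ] H) - R = cfc (fun x : ℝ => 1 - x) R := by
      rw [cfc_sub (fun _ : ℝ => 1) (fun x => x) R, cfc_const_one ℝ R, cfc_id' ℝ R]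
    rw [this]
    exact cfc_congr fun x hx => Real.mul_self_sqrt (sub_nonneg.2 (hs1 x hx))
  have hAC : A * C = C * A := by
    rw [hAdef, hCdef, ← cfc_mul _ _ R hc1 hc2, ← cfc_mul _ _ R hc2 hc1]
    exact cfc_congr fun x _ => mul_comm _ _
  have hAC0 : 0 ≤ A * C := by
    rw [hAdef, hCdef, ← cfc_mul _ _ R hc1 hc2]
    exact cfc_nonneg fun x _ => by positivity
  have hAsym : ∀ u v, ⟪A u, v⟫ = ⟪u, A v⟫ := by
    have h : IsSelfAdjoint A := cfc_predicate _ R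
    exact (ContinuousLinearMap.isSelfAdjoint_iff_isSymmetric.1 h)
  have hCsym : ∀ u v, ⟪C u, v⟫ = ⟪u, C v⟫ := by
    have h : IsSelfAdjoint C := cfc_predicate _ R
    exact (ContinuousLinearMap.isSelfAdjoint_iff_isSymmetric.1 h)
  have eAA : ∀ u, A (A u) = R u := fun u => congrArg (fun T : H →L[ℂ] H => T u) hAA
  have eCC : ∀ u, C (C u) = u - R u := fun u => congrArg (fun T : H →L[ℂ] H => T u) hCC
  have eAC : ∀ u, A (C u) = C (A u) := fun u => congrArg (fun T : H →L[ℂ] H => T u) hAC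
  let G : Submodule ℂ (H × H) := (A.prod C).range
  have hGmem : ∀ x y, (x, y) ∈ G ↔ ∃ z, A z = x ∧ C z = y := fun x y => by
    simp [G]
  have hG : ∀ x ∈ G, x.1 = 0 → x.2 = 0 := by
    rintro ⟨x, y⟩ hxy (rfl : x = 0)
    obtain ⟨z, hz, rfl⟩ := (hGmem _ _).1 hxy
    have : R z = 0 := by rw [← eAA, hz, map_zero]
    rw [hR.eq_zero_of_apply_eq_zero this, map_zero]
  have hgraph : ∀ x y, (x, y) ∈ G.toLinearPMap.graph ↔ ∃ z, A z = x ∧ C z = y := fun x y => by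
    rw [Submodule.toLinearPMap_graph_eq G hG, hGmem]
  have hMgraph : ∀ x y, (x, y) ∈ M.graph ↔ ∃ z, R z = x ∧ z - R z = y := fun x y => by
    constructor
    · intro h
      refine ⟨x + y, ?_, ?_⟩ <;>
      · have := hR.apply_eq _ _ h
        simp only [Complex.ofReal_one, one_smul] at this
        simp [this]
    · rintro ⟨z, rfl, rfl⟩
      simpa using hR.mem_graph z
  refine ⟨G.toLinearPMap, IsSelfAdjoint.isNonneg_of_graph ?_ ?_, fun x y => ?_⟩
  · rw [LinearPMap.isSelfAdjoint_iff_graph]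
    constructor
    · refine hM.1.dense_domain.mono fun x hx => ?_
      obtain ⟨y, hy⟩ := LinearPMap.mem_domain_iff.1 hx
      obtain ⟨z, rfl, -⟩ := (hMgraph _ _).1 hy
      exact LinearPMap.mem_domain_iff.2 ⟨_, (hgraph _ _).2 ⟨A z, eAA z, rfl⟩⟩
    · intro x y
      rw [hgraph]
      constructor
      · rintro ⟨z, rfl, rfl⟩ a b hab
        obtain ⟨w, rfl, rfl⟩ := (hgraph _ _).1 hab
        rw [hAsym, hCsym, eAC]
      · intro h
        have h1 : C x = A y := by
          refine ext_inner_left ℂ fun w => ?_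
          rw [← hCsym, ← hAsym]
          exact h _ _ ((hgraph _ _).2 ⟨w, rfl, rfl⟩)
        -- Since `A² + C² = 1`, a pair `(x, y) = (A z, C z)` determines `z = A x + C y`.
        refine ⟨A x + C y, ?_, ?_⟩
        · rw [map_add, eAA, eAC, ← h1, eCC]; abel
        · rw [map_add, eCC, ← eAC, h1, eAA]; abel
  · intro x y hxy
    obtain ⟨z, rfl, rfl⟩ := (hgraph _ _).1 hxy
    have := ((ContinuousLinearMap.nonneg_iff_isPositive _).1 hAC0).2 z
    rw [hAsym, ← inner_conj_symm, Complex.conj_re]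
    exact this
  · rw [hMgraph]
    constructor
    · rintro ⟨w, rfl, rfl⟩
      exact ⟨C (A w), (hgraph _ _).2 ⟨A w, eAA w, rfl⟩,
        (hgraph _ _).2 ⟨C w, eAC w, eCC w⟩⟩
    · rintro ⟨z, hxz, hzy⟩
      obtain ⟨u, rfl, rfl⟩ := (hgraph _ _).1 hxz
      obtain ⟨v, hv, rfl⟩ := (hgraph _ _).1 hzy
      -- The two graph elements are `(A u, C u)` and `(A v, C v)`, with `A v = C u`. The parameter
      -- for `M` must be `w` with `A w = u` and `C w = v`, and `A² + C² = 1` again yields it.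
      refine ⟨A u + C v, ?_, ?_⟩
      · rw [map_add, ← eAA (A u), eAA u, ← eAA (C v), eAC, hv, eCC, ← map_add,
          add_sub_cancel]
      · rw [← eCC, map_add, map_add, ← eAC, ← hv, eAA, eCC, ← eAA (C v), eAC, eAC, eAA, add_sub_cancel]

lemma IsNonnegSelfAdjoint.isOpSqrt_opSqrt {M : H →ₗ.[ℂ] H} (hM : IsNonnegSelfAdjoint M) :
    IsOpSqrt M (opSqrt M) := by
  rw [opSqrt, dif_pos hM.exists_isOpSqrt]
  exact hM.exists_isOpSqrt.choose_spec

namespace IsOpSqrt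

variable {M B : H →ₗ.[ℂ] H}

lemma re_inner_eq (h : IsOpSqrt M B) {x z y : H} (hx : (x, z) ∈ B.graph) (hz : (z, y) ∈ B.graph) :
    (⟪x, y⟫).re = ‖z‖ ^ 2 := by
  rw [← h.1.1.inner_graph hx hz]
  exact inner_self_eq_norm_sq (𝕜 := ℂ) z

end IsOpSqrt

end SelfAdjointOperators

/-! ### Bounded semigroups and their generators -/

section Semigroups

variable {H : Type*} [NormedAddCommGroup H] [InnerProductSpace ℂ H] [CompleteSpace H]

local notation "⟪" x ", " y "⟫" => inner ℂ x y

namespace IsSemigroupOf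

variable {M : H →ₗ.[ℂ] H} {S : ℝ → H →L[ℂ] H} {C : ℝ}

lemma add_apply (h : IsSemigroupOf M S) {s t : ℝ} (hs : 0 ≤ s) (ht : 0 ≤ t) (f : H) :
    S (s + t) f = S s (S t f) := by
  rw [h.map_add s t hs ht]; rfl

lemma continuousWithinAt_zero (h : IsSemigroupOf M S) (f : H) :
    ContinuousWithinAt (fun t => S t f) (Ici 0) 0 := by
  rw [← continuousWithinAt_Ioi_iff_Ici, ContinuousWithinAt, h.map_zero]
  exact h.tendsto_zero f

lemma norm_sub_le (h : IsSemigroupOf M S) (hC : ∀ t, 0 ≤ t → ‖S t‖ ≤ C) {s t : ℝ} (hs : 0 ≤ s)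
    (ht : 0 ≤ t) (f : H) : ‖S s f - S t f‖ ≤ C * ‖S |s - t| f - f‖ := by
  wlog hst : t ≤ s generalizing s t
  · rw [norm_sub_rev, abs_sub_comm]
    exact this ht hs (le_of_not_ge hst)
  rw [abs_of_nonneg (sub_nonneg.2 hst)]
  have : S s f - S t f = S t (S (s - t) f - f) := by
    rw [map_sub, ← h.add_apply ht (sub_nonneg.2 hst), add_sub_cancel]
  rw [this]
  exact (S t).le_of_opNorm_le (hC t ht) _

lemma continuousOn (h : IsSemigroupOf M S) (hC : ∀ t, 0 ≤ t → ‖S t‖ ≤ C) (f : H) :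
    ContinuousOn (fun t => S t f) (Ici 0) := by
  intro t ht
  have h1 : Tendsto (fun s : ℝ => |s - t|) (𝓝[Ici 0] t) (𝓝[Ici 0] 0) := by
    refine tendsto_nhdsWithin_iff.2 ⟨?_, Eventually.of_forall fun s => mem_Ici.2 (abs_nonneg (s - t))⟩
    have : Continuous fun s : ℝ => |s - t| := by fun_prop
    simpa using (this.tendsto t).mono_left nhdsWithin_le_nhds
  have h2 : Tendsto (fun s => S |s - t| f) (𝓝[Ici 0] t) (𝓝 f) := by
    have h2 := (h.continuousWithinAt_zero f).tendsto
    simp only [h.map_zero, one_apply_eq_self] at h2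
    exact h2.comp h1
  rw [ContinuousWithinAt, tendsto_iff_norm_sub_tendsto_zero]
  have h3 : Tendsto (fun s => C * ‖S |s - t| f - f‖) (𝓝[Ici 0] t) (𝓝 0) := by
    simpa using (tendsto_iff_norm_sub_tendsto_zero.1 h2).const_mul C
  exact squeeze_zero' (Eventually.of_forall fun s => norm_nonneg _)
    (eventually_nhdsWithin_of_forall fun s hs => h.norm_sub_le hC hs ht f) h3

lemma map_mem_graph (h : IsSemigroupOf M S) {t : ℝ} (ht : 0 ≤ t) {f g : H}
    (hfg : (f, g) ∈ M.graph) : (S t f, S t g) ∈ M.graph := by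
  rw [h.generator] at hfg ⊢
  refine (((S t).continuous.tendsto g).comp hfg).congr' ?_
  refine eventually_nhdsWithin_of_forall fun s hs => ?_
  have hs' : (0 : ℝ) ≤ s := le_of_lt hs
  simp only [Function.comp_apply]
  rw [← h.add_apply hs' ht, add_comm s t, h.add_apply ht hs', ← map_sub]
  exact ((S t).restrictScalars ℝ).map_smul _ _

/-- Only the right derivative is available directly, because the generator is defined by limits at
`0+`. This suffices for the fundamental theorem of calculus in its one-sided form. -/
lemma hasDerivWithinAt (h : IsSemigroupOf M S) {t : ℝ} (ht : 0 ≤ t) {f g : H}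
    (hfg : (f, g) ∈ M.graph) : HasDerivWithinAt (fun t => S t f) (-S t g) (Ici t) t := by
  rw [hasDerivWithinAt_iff_tendsto_slope, Ici_sdiff_left]
  have h1 := (h.generator _ _).1 (h.map_mem_graph ht hfg)
  have h2 : Tendsto (fun s : ℝ => s - t) (𝓝[>] t) (𝓝[>] 0) := by
    refine tendsto_nhdsWithin_iff.2 ⟨?_, eventually_nhdsWithin_of_forall fun s hs => mem_Ioi.2 (sub_pos.2 hs)⟩
    have : Continuous fun s : ℝ => s - t := by fun_prop
    simpa using (this.tendsto t).mono_left nhdsWithin_le_nhds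
  refine ((h1.comp h2).neg).congr' (eventually_nhdsWithin_of_forall fun s hs => ?_)
  have hs' : 0 ≤ s - t := sub_nonneg.2 (le_of_lt hs)
  simp only [Function.comp_apply, slope_def_module]
  rw [← h.add_apply hs' ht, sub_add_cancel, ← smul_neg, neg_sub]

/-- The resolvent is the Laplace transform of the semigroup. -/
lemma integrableOn_exp_smul (h : IsSemigroupOf M S) (hC : ∀ t, 0 ≤ t → ‖S t‖ ≤ C) {ε : ℝ}
    (hε : 0 < ε) (v : H) : IntegrableOn (fun t => Real.exp (-ε * t) • S t v) (Ioi 0) := by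
  refine Integrable.mono' (g := fun t => Real.exp (-ε * t) * (C * ‖v‖))
    ((exp_neg_integrableOn_Ioi 0 hε).mul_const _) ?_ ?_
  · refine ContinuousOn.aestronglyMeasurable ?_ measurableSet_Ioi
    have he : Continuous fun t : ℝ => Real.exp (-ε * t) := by fun_prop
    exact he.continuousOn.smul ((h.continuousOn hC v).mono Ioi_subset_Ici_self)
  · refine (ae_restrict_iff' measurableSet_Ioi).2 (Eventually.of_forall fun t ht => ?_)
    rw [norm_smul, Real.norm_eq_abs, Real.abs_exp]
    exact mul_le_mul_of_nonneg_left ((S t).le_of_opNorm_le (hC t (le_of_lt ht)) v)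
      (Real.exp_nonneg _)

/-- As `M R v = v - ε R v`, the right derivative of `t ↦ e^(-εt) S t (R v)` is `-e^(-εt) S t v`.
Integrating over `[0, T]` and letting `T → ∞` leaves the value at `0`. -/
lemma resolvent_eq_integral (h : IsSemigroupOf M S) (hC : ∀ t, 0 ≤ t → ‖S t‖ ≤ C) {ε : ℝ}
    (hε : 0 < ε) {R : H →L[ℂ] H} (hR : IsResolvent M ε R) (v : H) :
    R v = ∫ t in Ioi (0 : ℝ), Real.exp (-ε * t) • S t v := by
  set G : ℝ → H := fun t => Real.exp (-ε * t) • S t (R v)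
  have hcont : ∀ w, ContinuousOn (fun t => Real.exp (-ε * t) • S t w) (Ici 0) := fun w => by
    have he : Continuous fun t : ℝ => Real.exp (-ε * t) := by fun_prop
    exact he.continuousOn.smul (h.continuousOn hC w)
  have hderiv : ∀ t, 0 ≤ t →
      HasDerivWithinAt G (-(Real.exp (-ε * t) • S t v)) (Ici t) t := fun t ht => by
    have h1 := h.hasDerivWithinAt ht (hR.mem_graph v)
    have h2 : HasDerivWithinAt (fun t : ℝ => Real.exp (-ε * t)) (Real.exp (-ε * t) * (-ε))
        (Ici t) t := by
      simpa using (((hasDerivAt_id t).const_mul (-ε)).exp).hasDerivWithinAt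
    refine (h2.smul h1).congr_deriv ?_
    rw [map_sub, map_smul, Complex.coe_smul, mul_smul]
    module
  have hint : ∀ T, 0 ≤ T → ∫ t in (0 : ℝ)..T, -(Real.exp (-ε * t) • S t v) = G T - G 0 := by
    intro T hT
    refine intervalIntegral.integral_eq_sub_of_hasDeriv_right ?_ ?_ ?_
    · rw [uIcc_of_le hT]
      exact (hcont _).mono Icc_subset_Ici_self
    · rw [min_eq_left hT, max_eq_right hT]
      exact fun t ht => (hderiv t ht.1.le).mono Ioi_subset_Ici_self
    · refine ContinuousOn.intervalIntegrable ?_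
      rw [uIcc_of_le hT]
      exact ((hcont _).mono Icc_subset_Ici_self).neg
  have hlim1 := intervalIntegral_tendsto_integral_Ioi (0 : ℝ)
    (h.integrableOn_exp_smul hC hε v).neg tendsto_id
  have hlim2 : Tendsto (fun T => G T - G 0) atTop (𝓝 (0 - G 0)) := by
    refine Tendsto.sub_const ?_ _
    have h0 : Tendsto (fun T => Real.exp (-ε * T) * (C * ‖R v‖)) atTop (𝓝 0) := by
      have : Tendsto (fun T : ℝ => Real.exp (-ε * T)) atTop (𝓝 0) :=
        Real.tendsto_exp_atBot.comp (tendsto_id.const_mul_atTop_of_neg (by linarith))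
      simpa using this.mul_const (C * ‖R v‖)
    refine squeeze_zero_norm' ?_ h0
    filter_upwards [eventually_ge_atTop (0 : ℝ)] with t ht
    rw [norm_smul, Real.norm_eq_abs, Real.abs_exp]
    exact mul_le_mul_of_nonneg_left ((S t).le_of_opNorm_le (hC t ht) _) (Real.exp_nonneg _)
  have hlim3 := hlim2.congr' ((eventually_ge_atTop (0 : ℝ)).mono fun T hT => (hint T hT).symm)
  have h4 := tendsto_nhds_unique hlim1 hlim3
  have hG0 : G 0 = R v := by simp [G, h.map_zero]
  rw [zero_sub, hG0] at h4
  simp only [Pi.neg_apply] at h4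
  rw [integral_neg] at h4
  exact (neg_injective h4).symm

/-- A bounded semigroup with self-adjoint generator is symmetric. -/
lemma inner_symm (h : IsSemigroupOf M S) (hM : IsSelfAdjoint M)
    (hC : ∀ t, 0 ≤ t → ‖S t‖ ≤ C) {t : ℝ} (ht : 0 ≤ t) (f g : H) :
    ⟪S t f, g⟫ = ⟪f, S t g⟫ := by
  have key : ∀ f ∈ M.domain, ∀ g ∈ M.domain, ⟪S t f, g⟫ = ⟪f, S t g⟫ := by
    intro f hf g hg
    obtain ⟨f', hf⟩ := LinearPMap.mem_domain_iff.1 hf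
    obtain ⟨g', hg⟩ := LinearPMap.mem_domain_iff.1 hg
    have hrev : ∀ w, ContinuousOn (fun s => S (t - s) w) (Icc 0 t) := fun w =>
      (h.continuousOn hC w).comp (by fun_prop) fun s hs => sub_nonneg.2 hs.2
    -- This function joins the two sides of the claim as `s` runs over `[0, t]`. Its right
    -- derivative vanishes, since the two contributions of the symmetric `M` cancel.
    have hcont : ContinuousOn (fun s => ⟪S s f, S (t - s) g⟫) (Icc 0 t) :=
      ((h.continuousOn hC f).mono Icc_subset_Ici_self).inner (hrev g)
    have hd : ∀ s ∈ Ico 0 t, HasDerivWithinAt (fun s => S (t - s) g) (S (t - s) g') (Ici s) s := by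
      intro s hs
      rw [hasDerivWithinAt_iff_tendsto_slope, Ici_sdiff_left]
      have hnear : ∀ᶠ r in 𝓝[>] s, r ∈ Ioc s t := Ioc_mem_nhdsGT hs.2
      have h2 : Tendsto (fun r : ℝ => r - s) (𝓝[>] s) (𝓝[>] 0) := by
        refine tendsto_nhdsWithin_iff.2
          ⟨?_, eventually_nhdsWithin_of_forall fun r hr => mem_Ioi.2 (sub_pos.2 hr)⟩
        have : Continuous fun r : ℝ => r - s := by fun_prop
        simpa using (this.tendsto s).mono_left nhdsWithin_le_nhds
      have h3 := ((h.generator g g').1 hg).comp h2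
      have h4 : Tendsto (fun r => S (t - r) g') (𝓝[>] s) (𝓝 (S (t - s) g')) := by
        refine ((hrev g') s (Ico_subset_Icc_self hs)).tendsto.mono_left ?_
        exact nhdsWithin_le_iff.2 (hnear.mono fun r hr => ⟨hs.1.trans hr.1.le, hr.2⟩)
      -- The operator `S (t - r)` moves with `r`. Its effect on the error of the difference quotient
      -- is controlled by the uniform bound `C`, and its effect on the fixed vector `g'` by strong
      -- continuity.
      have h5 : Tendsto (fun r => S (t - r)
          ((r - s)⁻¹ • (g - S (r - s) g) - g')) (𝓝[>] s) (𝓝 0) := by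
        have h6 := (tendsto_iff_norm_sub_tendsto_zero.1 h3).const_mul C
        rw [mul_zero] at h6
        refine squeeze_zero_norm' ?_ h6
        filter_upwards [hnear] with r hr
        exact (S (t - r)).le_of_opNorm_le (hC _ (sub_nonneg.2 hr.2)) _
      have h7 := h5.add h4
      rw [zero_add] at h7
      refine h7.congr' ?_
      filter_upwards [hnear] with r hr
      have hr1 : 0 ≤ r - s := sub_nonneg.2 hr.1.le
      have hr2 : 0 ≤ t - r := sub_nonneg.2 hr.2
      rw [← _root_.map_add, sub_add_cancel, slope_def_module]
      refine (((S (t - r)).restrictScalars ℝ).map_smul _ _).trans ?_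
      congr 1
      simp only [ContinuousLinearMap.coe_restrictScalars', map_sub]
      rw [← h.add_apply hr2 hr1]
      congr 3
      ring
    have hd' : ∀ s ∈ Ico 0 t,
        HasDerivWithinAt (fun s => ⟪S s f, S (t - s) g⟫) 0 (Ici s) s := by
      intro s hs
      refine ((h.hasDerivWithinAt hs.1 hf).inner ℂ (hd s hs)).congr_deriv ?_
      rw [inner_neg_left, hM.inner_graph (h.map_mem_graph hs.1 hf)
        (h.map_mem_graph (sub_nonneg.2 hs.2.le) hg), add_neg_cancel]
    have := constant_of_has_deriv_right_zero hcont hd' t (right_mem_Icc.2 ht)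
    simpa [h.map_zero] using this
  have hdense := hM.dense_domain
  have key2 : ∀ f ∈ M.domain, ∀ g, ⟪S t f, g⟫ = ⟪f, S t g⟫ := fun f hf g =>
    congrFun (Continuous.ext_on hdense (by fun_prop) (by fun_prop) (fun g hg => key f hf g hg)) g
  exact congrFun (Continuous.ext_on hdense (f := fun f => ⟪S t f, g⟫)
    (g := fun f => ⟪f, S t g⟫) (by fun_prop) (by fun_prop) (fun f hf => key2 f hf g)) f

lemma norm_sq_eq (h : IsSemigroupOf M S) (hM : IsSelfAdjoint M)
    (hC : ∀ t, 0 ≤ t → ‖S t‖ ≤ C) {t : ℝ} (ht : 0 ≤ t) (f : H) :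
    ⟪f, S (t + t) f⟫ = (‖S t f‖ : ℂ) ^ 2 := by
  rw [h.add_apply ht ht, ← h.inner_symm hM hC ht]
  exact inner_self_eq_norm_sq_to_K (𝕜 := ℂ) _

/-- A bounded semigroup with self-adjoint generator is contractive. -/
lemma norm_apply_le (h : IsSemigroupOf M S) (hM : IsSelfAdjoint M)
    (hC : ∀ t, 0 ≤ t → ‖S t‖ ≤ C) {t : ℝ} (ht : 0 ≤ t) (f : H) : ‖S t f‖ ≤ ‖f‖ := by
  -- Cauchy-Schwarz gives `‖S t f‖² ≤ ‖S (2t) f‖ ‖f‖`. Iterating it, the constant `C` enters only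
  -- once while the powers double, so a ratio `‖S t f‖ / ‖f‖ > 1` is impossible.
  have key : ∀ n : ℕ, ∀ t, 0 ≤ t → ‖S t f‖ ^ 2 ^ n ≤ C * ‖f‖ ^ 2 ^ n := by
    intro n
    induction n with
    | zero => intro t ht; simpa using (S t).le_of_opNorm_le (hC t ht) f
    | succ n ih =>
      intro t ht
      have h1 : ‖S t f‖ ^ 2 ≤ ‖S (t + t) f‖ * ‖f‖ := by
        have := norm_inner_le_norm (𝕜 := ℂ) f (S (t + t) f)
        rw [h.norm_sq_eq hM hC ht, norm_pow, Complex.norm_real, norm_norm, mul_comm] at this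
        exact this
      calc ‖S t f‖ ^ 2 ^ (n + 1) = (‖S t f‖ ^ 2) ^ 2 ^ n := by rw [← pow_mul, pow_succ']
        _ ≤ (‖S (t + t) f‖ * ‖f‖) ^ 2 ^ n := by gcongr
        _ ≤ C * ‖f‖ ^ 2 ^ n * ‖f‖ ^ 2 ^ n := by
          rw [mul_pow]
          exact mul_le_mul_of_nonneg_right (ih _ (by linarith)) (by positivity)
        _ = _ := by rw [mul_assoc, ← pow_add, pow_succ, mul_two]
  by_contra! hlt
  have hf : 0 < ‖f‖ := by
    refine norm_pos_iff.2 ?_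
    rintro rfl
    simp at hlt
  have h1 : 1 < ‖S t f‖ / ‖f‖ := (one_lt_div hf).2 hlt
  have h2 := (tendsto_pow_atTop_atTop_of_one_lt h1).comp
    (tendsto_pow_atTop_atTop_of_one_lt (one_lt_two : (1 : ℕ) < 2))
  obtain ⟨n, hn⟩ := (h2.eventually_gt_atTop C).exists
  simp only [Function.comp_apply] at hn
  rw [div_pow, lt_div_iff₀ (by positivity)] at hn
  exact absurd (key n t ht) (not_le.2 hn)

/-- Contractivity makes `Re ⟨f, f - S t f⟩ ≥ 0`; divide by `t` and let `t → 0+`. In the subcritical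
case positivity of `1 + L` is obtained in this way. -/
lemma isNonnegSelfAdjoint (h : IsSemigroupOf M S) (hM : IsSelfAdjoint M)
    (hC : ∀ t, 0 ≤ t → ‖S t‖ ≤ C) : IsNonnegSelfAdjoint M := by
  refine hM.isNonneg_of_graph fun f g hfg => ?_
  have h1 := ((h.generator f g).1 hfg)
  have h2 : Tendsto (fun t : ℝ => (⟪f, t⁻¹ • (f - S t f)⟫).re) (𝓝[>] 0) (𝓝 (⟪f, g⟫).re) :=
    (Complex.continuous_re.tendsto _).comp (tendsto_const_nhds.inner h1)
  refine ge_of_tendsto h2 (eventually_nhdsWithin_of_forall fun t ht => ?_)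
  have ht' : 0 < t := ht
  rw [← Complex.coe_smul, inner_smul_right, Complex.re_ofReal_mul, inner_sub_right,
    Complex.sub_re]
  refine mul_nonneg (inv_nonneg.2 ht'.le) (sub_nonneg.2 ?_)
  have h3 : (⟪f, S t f⟫).re ≤ ‖f‖ * ‖S t f‖ := re_inner_le_norm (𝕜 := ℂ) f _
  have h4 : (⟪f, f⟫).re = ‖f‖ ^ 2 := inner_self_eq_norm_sq (𝕜 := ℂ) f
  rw [h4]
  nlinarith [h.norm_apply_le hM hC ht'.le f, norm_nonneg f]

/-- The semigroup generated by `-(1 + M)`. -/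
lemma exp_smul (h : IsSemigroupOf M S) :
    IsSemigroupOf ((LinearMap.id : H →ₗ[ℂ] H) +ᵥ M)
      (fun t => (Real.exp (-t) : ℂ) • S t) where
  map_zero := by simp [h.map_zero]
  map_add s t hs ht := by
    rw [h.map_add s t hs ht, smul_mul_smul_comm]
    congr 1
    rw [← Complex.ofReal_mul, ← Real.exp_add]
    congr 2
    ring
  tendsto_zero f := by
    have h1 : Tendsto (fun t : ℝ => (Real.exp (-t) : ℂ)) (𝓝[>] 0) (𝓝 1) := by
      have : Continuous fun t : ℝ => (Real.exp (-t) : ℂ) := by fun_prop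
      simpa using (this.tendsto 0).mono_left nhdsWithin_le_nhds
    simpa using h1.smul (h.tendsto_zero f)
  generator f g := by
    rw [LinearPMap.mem_graph_id_vadd, h.generator]
    have he : Tendsto (fun t : ℝ => t⁻¹ * (1 - Real.exp (-t))) (𝓝[>] 0) (𝓝 1) := by
      have h1 : HasDerivAt (fun t : ℝ => Real.exp (-t)) (-1) 0 := by
        simpa using (hasDerivAt_neg (0 : ℝ)).exp
      have h2 := (hasDerivAt_iff_tendsto_slope.1 h1).neg
      rw [neg_neg] at h2
      -- The factor `(1 - e^(-t)) / t` tends to `1`, which is where the additional identity in the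
      -- generator comes from.
      refine (h2.mono_left (nhdsWithin_mono _ fun t ht => (ne_of_gt ht : t ≠ 0))).congr fun t => ?_
      simp only [slope_def_field, sub_zero, neg_zero, Real.exp_zero]
      ring
    have h3 : Tendsto (fun t : ℝ => (t⁻¹ * (1 - Real.exp (-t))) • S t f) (𝓝[>] 0) (𝓝 f) := by
      simpa using he.smul (h.tendsto_zero f)
    have h4 : ∀ t : ℝ, t⁻¹ • (f - ((Real.exp (-t) : ℂ) • S t) f) =
        t⁻¹ • (f - S t f) + (t⁻¹ * (1 - Real.exp (-t))) • S t f := fun t => by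
      rw [smul_apply, Complex.coe_smul]
      module
    simp_rw [h4]
    constructor
    · intro h5
      simpa using h5.add h3
    · intro h5
      simpa using h5.sub h3

end IsSemigroupOf

end Semigroups

/-! ### Sobolev inequalities by duality -/

section Duality

variable {H : Type*} [NormedAddCommGroup H] [InnerProductSpace ℂ H] [CompleteSpace H]

local notation "⟪" x ", " y "⟫" => inner ℂ x y

/-- Cauchy-Schwarz for a weighted form in two variables; the defect is `ε (a d - b c)²`. -/
lemma mul_add_mul_sq_le {ε a b c d : ℝ} (hε : 0 ≤ ε) :
    (ε * (a * c) + b * d) ^ 2 ≤ (ε * a ^ 2 + b ^ 2) * (ε * c ^ 2 + d ^ 2) := by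
  nlinarith [mul_nonneg hε (sq_nonneg (a * d - b * c))]

/-- If `∫ |⟨v, e^{-tM} v⟩| dt ≤ a²`, i.e. formally `‖M^{-1/2} v‖ ≤ a`, then
`|⟨v, f⟩| ≤ a ‖M^{1/2} f‖`. -/
lemma IsSemigroupOf.norm_inner_le {M B : H →ₗ.[ℂ] H} {S : ℝ → H →L[ℂ] H} {C : ℝ}
    (h : IsSemigroupOf M S) (hM : IsNonnegSelfAdjoint M) (hC : ∀ t, 0 ≤ t → ‖S t‖ ≤ C)
    (hB : IsOpSqrt M B) {v : H} {a : ℝ} (ha : 0 ≤ a)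
    (hv : ∫⁻ t in Ioi (0 : ℝ), ‖⟪v, S t v⟫‖ₑ ≤ ENNReal.ofReal (a ^ 2))
    {f g : H} (hfg : (f, g) ∈ B.graph) : ‖⟪v, f⟫‖ ≤ a * ‖g‖ := by
  have key : ∀ ε : ℝ, 0 < ε → ‖⟪v, f⟫‖ ^ 2 ≤ a ^ 2 * (ε * ‖f‖ ^ 2 + ‖g‖ ^ 2) := by
    intro ε hε
    obtain ⟨R, hR⟩ := hM.exists_isResolvent hε
    -- The regularisation `w = (ε + M)⁻¹ v` stands in for `M⁻¹ v`, which may not exist. With `z =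
    -- M^(1/2) w` one has `ε ‖w‖² + ‖z‖² = Re ⟨w, v⟩`, which the Laplace transform bounds by `a²`,
    -- and `⟨v, f⟩ = ε ⟨w, f⟩ + ⟨z, g⟩`. At the end `ε → 0`.
    set w := R v with hw
    obtain ⟨z, hwz, hzy⟩ := (hB.2 _ _).1 (hR.mem_graph v)
    have h1 : ‖⟪v, w⟫‖ ≤ a ^ 2 := by
      rw [hw, h.resolvent_eq_integral hC hε hR v,
        ← integral_inner (h.integrableOn_exp_smul hC hε v) v, ← ENNReal.ofReal_le_ofReal_iff
        (sq_nonneg a), ofReal_norm]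
      refine (enorm_integral_le_lintegral_enorm _).trans (le_trans ?_ hv)
      refine setLIntegral_mono_ae' measurableSet_Ioi (Eventually.of_forall fun t ht => ?_)
      rw [← Complex.coe_smul, inner_smul_right, enorm_mul]
      refine mul_le_of_le_one_left' ?_
      have ht' : (0 : ℝ) < t := ht
      rw [← ofReal_norm, Complex.norm_real, Real.norm_eq_abs, Real.abs_exp,
        ENNReal.ofReal_le_one, Real.exp_le_one_iff]
      nlinarith
    have h2 : ε * ‖w‖ ^ 2 + ‖z‖ ^ 2 ≤ a ^ 2 := by
      have h3 := hB.re_inner_eq hwz hzy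
      rw [inner_sub_right, inner_smul_right, Complex.sub_re, Complex.re_ofReal_mul] at h3
      have h4 : (⟪w, w⟫).re = ‖w‖ ^ 2 := inner_self_eq_norm_sq (𝕜 := ℂ) w
      have h5 : (⟪w, v⟫).re ≤ a ^ 2 := by
        refine (Complex.re_le_norm _).trans ?_
        rwa [← inner_conj_symm, Complex.norm_conj]
      rw [h4] at h3
      linarith
    have h6 : ⟪v, f⟫ = ε * ⟪w, f⟫ + ⟪z, g⟫ := by
      have h7 := hB.1.1.inner_graph hzy hfg
      rw [inner_sub_left, inner_smul_left, Complex.conj_ofReal] at h7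
      linear_combination h7
    have h8 : ‖⟪v, f⟫‖ ≤ ε * (‖w‖ * ‖f‖) + ‖z‖ * ‖g‖ := by
      rw [h6]
      refine (norm_add_le _ _).trans (add_le_add ?_ (norm_inner_le_norm _ _))
      rw [norm_mul, Complex.norm_real, Real.norm_eq_abs, abs_of_pos hε]
      exact mul_le_mul_of_nonneg_left (norm_inner_le_norm _ _) hε.le
    calc ‖⟪v, f⟫‖ ^ 2 ≤ (ε * (‖w‖ * ‖f‖) + ‖z‖ * ‖g‖) ^ 2 := by gcongr
      _ ≤ (ε * ‖w‖ ^ 2 + ‖z‖ ^ 2) * (ε * ‖f‖ ^ 2 + ‖g‖ ^ 2) := mul_add_mul_sq_le hε.le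
      _ ≤ a ^ 2 * (ε * ‖f‖ ^ 2 + ‖g‖ ^ 2) := by gcongr
  have hlim : Tendsto (fun ε : ℝ => a ^ 2 * (ε * ‖f‖ ^ 2 + ‖g‖ ^ 2)) (𝓝[>] 0)
      (𝓝 (a ^ 2 * ‖g‖ ^ 2)) := by
    have : Continuous fun ε : ℝ => a ^ 2 * (ε * ‖f‖ ^ 2 + ‖g‖ ^ 2) := by fun_prop
    simpa using (this.tendsto 0).mono_left nhdsWithin_le_nhds
  have hle : ‖⟪v, f⟫‖ ^ 2 ≤ (a * ‖g‖) ^ 2 := by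
    rw [mul_pow]
    exact ge_of_tendsto hlim (eventually_nhdsWithin_of_forall key)
  exact (sq_le_sq₀ (norm_nonneg _) (by positivity)).1 hle

variable {α : Type*} [MeasurableSpace α] {μ : Measure α}

/-- The converse of Hölder's inequality, tested on square integrable functions. -/
lemma eLpNorm_le_of_inner_le [SigmaFinite μ] {q r : ℝ} (hqr : q.HolderConjugate r) (hq : 2 ≤ q)
    {f : Lp ℂ 2 μ} {c : ℝ≥0∞}
    (hf : ∀ v : Lp ℂ 2 μ, eLpNorm v (ENNReal.ofReal r) μ ≠ ∞ →
      ‖⟪v, f⟫‖ₑ ≤ c * eLpNorm v (ENNReal.ofReal r) μ) :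
    eLpNorm f (ENNReal.ofReal q) μ ≤ c := by
  have hq0 : 0 < q := by linarith
  have hr0 : 0 < r := hqr.symm.pos
  have hfm : Measurable f := (Lp.stronglyMeasurable f).measurable
  -- On `E n` the function is bounded and the measure finite. Hence the extremal test function
  -- `|f|^(q-2) f` restricted to `E n` lies in `L²`, and the integral `I` is finite, which allows
  -- cancelling `I^(1/r)`. Monotone convergence removes the truncation.
  set E : ℕ → Set α := fun n => {x | ‖f x‖ ≤ n} ∩ spanningSets μ n with hE
  have hEm : ∀ n, MeasurableSet (E n) := fun n =>
    (measurableSet_le hfm.norm measurable_const).inter (measurableSet_spanningSets μ n)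
  have hEmono : Monotone E := fun m n hmn x hx =>
    ⟨le_trans (α := ℝ) hx.1 (Nat.cast_le.2 hmn), monotone_spanningSets μ hmn hx.2⟩
  have hEU : ⋃ n, E n = univ := by
    refine eq_univ_of_forall fun x => ?_
    have h1 : x ∈ ⋃ n, spanningSets μ n := by rw [iUnion_spanningSets]; trivial
    obtain ⟨m, hm⟩ := mem_iUnion.1 h1
    obtain ⟨n, hn⟩ := exists_nat_ge ‖f x‖
    refine mem_iUnion.2 ⟨max m n, ?_, monotone_spanningSets μ (le_max_left _ _) hm⟩
    exact le_trans (α := ℝ) hn (Nat.cast_le.2 (le_max_right _ _))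
  have key : ∀ n, ∫⁻ x in E n, ‖f x‖ₑ ^ q ∂μ ≤ c ^ q := by
    intro n
    set I := ∫⁻ x in E n, ‖f x‖ₑ ^ q ∂μ with hI
    have hEfin : μ (E n) < ∞ :=
      (measure_mono inter_subset_right).trans_lt (measure_spanningSets_lt_top μ n)
    have hItop : I ≠ ∞ := by
      refine ne_top_of_le_ne_top (b := ENNReal.ofReal n ^ q * μ (E n)) ?_ ?_
      · exact ENNReal.mul_ne_top (ENNReal.rpow_ne_top_of_nonneg hq0.le ENNReal.ofReal_ne_top)
          hEfin.ne
      · rw [hI, ← setLIntegral_const]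
        refine setLIntegral_mono' (hEm n) fun x hx => ?_
        gcongr
        rw [← ofReal_norm]
        exact ENNReal.ofReal_le_ofReal hx.1
    set v₀ : α → ℂ := (E n).indicator (fun x => ((‖f x‖ ^ (q - 2) : ℝ) : ℂ) * f x) with hv₀
    have hv₀m : Measurable v₀ :=
      ((Complex.measurable_ofReal.comp (hfm.norm.pow_const _)).mul hfm).indicator (hEm n)
    have hv₀n : ∀ x, ‖v₀ x‖ₑ = (E n).indicator (fun x => ‖f x‖ₑ ^ (q - 1)) x := by
      intro x
      rw [hv₀, enorm_indicator_eq_indicator_enorm]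
      congr 1
      ext x
      rw [enorm_mul, ← ofReal_norm, Complex.norm_real, Real.norm_eq_abs,
        abs_of_nonneg (by positivity), ← ENNReal.ofReal_rpow_of_nonneg (norm_nonneg _)
        (by linarith), ofReal_norm, show q - 1 = (q - 2) + 1 by ring,
        ENNReal.rpow_add_of_nonneg _ _ (by linarith) zero_le_one, ENNReal.rpow_one]
    have hpow : ∀ s : ℝ, 0 < s → ∫⁻ x, ‖v₀ x‖ₑ ^ s ∂μ =
        ∫⁻ x in E n, ‖f x‖ₑ ^ ((q - 1) * s) ∂μ := by
      intro s hs
      rw [← lintegral_indicator (hEm n)]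
      refine lintegral_congr fun x => ?_
      rw [hv₀n]
      by_cases hx : x ∈ E n
      · simp [hx, ENNReal.rpow_mul]
      · simp [hx, hs]
    have hv₀2 : MemLp v₀ 2 μ := by
      refine ⟨hv₀m.aestronglyMeasurable, ?_⟩
      rw [eLpNorm_lt_top_iff_lintegral_rpow_enorm_lt_top two_ne_zero ENNReal.ofNat_ne_top,
        hpow _ (by simp)]
      refine lt_of_le_of_lt (b := ENNReal.ofReal n ^ ((q - 1) * (2 : ℝ≥0∞).toReal) * μ (E n)) ?_ ?_
      · rw [← setLIntegral_const]
        refine setLIntegral_mono' (hEm n) fun x hx => ?_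
        refine ENNReal.rpow_le_rpow ?_ (mul_nonneg (by linarith) (by simp))
        rw [← ofReal_norm]
        exact ENNReal.ofReal_le_ofReal hx.1
      · exact ENNReal.mul_lt_top (ENNReal.rpow_lt_top_of_nonneg
          (mul_nonneg (by linarith) (by simp)) ENNReal.ofReal_ne_top) hEfin
    have hnorm : eLpNorm (hv₀2.toLp v₀) (ENNReal.ofReal r) μ = I ^ (1 / r) := by
      rw [eLpNorm_congr_ae hv₀2.coeFn_toLp, eLpNorm_eq_lintegral_rpow_enorm_toReal
        (by simpa using hr0) ENNReal.ofReal_ne_top, ENNReal.toReal_ofReal hr0.le, hpow r hr0,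
        hqr.sub_one_mul_conj]
    have hinner : ‖⟪hv₀2.toLp v₀, f⟫‖ₑ = I := by
      have h1 : ⟪hv₀2.toLp v₀, f⟫ = ((∫ x in E n, ‖f x‖ ^ q ∂μ : ℝ) : ℂ) := by
        rw [L2.inner_def, ← integral_complex_ofReal, ← integral_indicator (hEm n)]
        refine integral_congr_ae ?_
        filter_upwards [hv₀2.coeFn_toLp] with x hx
        rw [hx, hv₀]
        by_cases hxE : x ∈ E n
        · simp only [indicator_of_mem hxE, RCLike.inner_apply, map_mul, Complex.conj_ofReal]
          rw [mul_left_comm, Complex.mul_conj, Complex.normSq_eq_norm_sq, ← Complex.ofReal_mul]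
          congr 1
          rcases (norm_nonneg (f x)).eq_or_lt with h0 | h0
          · rw [← h0, Real.zero_rpow hq0.ne']; simp
          · rw [← Real.rpow_natCast, ← Real.rpow_add h0]
            norm_num
        · simp [hxE]
      rw [h1, ← ofReal_norm, Complex.norm_real, Real.norm_eq_abs, abs_of_nonneg
        (integral_nonneg fun x => by positivity)]
      have h2 : ∀ x, ENNReal.ofReal (‖f x‖ ^ q) = ‖f x‖ₑ ^ q := fun x => by
        rw [← ENNReal.ofReal_rpow_of_nonneg (norm_nonneg _) hq0.le, ofReal_norm]
      rw [ofReal_integral_eq_lintegral_ofReal]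
      · simp_rw [h2]; rfl
      · refine ⟨(hfm.norm.pow_const q).aestronglyMeasurable, ?_⟩
        rw [hasFiniteIntegral_iff_ofReal (Eventually.of_forall fun x => by positivity)]
        simp_rw [h2]
        exact hItop.lt_top
      · exact Eventually.of_forall fun x => by positivity
    have h3 := hf (hv₀2.toLp v₀) (by
      rw [hnorm]; exact ENNReal.rpow_ne_top_of_nonneg (by positivity) hItop)
    rw [hnorm, hinner] at h3
    rcases eq_or_ne I 0 with h0 | h0
    · rw [h0]; exact zero_le
    have h4 : I = I ^ (1 / q) * I ^ (1 / r) := by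
      rw [← ENNReal.rpow_add _ _ h0 hItop, one_div, one_div, hqr.inv_add_inv_eq_one,
        ENNReal.rpow_one]
    have h5 : I ^ (1 / r) ≠ 0 := (ENNReal.rpow_pos (pos_iff_ne_zero.2 h0) hItop).ne'
    have h6 : I ^ (1 / r) ≠ ∞ := ENNReal.rpow_ne_top_of_nonneg (by positivity) hItop
    have h7 : I ^ (1 / q) ≤ c := by
      have h8 := h4.symm.le.trans h3
      rwa [ENNReal.mul_le_mul_iff_left h5 h6] at h8
    calc I = (I ^ (1 / q)) ^ q := by rw [← ENNReal.rpow_mul, one_div_mul_cancel hq0.ne',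
            ENNReal.rpow_one]
      _ ≤ c ^ q := ENNReal.rpow_le_rpow h7 hq0.le
  rw [eLpNorm_eq_lintegral_rpow_enorm_toReal (by simpa using hq0) ENNReal.ofReal_ne_top,
    ENNReal.toReal_ofReal hq0.le, one_div, ENNReal.rpow_inv_le_iff hq0]
  have h8 := setLIntegral_iUnion_of_directed (μ := μ) (fun x => ‖f x‖ₑ ^ q)
    (hEmono.directed_le)
  rw [hEU, setLIntegral_univ] at h8
  rw [h8]
  exact iSup_le key

/-- The Sobolev inequality of a non-negative self-adjoint operator `M` on `L²`. -/
theorem IsSemigroupOf.eLpNorm_le_of_lintegral_inner_le [SigmaFinite μ]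
    {M B : Lp ℂ 2 μ →ₗ.[ℂ] Lp ℂ 2 μ} {S : ℝ → Lp ℂ 2 μ →L[ℂ] Lp ℂ 2 μ} {C : ℝ}
    (h : IsSemigroupOf M S) (hM : IsNonnegSelfAdjoint M) (hC : ∀ t, 0 ≤ t → ‖S t‖ ≤ C)
    (hB : IsOpSqrt M B) {q r : ℝ} (hqr : q.HolderConjugate r) (hq : 2 ≤ q) {K : ℝ≥0∞}
    (hK : K ≠ ∞) (hv : ∀ v : Lp ℂ 2 μ, eLpNorm v (ENNReal.ofReal r) μ ≠ ∞ →
      ∫⁻ t in Ioi (0 : ℝ), ‖⟪v, S t v⟫‖ₑ ≤ (K * eLpNorm v (ENNReal.ofReal r) μ) ^ 2)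
    {f g : Lp ℂ 2 μ} (hfg : (f, g) ∈ B.graph) :
    eLpNorm f (ENNReal.ofReal q) μ ≤ K * ‖g‖ₑ := by
  refine eLpNorm_le_of_inner_le hqr hq fun v hvr => ?_
  have hA : K * eLpNorm v (ENNReal.ofReal r) μ ≠ ∞ := ENNReal.mul_ne_top hK hvr
  have h1 := h.norm_inner_le hM hC hB (v := v)
    (a := (K * eLpNorm v (ENNReal.ofReal r) μ).toReal) ENNReal.toReal_nonneg (by
      rw [ENNReal.ofReal_pow ENNReal.toReal_nonneg, ENNReal.ofReal_toReal hA]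
      exact hv v hvr) hfg
  rw [mul_right_comm, ← ENNReal.ofReal_toReal hA, ← ofReal_norm, ← ofReal_norm,
    ← ENNReal.ofReal_mul ENNReal.toReal_nonneg]
  exact ENNReal.ofReal_le_ofReal h1

end Duality

/-! ### The energy-subcritical case -/

section Subcritical

local notation "⟪" x ", " y "⟫" => inner ℂ x y

/-! ### Hölder's inequality for extended norms -/

section Holder

variable {α : Type*} [MeasurableSpace α] {μ : Measure α}

lemma lintegral_enorm_mul_le_eLpNorm {q r : ℝ} (hqr : q.HolderConjugate r) {u v : α → ℂ}
    (hu : AEStronglyMeasurable u μ) (hv : AEStronglyMeasurable v μ) :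
    ∫⁻ x, ‖u x‖ₑ * ‖v x‖ₑ ∂μ ≤
      eLpNorm u (ENNReal.ofReal q) μ * eLpNorm v (ENNReal.ofReal r) μ := by
  have hq0 := hqr.pos
  have hr0 := hqr.symm.pos
  rw [eLpNorm_eq_lintegral_rpow_enorm_toReal (by simpa using hq0) ENNReal.ofReal_ne_top,
    eLpNorm_eq_lintegral_rpow_enorm_toReal (by simpa using hr0) ENNReal.ofReal_ne_top,
    ENNReal.toReal_ofReal hq0.le, ENNReal.toReal_ofReal hr0.le]
  exact ENNReal.lintegral_mul_le_Lp_mul_Lq μ hqr hu.enorm hv.enorm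

lemma enorm_inner_le_lintegral (v f : Lp ℂ 2 μ) : ‖⟪v, f⟫‖ₑ ≤ ∫⁻ x, ‖v x‖ₑ * ‖f x‖ₑ ∂μ := by
  rw [L2.inner_def]
  refine (enorm_integral_le_lintegral_enorm _).trans (lintegral_mono fun x => ?_)
  rw [RCLike.inner_apply, enorm_mul, mul_comm, RCLike.enorm_conj]

lemma enorm_inner_le_eLpNorm {q r : ℝ} (hqr : q.HolderConjugate r) (v f : Lp ℂ 2 μ) :
    ‖⟪v, f⟫‖ₑ ≤ eLpNorm f (ENNReal.ofReal q) μ * eLpNorm v (ENNReal.ofReal r) μ := by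
  refine (enorm_inner_le_lintegral v f).trans ?_
  simp_rw [mul_comm ‖v _‖ₑ]
  exact lintegral_enorm_mul_le_eLpNorm hqr (Lp.aestronglyMeasurable f) (Lp.aestronglyMeasurable v)

lemma lp_eq_zero_of_eLpNorm_eq_zero {q : ℝ} (hq : 0 < q) {f : Lp ℂ 2 μ}
    (h : eLpNorm f (ENNReal.ofReal q) μ = 0) : f = 0 := by
  rw [eLpNorm_eq_zero_iff (Lp.aestronglyMeasurable f) (by simpa using hq)] at h
  exact Lp.eq_zero_iff_ae_eq_zero.2 h

end Holder

/-- The `T T*` argument: `‖S t v‖² = ⟨v, S t (S t v)⟩ ≤ w ‖S t v‖ ‖v‖_r`, and one factor `‖S t v‖`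
cancels. Thus the `L² → L^q` bound is also an `L^r → L²` bound. -/
lemma IsSemigroupOf.enorm_inner_apply_le {α : Type*} [MeasurableSpace α] {μ : Measure α}
    {M : Lp ℂ 2 μ →ₗ.[ℂ] Lp ℂ 2 μ} {S : ℝ → Lp ℂ 2 μ →L[ℂ] Lp ℂ 2 μ} {C : ℝ}
    (h : IsSemigroupOf M S) (hM : IsSelfAdjoint M) (hC : ∀ t, 0 ≤ t → ‖S t‖ ≤ C)
    {q r : ℝ} (hqr : q.HolderConjugate r) {t : ℝ} (ht : 0 ≤ t) {w : ℝ≥0∞}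
    (hw : ∀ f, eLpNorm (S t f) (ENNReal.ofReal q) μ ≤ w * ‖f‖ₑ) (v : Lp ℂ 2 μ) :
    ‖⟪v, S (t + t) v⟫‖ₑ ≤ (w * eLpNorm v (ENNReal.ofReal r) μ) ^ 2 := by
  have h1 : ‖⟪v, S (t + t) v⟫‖ₑ = ‖S t v‖ₑ ^ 2 := by
    rw [h.norm_sq_eq hM hC ht, enorm_pow, ← ofReal_norm, Complex.norm_real, norm_norm, ofReal_norm]
  have h2 : ‖S t v‖ₑ ^ 2 ≤ w * eLpNorm v (ENNReal.ofReal r) μ * ‖S t v‖ₑ := by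
    rw [← h1]
    refine (enorm_inner_le_eLpNorm hqr _ _).trans ?_
    rw [h.add_apply ht ht, mul_right_comm]
    gcongr
    exact hw _
  rw [h1]
  gcongr
  rcases eq_or_ne ‖S t v‖ₑ 0 with h0 | h0
  · rw [h0]; exact zero_le
  · rw [pow_two] at h2
    rwa [ENNReal.mul_le_mul_iff_left h0 enorm_ne_top] at h2

variable {d : ℕ} {Ω : Set (EuclideanSpace ℝ (Fin d))}

/-- Twice the left side is the exponent of the singularity at `t = 0` in the time integral, so this
inequality makes it integrable. Equality would hold at the critical exponent. -/
lemma subcritical_exponent_lt {d : ℕ} {p : ℝ} (hd : 1 ≤ d) (hp : 1 < p)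
    (hpc : (p : EReal) < critExp d) : (d : ℝ) / 2 * (1 / 2 - 1 / (p + 1)) < 1 / 2 := by
  have hp1 : 0 < p + 1 := by linarith
  have hd' : (1 : ℝ) ≤ d := by exact_mod_cast hd
  by_cases h3 : 3 ≤ d
  · rw [critExp, if_pos h3, EReal.coe_lt_coe_iff] at hpc
    have hd3 : (3 : ℝ) ≤ d := by exact_mod_cast h3
    rw [lt_div_iff₀ (by linarith)] at hpc
    rw [show (d : ℝ) / 2 * (1 / 2 - 1 / (p + 1)) = d * (p - 1) / (4 * (p + 1)) by field_simp; ring,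
      div_lt_iff₀ (by positivity)]
    nlinarith
  · have hd2 : (d : ℝ) ≤ 2 := by exact_mod_cast (by omega : d ≤ 2)
    have : 0 < 1 / (p + 1) := by positivity
    nlinarith

lemma lt_critExp_add_one {d : ℕ} {p : ℝ} (hpc : (p : EReal) < critExp d) :
    ((p + 1 : ℝ) : EReal) < critExp d + 1 := by
  rw [EReal.coe_add, EReal.coe_one]
  unfold critExp at hpc ⊢
  split_ifs at hpc ⊢ with h
  · rw [EReal.coe_lt_coe_iff] at hpc
    exact_mod_cast add_lt_add_left hpc 1
  · rw [EReal.top_add_of_ne_bot (by exact_mod_cast EReal.coe_ne_bot 1)]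
    exact_mod_cast EReal.coe_lt_top (p + 1)

lemma two_lt_critExp_add_one {d : ℕ} : ((2 : ℝ) : EReal) < critExp d + 1 := by
  have : ((1 : ℝ) : EReal) < critExp d := by
    unfold critExp
    split_ifs with h
    · have hd3 : (3 : ℝ) ≤ d := by exact_mod_cast h
      rw [EReal.coe_lt_coe_iff, lt_div_iff₀ (by linarith)]
      linarith
    · exact EReal.coe_lt_top 1
  have h2 := lt_critExp_add_one this
  norm_num at h2 ⊢
  exact h2

lemma exists_memLp_one_ne_zero (hΩ : IsOpen Ω) (hne : Ω.Nonempty) :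
    ∃ f : L2 Ω, MemLp f 1 (volume.restrict Ω) ∧ f ≠ 0 := by
  obtain ⟨x, hx⟩ := hne
  obtain ⟨ε, hε, hball⟩ := Metric.isOpen_iff.1 hΩ x hx
  have hpos : 0 < volume.restrict Ω (Metric.ball x ε) := by
    rw [Measure.restrict_apply Metric.isOpen_ball.measurableSet, inter_eq_left.2 hball]
    exact Metric.measure_ball_pos _ _ hε
  have hfin : volume.restrict Ω (Metric.ball x ε) ≠ ∞ :=
    ne_top_of_le_ne_top measure_ball_lt_top.ne (Measure.restrict_apply_le _ _)
  have hm : MeasurableSet (Metric.ball x ε) := Metric.isOpen_ball.measurableSet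
  refine ⟨indicatorConstLp 2 hm hfin (1 : ℂ), ?_, ?_⟩
  · exact (memLp_congr_ae indicatorConstLp_coeFn).2 (memLp_indicator_const 1 hm 1 (Or.inr hfin))
  · rw [← norm_ne_zero_iff, norm_indicatorConstLp two_ne_zero ENNReal.ofNat_ne_top, norm_one,
      one_mul]
    exact (Real.rpow_pos_of_pos (ENNReal.toReal_pos hpos.ne' hfin) _).ne'

lemma exists_ne_zero_of_dense {E : Type*} [NormedAddCommGroup E] [Nontrivial E] {s : Set E}
    (hs : Dense s) : ∃ x ∈ s, x ≠ 0 := by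
  obtain ⟨y, hy⟩ := exists_ne (0 : E)
  obtain ⟨x, hx, hxs⟩ := hs.exists_mem_open isOpen_compl_singleton ⟨y, hy⟩
  exact ⟨x, hx, hxs⟩

/-- The Sobolev inequality under Assumption A. -/
lemma AssumptionA.exists_sobolev {L : L2 Ω →ₗ.[ℂ] L2 Ω} (hA : AssumptionA Ω L) (hd : 1 ≤ d)
    {p : ℝ} (hp : 1 < p) (hpc : (p : EReal) < critExp d) :
    IsNonnegSelfAdjoint ((LinearMap.id : L2 Ω →ₗ[ℂ] L2 Ω) +ᵥ L) ∧
      ∃ K : ℝ≥0∞, K ≠ ∞ ∧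
        ∀ f g, (f, g) ∈ (opSqrt ((LinearMap.id : L2 Ω →ₗ[ℂ] L2 Ω) +ᵥ L)).graph →
          eLpNorm f (ENNReal.ofReal (p + 1)) (volume.restrict Ω) ≤ K * ‖g‖ₑ := by
  obtain ⟨hL, T, hT, hq⟩ := hA
  -- The semigroup of `1 + L`. Since `ω < 1`, the factor `e^(-t)` absorbs the growth `e^(ωt)`; the
  -- case `q = 2` of the hypothesis then gives uniform boundedness on `L²`.
  set S : ℝ → L2 Ω →L[ℂ] L2 Ω := fun t => (Real.exp (-t) : ℂ) • T t with hSdef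
  have hS := hT.exp_smul
  have hM := hL.id_vadd
  have hC : ∃ C, ∀ t, 0 ≤ t → ‖S t‖ ≤ C := by
    obtain ⟨C, ω, hC, hω0, hω1, hb⟩ := hq 2 le_rfl two_lt_critExp_add_one
    refine ⟨max C 1, fun t ht => ?_⟩
    rcases ht.eq_or_lt with rfl | ht
    · simp only [hSdef, hT.map_zero, neg_zero, Real.exp_zero, Complex.ofReal_one, one_smul]
      exact ContinuousLinearMap.norm_id_le.trans (le_max_right _ _)
    · refine (ContinuousLinearMap.opNorm_le_bound _ hC.le fun f => ?_).trans (le_max_left _ _)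
      have h1 := hb t ht f
      rw [sub_self, mul_zero, neg_zero, Real.rpow_zero, mul_one, ENNReal.ofReal_ofNat,
        ← Lp.enorm_def, ← ofReal_norm, ← ofReal_norm, ← ENNReal.ofReal_mul (by positivity),
        ENNReal.ofReal_le_ofReal_iff (by positivity)] at h1
      rw [hSdef, smul_apply, norm_smul, Complex.norm_real, Real.norm_eq_abs, Real.abs_exp]
      calc Real.exp (-t) * ‖T t f‖ ≤ Real.exp (-t) * (C * Real.exp (ω * t) * ‖f‖) := by gcongr
        _ = C * Real.exp (-t + ω * t) * ‖f‖ := by rw [Real.exp_add]; ring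
        _ ≤ C * 1 * ‖f‖ := by
          gcongr
          rw [Real.exp_le_one_iff]
          nlinarith
        _ = C * ‖f‖ := by rw [mul_one]
  obtain ⟨C₀, hC₀⟩ := hC
  have hMn := hS.isNonnegSelfAdjoint hM hC₀
  refine ⟨hMn, ?_⟩
  obtain ⟨C, ω, hC, hω0, hω1, hb⟩ := hq (p + 1) (by linarith) (lt_critExp_add_one hpc)
  set γ := (d : ℝ) / 2 * (1 / 2 - 1 / (p + 1)) with hγ
  have hγ' : γ < 1 / 2 := subcritical_exponent_lt hd hp hpc
  set W : ℝ → ℝ := fun s => C * s ^ (-γ) * Real.exp (-((1 - ω) * s)) with hW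
  have hw : ∀ t, 0 < t → ∀ f, eLpNorm (S t f) (ENNReal.ofReal (p + 1)) (volume.restrict Ω) ≤
      ENNReal.ofReal (W t) * ‖f‖ₑ := by
    intro t ht f
    have h1 : (S t f : EuclideanSpace ℝ (Fin d) → ℂ) =ᵐ[volume.restrict Ω]
        (Real.exp (-t) : ℂ) • (T t f : EuclideanSpace ℝ (Fin d) → ℂ) := Lp.coeFn_smul _ _
    rw [eLpNorm_congr_ae h1, eLpNorm_const_smul]
    have h2 : ‖(Real.exp (-t) : ℂ)‖ₑ = ENNReal.ofReal (Real.exp (-t)) := by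
      rw [← ofReal_norm, Complex.norm_real, Real.norm_eq_abs, Real.abs_exp]
    rw [h2]
    refine (mul_le_mul_right (hb t ht f) _).trans ?_
    rw [← mul_assoc, ← ENNReal.ofReal_mul (Real.exp_nonneg _)]
    refine le_of_eq ?_
    congr 2
    rw [hW]
    simp only
    rw [show -((1 - ω) * t) = -t + ω * t by ring, Real.exp_add]
    ring
  have hqr := Real.HolderConjugate.conjExponent (show 1 < p + 1 by linarith)
  set r := Real.conjExponent (p + 1)
  -- The square and the argument `t / 2` come from writing `S t = S (t/2) S (t/2)` and using the `L²
  -- → L^q` bound for each factor. The integrand is a multiple of `t^(-2γ) e^(-(1-ω)t)`.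
  set J : ℝ≥0∞ := ∫⁻ t in Ioi (0 : ℝ), ENNReal.ofReal (W (t / 2)) ^ 2 with hJ
  have hJtop : J ≠ ∞ := by
    have h1 : ∀ t ∈ Ioi (0 : ℝ), ENNReal.ofReal (W (t / 2)) ^ 2 =
        ENNReal.ofReal (C ^ 2 * (1 / 2) ^ (-(2 * γ)) *
          (t ^ (-(2 * γ)) * Real.exp (-(1 - ω) * t ^ (1 : ℝ)))) := by
      intro t ht
      have ht' : (0 : ℝ) < t := ht
      rw [← ENNReal.ofReal_pow (by positivity)]
      congr 1
      rw [hW]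
      simp only
      rw [mul_pow, mul_pow, ← Real.exp_nat_mul, div_eq_mul_one_div t 2,
        Real.mul_rpow ht'.le (by norm_num), mul_pow, ← Real.rpow_natCast (t ^ (-γ)),
        ← Real.rpow_natCast ((1 / 2 : ℝ) ^ (-γ)), ← Real.rpow_mul ht'.le,
        ← Real.rpow_mul (by norm_num), Real.rpow_one]
      have e1 : -γ * ((2 : ℕ) : ℝ) = -(2 * γ) := by push_cast; ring
      have e2 : ((2 : ℕ) : ℝ) * -((1 - ω) * (t * (1 / 2))) = -(1 - ω) * t := by push_cast; ring
      rw [e1, e2]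
      ring
    rw [hJ, setLIntegral_congr_fun measurableSet_Ioi h1]
    have h2 : IntegrableOn (fun t : ℝ => C ^ 2 * (1 / 2) ^ (-(2 * γ)) *
        (t ^ (-(2 * γ)) * Real.exp (-(1 - ω) * t ^ (1 : ℝ)))) (Ioi 0) :=
      (integrableOn_rpow_mul_exp_neg_mul_rpow (by linarith) one_pos (by linarith)).const_mul _
    exact (Integrable.lintegral_lt_top h2).ne
  refine ⟨J ^ (1 / 2 : ℝ), ENNReal.rpow_ne_top_of_nonneg (by norm_num) hJtop, fun f g hfg => ?_⟩
  refine hS.eLpNorm_le_of_lintegral_inner_le hMn hC₀ hMn.isOpSqrt_opSqrt hqr (by linarith)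
    (ENNReal.rpow_ne_top_of_nonneg (by norm_num) hJtop) (fun v hv => ?_) hfg
  have hJ2 : (J ^ (1 / 2 : ℝ)) ^ 2 = J := by
    rw [← ENNReal.rpow_natCast, ← ENNReal.rpow_mul]
    norm_num
  rw [mul_pow, hJ2, hJ, ← lintegral_mul_const' _ _ (ENNReal.pow_ne_top hv)]
  refine setLIntegral_mono_ae' measurableSet_Ioi (Eventually.of_forall fun t ht => ?_)
  have ht' : (0 : ℝ) < t := ht
  have := hS.enorm_inner_apply_le hM hC₀ hqr (half_pos ht').le (hw _ (half_pos ht')) v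
  rwa [add_halves, mul_pow] at this

/-! ### The inhomogeneous energy space -/

section H1

variable {L : L2 Ω →ₗ.[ℂ] L2 Ω}

lemma h1Norm_eq_of_mem {f g : L2 Ω}
    (h : (f, g) ∈ (opSqrt ((LinearMap.id : L2 Ω →ₗ[ℂ] L2 Ω) +ᵥ L)).graph) :
    h1Norm L f = ‖g‖ₑ := by
  refine le_antisymm (iInf₂_le g h) (le_iInf₂ fun g' h' => ?_)
  rw [LinearPMap.mem_graph_snd_inj _ h h' rfl]

lemma exists_mem_of_h1Norm_ne_top {f : L2 Ω} (h : h1Norm L f ≠ ∞) :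
    ∃ g, (f, g) ∈ (opSqrt ((LinearMap.id : L2 Ω →ₗ[ℂ] L2 Ω) +ᵥ L)).graph := by
  by_contra! hn
  refine h ?_
  simp [h1Norm, hn]

lemma enorm_ofReal_of_pos {s : ℝ} (hs : 0 < s) : ‖(s : ℂ)‖ₑ = ENNReal.ofReal s := by
  rw [← ofReal_norm, Complex.norm_real, Real.norm_eq_abs, abs_of_pos hs]

lemma h1Norm_smul {s : ℝ} (hs : 0 < s) (f : L2 Ω) :
    h1Norm L ((s : ℂ) • f) = ENNReal.ofReal s * h1Norm L f := by
  have hs' : (s : ℂ) ≠ 0 := by exact_mod_cast hs.ne'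
  by_cases h : h1Norm L f = ∞
  · rw [h, ENNReal.mul_top (by simpa using hs)]
    by_contra h'
    obtain ⟨g, hg⟩ := exists_mem_of_h1Norm_ne_top h'
    have := (LinearPMap.graph _).smul_mem (s : ℂ)⁻¹ hg
    rw [Prod.smul_mk, smul_smul, inv_mul_cancel₀ hs', one_smul] at this
    rw [h1Norm_eq_of_mem this] at h
    exact enorm_ne_top h
  · obtain ⟨g, hg⟩ := exists_mem_of_h1Norm_ne_top h
    have := (LinearPMap.graph _).smul_mem (s : ℂ) hg
    rw [Prod.smul_mk] at this
    rw [h1Norm_eq_of_mem hg, h1Norm_eq_of_mem this, enorm_smul, enorm_ofReal_of_pos hs]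

/-- Under Assumption A, the norms of `H¹(L)` and `L^{p+1}` form a Sobolev pair. -/
theorem AssumptionA.isSobolevPair (hA : AssumptionA Ω L) (hd : 1 ≤ d) (hΩ : IsOpen Ω)
    (hne : Ω.Nonempty) {p : ℝ} (hp : 1 < p) (hpc : (p : EReal) < critExp d) :
    IsSobolevPair (h1Norm L) (lqNorm (Ω := Ω) (ENNReal.ofReal (p + 1))) := by
  obtain ⟨hMn, K, hK, hsob⟩ := hA.exists_sobolev hd hp hpc
  refine ⟨fun s hs u => h1Norm_smul hs u, fun s hs u => ?_, ?_, ?_, fun u hu h0 => ?_,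
    fun u hu h0 => hu.2 (lp_eq_zero_of_eLpNorm_eq_zero (by linarith) h0), ?_, K.toReal,
    ENNReal.toReal_nonneg, fun f hf => ?_⟩
  · rw [lqNorm, eLpNorm_congr_ae (Lp.coeFn_smul _ _), eLpNorm_const_smul, enorm_ofReal_of_pos hs,
      lqNorm]
  · rw [h1Norm_eq_of_mem (Submodule.zero_mem _), enorm_zero]
  · rw [lqNorm, eLpNorm_congr_ae (Lp.coeFn_zero _ _ _), eLpNorm_zero]
  · obtain ⟨g, hg⟩ := exists_mem_of_h1Norm_ne_top hu.1
    rw [h1Norm_eq_of_mem hg] at h0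
    have := hsob u g hg
    rw [h0, mul_zero] at this
    exact hu.2 (lp_eq_zero_of_eLpNorm_eq_zero (by linarith) (le_antisymm this zero_le))
  · obtain ⟨f₀, -, hf₀⟩ := exists_memLp_one_ne_zero hΩ hne
    have : Nontrivial (L2 Ω) := ⟨⟨f₀, 0, hf₀⟩⟩
    obtain ⟨f, hf, hf0⟩ := exists_ne_zero_of_dense hMn.isOpSqrt_opSqrt.1.1.dense_domain
    obtain ⟨g, hg⟩ := LinearPMap.mem_domain_iff.1 hf
    exact ⟨f, by rw [h1Norm_eq_of_mem hg]; exact enorm_ne_top, hf0⟩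
  · obtain ⟨g, hg⟩ := exists_mem_of_h1Norm_ne_top hf
    rw [h1Norm_eq_of_mem hg, ENNReal.ofReal_toReal hK]
    exact hsob f g hg

end H1

end Subcritical

/-! ### A diagonal Hardy-Littlewood-Sobolev inequality -/

section HardyLittlewoodSobolev

/-- Interpolation between the two bounds `c₁ b` and `c₂ t^{-s} a`. -/
lemma lintegral_le_of_le_of_le {s a b : ℝ} {c₁ c₂ : ℝ≥0∞} {h : ℝ → ℝ≥0∞} (hs : 1 < s) (ha : 0 < a)
    (hb : 0 < b) (h1 : ∀ t, 0 < t → h t ≤ c₁ * ENNReal.ofReal b)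
    (h2 : ∀ t, 0 < t → h t ≤ c₂ * ENNReal.ofReal (t ^ (-s)) * ENNReal.ofReal a) :
    ∫⁻ t in Ioi (0 : ℝ), h t ≤ (c₁ + c₂ * ENNReal.ofReal (1 / (s - 1))) *
      ENNReal.ofReal (b ^ (1 - 1 / s) * a ^ (1 / s)) := by
  have hs0 : 0 < s := by linarith
  -- The time at which the bounds `b` and `t^(-s) a` agree. The constant bound is integrated before
  -- `τ` and the decaying one after it, with contributions of the same form.
  set τ : ℝ := (a / b) ^ (1 / s) with hτ
  have hτ0 : 0 < τ := by positivity
  have e1 : b * τ = b ^ (1 - 1 / s) * a ^ (1 / s) := by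
    rw [hτ, Real.div_rpow ha.le hb.le, Real.rpow_sub hb, Real.rpow_one]
    ring
  have e2 : τ ^ (1 - s) * a = b ^ (1 - 1 / s) * a ^ (1 / s) := by
    rw [hτ, ← Real.rpow_mul (by positivity), Real.div_rpow ha.le hb.le,
      show 1 / s * (1 - s) = 1 / s - 1 by field_simp, Real.rpow_sub ha, Real.rpow_one,
      show 1 - 1 / s = -(1 / s - 1) by ring, Real.rpow_neg hb.le]
    field_simp
  have hunion : Ioi (0 : ℝ) = Ioc 0 τ ∪ Ioi τ := (Ioc_union_Ioi_eq_Ioi hτ0.le).symm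
  rw [hunion]
  refine (lintegral_union_le _ _ _).trans ?_
  rw [add_mul]
  refine add_le_add ?_ ?_
  · calc ∫⁻ t in Ioc 0 τ, h t ≤ ∫⁻ _ in Ioc 0 τ, c₁ * ENNReal.ofReal b :=
          setLIntegral_mono' measurableSet_Ioc fun t ht => h1 t ht.1
      _ = c₁ * ENNReal.ofReal (b ^ (1 - 1 / s) * a ^ (1 / s)) := by
        rw [setLIntegral_const, Real.volume_Ioc, sub_zero, mul_assoc,
          ← ENNReal.ofReal_mul hb.le, e1]
  · have hint : IntegrableOn (fun t : ℝ => t ^ (-s)) (Ioi τ) :=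
      integrableOn_Ioi_rpow_of_lt (by linarith) hτ0
    have hval : ∫⁻ t in Ioi τ, ENNReal.ofReal (t ^ (-s)) =
        ENNReal.ofReal (1 / (s - 1) * τ ^ (1 - s)) := by
      rw [← ofReal_integral_eq_lintegral_ofReal hint ((ae_restrict_iff' measurableSet_Ioi).2
        (Eventually.of_forall fun t ht => Real.rpow_nonneg (hτ0.trans ht).le _)),
        integral_Ioi_rpow_of_lt (by linarith) hτ0]
      congr 1
      rw [show -s + 1 = -(s - 1) by ring, neg_div_neg_eq, show 1 - s = -(s - 1) by ring]
      ring
    calc ∫⁻ t in Ioi τ, h t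
        ≤ ∫⁻ t in Ioi τ, c₂ * ENNReal.ofReal a * ENNReal.ofReal (t ^ (-s)) :=
          setLIntegral_mono' measurableSet_Ioi fun t ht =>
            (h2 t (hτ0.trans ht)).trans (le_of_eq (by ring))
      _ = c₂ * ENNReal.ofReal a * ENNReal.ofReal (1 / (s - 1) * τ ^ (1 - s)) := by
        rw [lintegral_const_mul _ (by fun_prop), hval]
      _ = c₂ * ENNReal.ofReal (1 / (s - 1)) *
          ENNReal.ofReal (b ^ (1 - 1 / s) * a ^ (1 / s)) := by
        rw [← e2, ENNReal.ofReal_mul (one_div_nonneg.2 (by linarith)),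
          ENNReal.ofReal_mul (by positivity)]
        ring

variable {α : Type*} [MeasurableSpace α] {μ : Measure α}

/-- A symmetric kernel `k t x y` that is bounded on `L^∞` uniformly in `t` and decays pointwise
like `t^{-σ}`. -/
structure IsUltracontractiveKernel (μ : Measure α) (k : ℝ → α → α → ℝ≥0∞) (σ : ℝ)
    (c D : ℝ≥0∞) : Prop where
  measurable : Measurable fun z : ℝ × α × α => k z.1 z.2.1 z.2.2
  symm : ∀ t x y, k t x y = k t y x
  lintegral_le : ∀ t, 0 < t → ∀ x, ∫⁻ y, k t x y ∂μ ≤ c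
  le_rpow : ∀ t, 0 < t → ∀ x y, k t x y ≤ D * ENNReal.ofReal (t ^ (-σ))
  ne_top_left : c ≠ ∞
  ne_top_right : D ≠ ∞

namespace IsUltracontractiveKernel

variable {k : ℝ → α → α → ℝ≥0∞} {σ : ℝ} {c D : ℝ≥0∞}

lemma measurable_right (hk : IsUltracontractiveKernel μ k σ c D) (t : ℝ) (x : α) :
    Measurable (k t x) :=
  hk.measurable.comp (measurable_const.prodMk (measurable_const.prodMk measurable_id))

lemma measurable_uncurry (hk : IsUltracontractiveKernel μ k σ c D) (t : ℝ) :
    Measurable (fun z : α × α => k t z.1 z.2) :=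
  hk.measurable.comp (measurable_const.prodMk measurable_id)

/-- Hölder's inequality together with `k^q ≤ (sup k)^(q-1) k`, and `(q - 1)/q = 1/r`. It is an `L^r
→ L^∞` bound interpolated between the two properties of the kernel. -/
lemma lintegral_mul_le (hk : IsUltracontractiveKernel μ k σ c D) {q r : ℝ}
    (hqr : q.HolderConjugate r) {t : ℝ} (ht : 0 < t) (x : α) {w : α → ℝ≥0∞} (hw : Measurable w) :
    ∫⁻ y, k t x y * w y ∂μ ≤ D ^ (1 / r) * c ^ (1 / q) * ENNReal.ofReal (t ^ (-(σ / r))) *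
      (∫⁻ y, w y ^ r ∂μ) ^ (1 / r) := by
  have hq0 := hqr.pos
  have hq1 := hqr.lt
  have hr0 := hqr.symm.pos
  refine (ENNReal.lintegral_mul_le_Lp_mul_Lq μ hqr (hk.measurable_right t x).aemeasurable
    hw.aemeasurable).trans ?_
  gcongr
  have h1 : ∫⁻ y, k t x y ^ q ∂μ ≤ (D * ENNReal.ofReal (t ^ (-σ))) ^ (q - 1) * c := by
    calc ∫⁻ y, k t x y ^ q ∂μ
        ≤ ∫⁻ y, (D * ENNReal.ofReal (t ^ (-σ))) ^ (q - 1) * k t x y ∂μ := by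
          refine lintegral_mono fun y => ?_
          have : k t x y ^ q = k t x y ^ (q - 1) * k t x y := by
            conv_lhs => rw [show q = (q - 1) + 1 by ring]
            rw [ENNReal.rpow_add_of_nonneg _ _ (by linarith) zero_le_one, ENNReal.rpow_one]
          simp only [this]
          gcongr
          exact hk.le_rpow t ht x y
      _ ≤ (D * ENNReal.ofReal (t ^ (-σ))) ^ (q - 1) * c := by
          rw [lintegral_const_mul _ (hk.measurable_right t x)]
          gcongr
          exact hk.lintegral_le t ht x
  have e1 : (q - 1) * (1 / q) = 1 / r := by
    rw [one_div, one_div, ← hqr.one_sub_inv]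
    field_simp
  refine (ENNReal.rpow_le_rpow h1 (by positivity)).trans (le_of_eq ?_)
  rw [ENNReal.mul_rpow_of_nonneg _ _ (by positivity), ← ENNReal.rpow_mul, e1,
    ENNReal.mul_rpow_of_nonneg _ _ (by positivity),
    ENNReal.ofReal_rpow_of_nonneg (by positivity) (by positivity), ← Real.rpow_mul ht.le,
    show -σ * (1 / r) = -(σ / r) by ring]
  ring

variable [SFinite μ]

/-- The contribution of the pairs with `v y ≤ v x`. -/
lemma lintegral_indicator_le (hk : IsUltracontractiveKernel μ k σ c D) {q r s a : ℝ}
    (hqr : q.HolderConjugate r) (hs : 1 < s) (hsr : σ / r = s) {v : α → ℝ≥0∞} (hv : Measurable v)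
    (ha : 0 < a) (hva : (∫⁻ y, v y ^ r ∂μ) ^ (1 / r) = ENNReal.ofReal a) {x : α} (hx : v x ≠ ∞) :
    ∫⁻ t in Ioi (0 : ℝ), ∫⁻ y, k t x y * {y | v y ≤ v x}.indicator v y ∂μ ≤
      (c + D ^ (1 / r) * c ^ (1 / q) * ENNReal.ofReal (1 / (s - 1))) *
        (v x ^ (1 - 1 / s) * ENNReal.ofReal a ^ (1 / s)) := by
  have hmeas : MeasurableSet {y | v y ≤ v x} := measurableSet_le hv measurable_const
  have hs1 : 0 < 1 - 1 / s := sub_pos.2 ((div_lt_one (by linarith)).2 hs)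
  have hs0 : 0 < 1 / s := by positivity
  rcases eq_or_ne (v x) 0 with h0 | h0
  · have : ∀ t y, k t x y * {y | v y ≤ v x}.indicator v y = 0 := fun t y => by
      by_cases hy : v y ≤ v x
      · have : v y = 0 := le_antisymm (hy.trans h0.le) zero_le
        simp [indicator, this]
      · simp [indicator, hy]
    simp [this]
  have hb : 0 < (v x).toReal := ENNReal.toReal_pos h0 hx
  have hvx : v x = ENNReal.ofReal (v x).toReal := (ENNReal.ofReal_toReal hx).symm
  -- The truncation `v y ≤ v x` supplies the time-independent bound `c * v x`, which would fail for
  -- `v` itself. The decaying bound uses the `L^r` norm of `v`.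
  have hle := lintegral_le_of_le_of_le (c₁ := c) (c₂ := D ^ (1 / r) * c ^ (1 / q))
    (h := fun t => ∫⁻ y, k t x y * {y | v y ≤ v x}.indicator v y ∂μ) hs ha hb
    (fun t ht => ?_) (fun t ht => ?_)
  · refine hle.trans (le_of_eq ?_)
    rw [ENNReal.ofReal_mul (by positivity), ← ENNReal.ofReal_rpow_of_nonneg hb.le hs1.le,
      ← ENNReal.ofReal_rpow_of_nonneg ha.le hs0.le, ← hvx]
  · calc ∫⁻ y, k t x y * {y | v y ≤ v x}.indicator v y ∂μ
        ≤ ∫⁻ y, k t x y * v x ∂μ := by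
          refine lintegral_mono fun y => ?_
          gcongr
          exact indicator_le (fun y hy => hy) y
      _ = (∫⁻ y, k t x y ∂μ) * v x := lintegral_mul_const _ (hk.measurable_right t x)
      _ ≤ c * ENNReal.ofReal (v x).toReal := by
          rw [← hvx]
          gcongr
          exact hk.lintegral_le t ht x
  · rw [← hva, ← hsr]
    refine (hk.lintegral_mul_le hqr ht x (hv.indicator hmeas)).trans ?_
    gcongr
    · have := hqr.symm.pos
      positivity
    · exact hqr.symm.pos.le
    · exact indicator_le_self _ _ _

/-- A diagonal Hardy-Littlewood-Sobolev inequality. -/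
theorem lintegral_lintegral_mul_le (hk : IsUltracontractiveKernel μ k σ c D) {q r s : ℝ}
    (hqr : q.HolderConjugate r) (hs : 1 < s) (hsr : σ / r = s) (hrs : r = 2 - 1 / s)
    {v : α → ℝ≥0∞} (hv : Measurable v) (hvtop : ∀ x, v x ≠ ∞)
    (hvr : (∫⁻ y, v y ^ r ∂μ) ^ (1 / r) ≠ ∞) :
    ∫⁻ t in Ioi (0 : ℝ), ∫⁻ x, ∫⁻ y, k t x y * (v x * v y) ∂μ ∂μ ≤
      2 * (c + D ^ (1 / r) * c ^ (1 / q) * ENNReal.ofReal (1 / (s - 1))) *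
        ((∫⁻ y, v y ^ r ∂μ) ^ (1 / r)) ^ 2 := by
  have hr0 := hqr.symm.pos
  set A := (∫⁻ y, v y ^ r ∂μ) ^ (1 / r) with hA
  have hAr : A ^ r = ∫⁻ y, v y ^ r ∂μ := by
    rw [hA, ← ENNReal.rpow_mul, one_div_mul_cancel hr0.ne', ENNReal.rpow_one]
  rcases eq_or_ne A 0 with h0 | h0
  · have h1 : ∫⁻ y, v y ^ r ∂μ = 0 := by rw [← hAr, h0, ENNReal.zero_rpow_of_pos hr0]
    rw [lintegral_eq_zero_iff (hv.pow_const r)] at h1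
    have h2 : v =ᵐ[μ] 0 := h1.mono fun x hx => by
      simpa [hr0, hr0.le, not_lt.2 hr0.le] using hx
    have h3 : ∀ t x, ∫⁻ y, k t x y * (v x * v y) ∂μ = 0 := fun t x => by
      rw [lintegral_congr_ae (h2.mono fun y hy => by simp only [hy, Pi.zero_apply, mul_zero] :
        (fun y => k t x y * (v x * v y)) =ᵐ[μ] fun _ => 0)]
      simp
    simp [h3]
  -- By symmetry of the kernel only pairs with `v y ≤ v x` matter, at the price of a factor `2`. For
  -- these the time integral is a multiple of `A^(1/s) v(x)^(2 - 1/s) = A^(1/s) v(x)^r`, and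
  -- integrating in `x` gives `A^(1/s + r) = A²`.
  set F : ℝ → α → α → ℝ≥0∞ := fun t x y => k t x y * (v x * {y | v y ≤ v x}.indicator v y) with hF
  have hind : Measurable fun z : α × α => {y | v y ≤ v z.1}.indicator v z.2 := by
    have : (fun z : α × α => {y | v y ≤ v z.1}.indicator v z.2) =
        {z : α × α | v z.2 ≤ v z.1}.indicator (fun z => v z.2) := by
      ext z
      by_cases hz : v z.2 ≤ v z.1 <;> simp [indicator, hz]
    rw [this]
    exact (hv.comp measurable_snd).indicator
      (measurableSet_le (hv.comp measurable_snd) (hv.comp measurable_fst))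
  have hFm : Measurable fun z : ℝ × α × α => F z.1 z.2.1 z.2.2 :=
    hk.measurable.mul ((hv.comp (measurable_fst.comp measurable_snd)).mul
      (hind.comp measurable_snd))
  have hFm' : ∀ t, Measurable fun z : α × α => F t z.1 z.2 := fun t =>
    hFm.comp (measurable_const.prodMk measurable_id)
  have hsplit : ∀ t x y, k t x y * (v x * v y) ≤ F t x y + F t y x := by
    intro t x y
    simp only [hF]
    rw [hk.symm t y x, ← mul_add]
    gcongr
    rcases le_total (v y) (v x) with hxy | hxy
    · refine le_add_right ?_
      simp [indicator, hxy]
    · refine le_add_left ?_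
      simp [indicator, hxy, mul_comm]
  have hsum : ∀ t, ∫⁻ x, ∫⁻ y, k t x y * (v x * v y) ∂μ ∂μ ≤
      2 * ∫⁻ x, ∫⁻ y, F t x y ∂μ ∂μ := by
    intro t
    calc ∫⁻ x, ∫⁻ y, k t x y * (v x * v y) ∂μ ∂μ
        ≤ ∫⁻ x, ∫⁻ y, (F t x y + F t y x) ∂μ ∂μ :=
          lintegral_mono fun x => lintegral_mono fun y => hsplit t x y
      _ = ∫⁻ x, (∫⁻ y, F t x y ∂μ + ∫⁻ y, F t y x ∂μ) ∂μ :=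
          lintegral_congr fun x => lintegral_add_left
            ((hFm' t).comp (measurable_const.prodMk measurable_id)) _
      _ = ∫⁻ x, ∫⁻ y, F t x y ∂μ ∂μ + ∫⁻ x, ∫⁻ y, F t y x ∂μ ∂μ :=
          lintegral_add_left (hFm' t).lintegral_prod_right' _
      _ = 2 * ∫⁻ x, ∫⁻ y, F t x y ∂μ ∂μ := by
          rw [lintegral_lintegral_swap (f := fun x y => F t y x)
            (((hFm' t).comp measurable_swap).aemeasurable), two_mul]
  have hAtop : ENNReal.ofReal A.toReal = A := ENNReal.ofReal_toReal hvr
  have hin : ∀ x, ∫⁻ t in Ioi (0 : ℝ), ∫⁻ y, F t x y ∂μ ≤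
      (c + D ^ (1 / r) * c ^ (1 / q) * ENNReal.ofReal (1 / (s - 1))) *
        A ^ (1 / s) * v x ^ r := by
    intro x
    have h1 : ∀ t, ∫⁻ y, F t x y ∂μ =
        v x * ∫⁻ y, k t x y * {y | v y ≤ v x}.indicator v y ∂μ := fun t => by
      rw [← lintegral_const_mul' _ _ (hvtop x)]
      exact lintegral_congr fun y => by simp only [hF]; ring
    simp_rw [h1]
    rw [lintegral_const_mul' _ _ (hvtop x)]
    have h2 := hk.lintegral_indicator_le hqr hs hsr hv (ENNReal.toReal_pos h0 hvr)
      (hA.symm.trans hAtop.symm) (hvtop x)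
    rw [hAtop] at h2
    refine (mul_le_mul_right h2 (v x)).trans (le_of_eq ?_)
    have hs1 : 0 < 1 - 1 / s := sub_pos.2 ((div_lt_one (by linarith)).2 hs)
    rw [hrs, show 2 - 1 / s = (1 - 1 / s) + 1 by ring,
      ENNReal.rpow_add_of_nonneg _ _ hs1.le zero_le_one, ENNReal.rpow_one]
    ring
  calc ∫⁻ t in Ioi (0 : ℝ), ∫⁻ x, ∫⁻ y, k t x y * (v x * v y) ∂μ ∂μ
      ≤ ∫⁻ t in Ioi (0 : ℝ), 2 * ∫⁻ x, ∫⁻ y, F t x y ∂μ ∂μ := lintegral_mono fun t => hsum t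
    _ = 2 * ∫⁻ x, (∫⁻ t in Ioi (0 : ℝ), ∫⁻ y, F t x y ∂μ) ∂μ := by
        rw [lintegral_const_mul' _ _ ENNReal.ofNat_ne_top, lintegral_lintegral_swap]
        refine Measurable.aemeasurable ?_
        exact Measurable.lintegral_prod_right' (f := fun z : (ℝ × α) × α => F z.1.1 z.1.2 z.2)
          (hFm.comp MeasurableEquiv.prodAssoc.measurable)
    _ ≤ 2 * ∫⁻ x, (c + D ^ (1 / r) * c ^ (1 / q) * ENNReal.ofReal (1 / (s - 1))) *
        A ^ (1 / s) * v x ^ r ∂μ := by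
        gcongr with x
        exact hin x
    _ = 2 * (c + D ^ (1 / r) * c ^ (1 / q) * ENNReal.ofReal (1 / (s - 1))) * A ^ 2 := by
        rw [lintegral_const_mul _ (hv.pow_const r), ← hAr]
        have : A ^ 2 = A ^ (1 / s) * A ^ r := by
          rw [← ENNReal.rpow_add_of_nonneg _ _ (by positivity) hr0.le, hrs,
            show 1 / s + (2 - 1 / s) = ((2 : ℕ) : ℝ) by push_cast; ring, ENNReal.rpow_natCast]
        rw [this]
        ring

end IsUltracontractiveKernel

end HardyLittlewoodSobolev

/-! ### Semigroups dominated by Gaussian kernels -/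

section GaussianKernels

local notation "⟪" x ", " y "⟫" => inner ℂ x y

variable {d : ℕ} {Ω : Set (EuclideanSpace ℝ (Fin d))}

lemma lintegral_gaussian_le {c t : ℝ} (hc : 0 < c) (ht : 0 < t) (C : ℝ)
    (x : EuclideanSpace ℝ (Fin d)) :
    ∫⁻ y in Ω, ENNReal.ofReal (C * t ^ (-((d : ℝ) / 2)) * Real.exp (-(‖x - y‖ ^ 2 / (c * t)))) ≤
      ENNReal.ofReal (C * (Real.pi * c) ^ ((d : ℝ) / 2)) := by
  have hb : 0 < 1 / (c * t) := by positivity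
  have h1 := GaussianFourier.integral_rexp_neg_mul_sq_norm (V := EuclideanSpace ℝ (Fin d)) hb
  -- The Gaussian integral has a positive value, whereas the integral of a non-integrable function
  -- is zero by convention.
  have hint : Integrable (fun v : EuclideanSpace ℝ (Fin d) => Real.exp (-(1 / (c * t)) * ‖v‖ ^ 2)) :=
    by_contra fun hn => by
      rw [integral_undef hn] at h1
      exact (Real.rpow_pos_of_pos (by positivity) _).ne h1
  calc ∫⁻ y in Ω, ENNReal.ofReal (C * t ^ (-((d : ℝ) / 2)) *
        Real.exp (-(‖x - y‖ ^ 2 / (c * t))))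
      ≤ ∫⁻ y, ENNReal.ofReal (C * t ^ (-((d : ℝ) / 2)) *
        Real.exp (-(‖x - y‖ ^ 2 / (c * t)))) := setLIntegral_le_lintegral _ _
    _ = ∫⁻ y, ENNReal.ofReal (C * t ^ (-((d : ℝ) / 2))) *
        ENNReal.ofReal (Real.exp (-(1 / (c * t)) * ‖y‖ ^ 2)) := by
        rw [← lintegral_sub_left_eq_self _ x]
        refine lintegral_congr fun y => ?_
        rw [sub_sub_cancel, ENNReal.ofReal_mul' (Real.exp_nonneg _)]
        congr 3
        ring
    _ = ENNReal.ofReal (C * t ^ (-((d : ℝ) / 2))) *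
        ENNReal.ofReal ((Real.pi / (1 / (c * t))) ^ ((d : ℝ) / 2)) := by
        rw [lintegral_const_mul' _ _ ENNReal.ofReal_ne_top,
          ← ofReal_integral_eq_lintegral_ofReal hint
            (Eventually.of_forall fun y => Real.exp_nonneg _), h1, finrank_euclideanSpace_fin]
    _ = ENNReal.ofReal (C * (Real.pi * c) ^ ((d : ℝ) / 2)) := by
        rw [← ENNReal.ofReal_mul' (by positivity)]
        congr 1
        rw [show Real.pi / (1 / (c * t)) = Real.pi * c * t by field_simp,
          Real.mul_rpow (by positivity) ht.le, Real.rpow_neg ht.le]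
        field_simp

/-- The Gaussian majorant replaces the heat kernel itself: it is symmetric, jointly measurable also
in time, and its bounds hold at every point rather than almost everywhere. -/
lemma isUltracontractiveKernel_gaussian {c C : ℝ} (hc : 0 < c) (hC : 0 < C) :
    IsUltracontractiveKernel (volume.restrict Ω)
      (fun t x y => ENNReal.ofReal (C * t ^ (-((d : ℝ) / 2)) *
        Real.exp (-(‖x - y‖ ^ 2 / (c * t))))) ((d : ℝ) / 2)
      (ENNReal.ofReal (C * (Real.pi * c) ^ ((d : ℝ) / 2))) (ENNReal.ofReal C) where
  measurable := by
    refine Measurable.ennreal_ofReal (Measurable.mul ?_ ?_)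
    · exact (measurable_fst.pow_const _).const_mul _
    · exact Real.measurable_exp.comp
        (((((measurable_fst.comp measurable_snd).sub
          (measurable_snd.comp measurable_snd)).norm.pow_const 2).div
            (measurable_fst.const_mul c)).neg)
  symm t x y := by rw [norm_sub_rev]
  lintegral_le t ht x := lintegral_gaussian_le hc ht C x
  le_rpow t ht x y := by
    rw [← ENNReal.ofReal_mul hC.le]
    refine ENNReal.ofReal_le_ofReal (mul_le_of_le_one_right (by positivity) ?_)
    rw [Real.exp_le_one_iff, neg_nonpos]
    positivity
  ne_top_left := ENNReal.ofReal_ne_top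
  ne_top_right := ENNReal.ofReal_ne_top

variable {α : Type*} [MeasurableSpace α] {μ : Measure α}

/-- The operators `T t` are dominated by the integral operators with kernels `k t`. -/
def IsDominatedBy (T : ℝ → Lp ℂ 2 μ →L[ℂ] Lp ℂ 2 μ) (k : ℝ → α → α → ℝ≥0∞) : Prop :=
  ∀ t, 0 < t → ∀ f : Lp ℂ 2 μ, ∀ᵐ x ∂μ, ‖T t f x‖ₑ ≤ ∫⁻ y, k t x y * ‖f y‖ₑ ∂μ

lemma AssumptionB.exists_kernel {L : L2 Ω →ₗ.[ℂ] L2 Ω} (hB : AssumptionB Ω L) :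
    ∃ (T : ℝ → L2 Ω →L[ℂ] L2 Ω)
      (k : ℝ → EuclideanSpace ℝ (Fin d) → EuclideanSpace ℝ (Fin d) → ℝ≥0∞) (c D : ℝ≥0∞),
      IsSemigroupOf L T ∧ IsUltracontractiveKernel (volume.restrict Ω) k ((d : ℝ) / 2) c D ∧
      IsDominatedBy T k := by
  obtain ⟨-, T, K, hT, -, hK, c, C, hc, hC, hb⟩ := hB
  refine ⟨T, _, _, _, hT, isUltracontractiveKernel_gaussian hc hC, fun t ht f => ?_⟩
  filter_upwards [hK t ht f, Measure.ae_ae_of_ae_prod (hb t ht)] with x hx hxy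
  rw [hx]
  refine (enorm_integral_le_lintegral_enorm _).trans (lintegral_mono_ae ?_)
  filter_upwards [hxy] with y hy
  rw [enorm_mul]
  gcongr
  rw [← ofReal_norm]
  exact ENNReal.ofReal_le_ofReal hy

namespace IsDominatedBy

variable {T : ℝ → Lp ℂ 2 μ →L[ℂ] Lp ℂ 2 μ} {k : ℝ → α → α → ℝ≥0∞} {σ t : ℝ} {c D : ℝ≥0∞}

lemma enorm_inner_le (h : IsDominatedBy T k) (ht : 0 < t) (v f : Lp ℂ 2 μ) :
    ‖⟪v, T t f⟫‖ₑ ≤ ∫⁻ x, ∫⁻ y, k t x y * (‖v x‖ₑ * ‖f y‖ₑ) ∂μ ∂μ := by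
  refine (enorm_inner_le_lintegral v (T t f)).trans (lintegral_mono_ae ?_)
  filter_upwards [h t ht f] with x hx
  refine (mul_le_mul_right hx _).trans (le_of_eq ?_)
  rw [← lintegral_const_mul' _ _ enorm_ne_top]
  exact lintegral_congr fun y => by ring

lemma enorm_inner_le_eLpNorm_one (h : IsDominatedBy T k)
    (hk : IsUltracontractiveKernel μ k σ c D) (ht : 0 < t) (v f : Lp ℂ 2 μ) :
    ‖⟪v, T t f⟫‖ₑ ≤ D * ENNReal.ofReal (t ^ (-σ)) * (eLpNorm v 1 μ * eLpNorm f 1 μ) := by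
  refine (h.enorm_inner_le ht v f).trans ?_
  have hv := (Lp.stronglyMeasurable v).measurable.enorm
  have hf := (Lp.stronglyMeasurable f).measurable.enorm
  calc ∫⁻ x, ∫⁻ y, k t x y * (‖v x‖ₑ * ‖f y‖ₑ) ∂μ ∂μ
      ≤ ∫⁻ x, ∫⁻ y, D * ENNReal.ofReal (t ^ (-σ)) * (‖v x‖ₑ * ‖f y‖ₑ) ∂μ ∂μ := by
        gcongr with x y
        exact hk.le_rpow t ht x y
    _ = D * ENNReal.ofReal (t ^ (-σ)) * (eLpNorm v 1 μ * eLpNorm f 1 μ) := by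
        have h1 : ∀ x, ∫⁻ y, D * ENNReal.ofReal (t ^ (-σ)) * (‖v x‖ₑ * ‖f y‖ₑ) ∂μ =
            D * ENNReal.ofReal (t ^ (-σ)) * eLpNorm f 1 μ * ‖v x‖ₑ := fun x => by
          rw [eLpNorm_one_eq_lintegral_enorm, lintegral_const_mul _ (hf.const_mul _),
            lintegral_const_mul _ hf]
          ring
        simp_rw [h1]
        rw [lintegral_const_mul _ hv, eLpNorm_one_eq_lintegral_enorm,
          eLpNorm_one_eq_lintegral_enorm]
        ring

lemma eLpNorm_one_le [SFinite μ] (h : IsDominatedBy T k)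
    (hk : IsUltracontractiveKernel μ k σ c D) (ht : 0 < t) (f : Lp ℂ 2 μ) :
    eLpNorm (T t f) 1 μ ≤ c * eLpNorm f 1 μ := by
  have hf := (Lp.stronglyMeasurable f).measurable.enorm
  rw [eLpNorm_one_eq_lintegral_enorm, eLpNorm_one_eq_lintegral_enorm]
  calc ∫⁻ x, ‖T t f x‖ₑ ∂μ ≤ ∫⁻ x, ∫⁻ y, k t x y * ‖f y‖ₑ ∂μ ∂μ := lintegral_mono_ae (h t ht f)
    _ = ∫⁻ y, ∫⁻ x, k t x y * ‖f y‖ₑ ∂μ ∂μ := lintegral_lintegral_swap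
        ((hk.measurable_uncurry t).mul (hf.comp measurable_snd)).aemeasurable
    _ ≤ ∫⁻ y, c * ‖f y‖ₑ ∂μ := by
        refine lintegral_mono fun y => ?_
        rw [lintegral_mul_const' _ _ enorm_ne_top]
        simp_rw [hk.symm t _ y]
        gcongr
        exact hk.lintegral_le t ht y
    _ = c * ∫⁻ y, ‖f y‖ₑ ∂μ := lintegral_const_mul _ hf

/-- Schur's test. -/
lemma norm_le [SFinite μ] (h : IsDominatedBy T k)
    (hk : IsUltracontractiveKernel μ k σ c D) (ht : 0 < t) : ‖T t‖ ≤ c.toReal := by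
  refine ContinuousLinearMap.opNorm_le_bound _ ENNReal.toReal_nonneg fun f => ?_
  have hf := (Lp.stronglyMeasurable f).measurable.enorm
  have hsq : ∀ g : Lp ℂ 2 μ, ‖g‖ₑ ^ 2 = ∫⁻ x, ‖g x‖ₑ ^ 2 ∂μ := fun g => by
    rw [Lp.enorm_def, eLpNorm_eq_lintegral_rpow_enorm_toReal two_ne_zero ENNReal.ofNat_ne_top,
      ← ENNReal.rpow_natCast, ← ENNReal.rpow_mul]
    simp
  -- Cauchy-Schwarz for the splitting `k = k^(1/2) k^(1/2)`; the symmetry of `k` later bounds the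
  -- other marginal.
  have hpt : ∀ x, (∫⁻ y, k t x y * ‖f y‖ₑ ∂μ) ^ 2 ≤ c * ∫⁻ y, k t x y * ‖f y‖ₑ ^ 2 ∂μ := by
    intro x
    have hkx := hk.measurable_right t x
    have h1 : ∀ z : ℝ≥0∞, (z ^ (1 / 2 : ℝ)) ^ (2 : ℝ) = z := fun z => by
      rw [← ENNReal.rpow_mul]; norm_num
    have h2 := ENNReal.lintegral_mul_le_Lp_mul_Lq μ (Real.HolderConjugate.two_two)
      (f := fun y => k t x y ^ (1 / 2 : ℝ)) (g := fun y => k t x y ^ (1 / 2 : ℝ) * ‖f y‖ₑ)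
      (hkx.pow_const _).aemeasurable ((hkx.pow_const _).mul hf).aemeasurable
    have h3 : ∀ y, ((fun y => k t x y ^ (1 / 2 : ℝ)) * fun y => k t x y ^ (1 / 2 : ℝ) * ‖f y‖ₑ) y
        = k t x y * ‖f y‖ₑ := fun y => by
      simp only [Pi.mul_apply]
      rw [← mul_assoc, ← ENNReal.rpow_add_of_nonneg _ _ (by norm_num) (by norm_num)]
      norm_num
    simp_rw [h3, ENNReal.mul_rpow_of_nonneg _ _ zero_le_two, h1] at h2
    calc (∫⁻ y, k t x y * ‖f y‖ₑ ∂μ) ^ 2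
        ≤ ((∫⁻ y, k t x y ∂μ) ^ (1 / 2 : ℝ) *
          (∫⁻ y, k t x y * ‖f y‖ₑ ^ (2 : ℝ) ∂μ) ^ (1 / 2 : ℝ)) ^ 2 := by gcongr
      _ = (∫⁻ y, k t x y ∂μ) * ∫⁻ y, k t x y * ‖f y‖ₑ ^ (2 : ℝ) ∂μ := by
          rw [mul_pow, ← ENNReal.rpow_natCast, ← ENNReal.rpow_natCast]
          norm_num only [Nat.cast_ofNat, h1]
      _ ≤ c * ∫⁻ y, k t x y * ‖f y‖ₑ ^ 2 ∂μ := by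
          simp_rw [ENNReal.rpow_two]
          gcongr
          exact hk.lintegral_le t ht x
  have hfin : ‖T t f‖ₑ ^ 2 ≤ (c * ‖f‖ₑ) ^ 2 := by
    rw [hsq, mul_pow, hsq]
    calc ∫⁻ x, ‖T t f x‖ₑ ^ 2 ∂μ ≤ ∫⁻ x, c * ∫⁻ y, k t x y * ‖f y‖ₑ ^ 2 ∂μ ∂μ := by
          refine lintegral_mono_ae ?_
          filter_upwards [h t ht f] with x hx
          exact (pow_le_pow_left₀ zero_le hx 2).trans (hpt x)
      _ = c * ∫⁻ y, ∫⁻ x, k t x y * ‖f y‖ₑ ^ 2 ∂μ ∂μ := by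
          rw [lintegral_const_mul' _ _ hk.ne_top_left, lintegral_lintegral_swap]
          exact ((hk.measurable_uncurry t).mul
            ((hf.pow_const 2).comp measurable_snd)).aemeasurable
      _ ≤ c * ∫⁻ y, c * ‖f y‖ₑ ^ 2 ∂μ := by
          gcongr with y
          rw [lintegral_mul_const' _ _ (ENNReal.pow_ne_top enorm_ne_top)]
          simp_rw [hk.symm t _ y]
          gcongr
          exact hk.lintegral_le t ht y
      _ = c ^ 2 * ∫⁻ y, ‖f y‖ₑ ^ 2 ∂μ := by
          rw [lintegral_const_mul _ (hf.pow_const 2)]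
          ring
  have h4 : ‖T t f‖ₑ ≤ c * ‖f‖ₑ := (ENNReal.pow_le_pow_left_iff two_ne_zero).1 hfin
  have h5 := ENNReal.toReal_mono (ENNReal.mul_ne_top hk.ne_top_left enorm_ne_top) h4
  rwa [ENNReal.toReal_mul, toReal_enorm, toReal_enorm] at h5

lemma norm_le_max [SFinite μ] {M : Lp ℂ 2 μ →ₗ.[ℂ] Lp ℂ 2 μ} (h : IsDominatedBy T k)
    (hT : IsSemigroupOf M T) (hk : IsUltracontractiveKernel μ k σ c D) (t : ℝ) (ht : 0 ≤ t) :
    ‖T t‖ ≤ max c.toReal 1 := by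
  rcases ht.eq_or_lt with rfl | ht
  · rw [hT.map_zero]
    exact ContinuousLinearMap.norm_id_le.trans (le_max_right _ _)
  · exact (h.norm_le hk ht).trans (le_max_left _ _)

/-- The Sobolev inequality for semigroups with ultracontractive kernels. -/
theorem exists_sobolev [SigmaFinite μ] {M B : Lp ℂ 2 μ →ₗ.[ℂ] Lp ℂ 2 μ} (h : IsDominatedBy T k)
    (hT : IsSemigroupOf M T) (hM : IsNonnegSelfAdjoint M)
    (hk : IsUltracontractiveKernel μ k σ c D) (hB : IsOpSqrt M B) {q r s : ℝ}
    (hqr : q.HolderConjugate r) (hq : 2 ≤ q) (hs : 1 < s) (hsr : σ / r = s)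
    (hrs : r = 2 - 1 / s) :
    ∃ K : ℝ≥0∞, K ≠ ∞ ∧ ∀ f g, (f, g) ∈ B.graph →
      eLpNorm f (ENNReal.ofReal q) μ ≤ K * ‖g‖ₑ := by
  have hr0 := hqr.symm.pos
  set K := 2 * (c + D ^ (1 / r) * c ^ (1 / q) * ENNReal.ofReal (1 / (s - 1)))
  have hK : K ≠ ∞ := by
    refine ENNReal.mul_ne_top ENNReal.ofNat_ne_top (ENNReal.add_ne_top.2 ⟨hk.ne_top_left, ?_⟩)
    exact ENNReal.mul_ne_top (ENNReal.mul_ne_top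
      (ENNReal.rpow_ne_top_of_nonneg (one_div_nonneg.2 hr0.le) hk.ne_top_right)
      (ENNReal.rpow_ne_top_of_nonneg (one_div_nonneg.2 hqr.pos.le) hk.ne_top_left))
      ENNReal.ofReal_ne_top
  have hK2 : (K ^ (1 / 2 : ℝ)) ^ 2 = K := by
    rw [← ENNReal.rpow_natCast, ← ENNReal.rpow_mul]
    norm_num
  refine ⟨K ^ (1 / 2 : ℝ), ENNReal.rpow_ne_top_of_nonneg (by norm_num) hK, fun f g hfg => ?_⟩
  refine hT.eLpNorm_le_of_lintegral_inner_le hM (h.norm_le_max hT hk) hB hqr hq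
    (ENNReal.rpow_ne_top_of_nonneg (by norm_num) hK) (fun v hv => ?_) hfg
  rw [mul_pow, hK2]
  rw [eLpNorm_eq_lintegral_rpow_enorm_toReal (by simpa using hr0) ENNReal.ofReal_ne_top,
    ENNReal.toReal_ofReal hr0.le] at hv ⊢
  refine le_trans (setLIntegral_mono_ae' measurableSet_Ioi (Eventually.of_forall fun t ht =>
    h.enorm_inner_le ht v v)) ?_
  exact hk.lintegral_lintegral_mul_le hqr hs hsr hrs
    (Lp.stronglyMeasurable v).measurable.enorm (fun x => enorm_ne_top) hv

end IsDominatedBy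

end GaussianKernels

/-! ### Backward orbits and the test space -/

section BackwardOrbits

/-- A Mittag-Leffler type construction of non-zero backward orbits of `Q`, which are finite for an
extended norm `ν` that is stronger than the given norm. -/
lemma exists_backward_orbit {E : Type*} [NormedAddCommGroup E] [NormedSpace ℂ E] [CompleteSpace E]
    (ν : E → ℝ≥0∞) (Q : E →L[ℂ] E) {Λ : ℝ≥0∞} (hΛ : Λ ≠ ∞) (hΛ1 : 1 ≤ Λ)
    (hadd : ∀ x y, ν (x + y) ≤ ν x + ν y) (hle : ∀ x, ‖x‖ₑ ≤ ν x)
    (hlsc : ∀ (x : ℕ → E) (a : E), Tendsto x atTop (𝓝 a) →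
      (∃ b : ℝ≥0∞, b ≠ ∞ ∧ ∀ n, ν (x n) ≤ b) → ν a ≠ ∞)
    (hQ : ∀ x, ν (Q x) ≤ Λ * ν x)
    (happrox : ∀ x, ν x ≠ ∞ → ∀ δ : ℝ≥0∞, 0 < δ → ∃ z, ν z ≠ ∞ ∧ ν (Q (Q z) - Q x) ≤ δ)
    {x₀ : E} (hx₀ : ν x₀ ≠ ∞) (hQx₀ : Q x₀ ≠ 0) :
    ∃ f : ℕ → E, (∀ n, Q (f (n + 1)) = f n) ∧ (∀ n, ν (f n) ≠ ∞) ∧ f 0 ≠ 0 := by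
  have hΛ0 : Λ ≠ 0 := (zero_lt_one.trans_le hΛ1).ne'
  -- All corrections to `Q x₀` will add up to at most `2 C`, so the limit `f 0` cannot vanish.
  obtain ⟨C, hC0, hC⟩ : ∃ C : ℝ≥0∞, 0 < C ∧ 2 * C < ‖Q x₀‖ₑ := by
    have h0 : ‖Q x₀‖ₑ ≠ 0 := enorm_ne_zero.2 hQx₀
    refine ⟨‖Q x₀‖ₑ / 2 / 2, ENNReal.half_pos (ENNReal.half_pos h0).ne', ?_⟩
    rw [ENNReal.mul_div_cancel two_ne_zero ENNReal.ofNat_ne_top]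
    exact ENNReal.half_lt_self h0 enorm_ne_top
  have hCtop : C ≠ ∞ := by
    rintro rfl
    simp at hC
  -- Applying `Q` `k` times costs `Λ^k`; an error `C θ^k` then still leaves `C / 2^k`.
  set θ : ℝ≥0∞ := (2 * Λ)⁻¹ with hθ
  have hθ0 : 0 < θ := ENNReal.inv_pos.2 (ENNReal.mul_ne_top ENNReal.ofNat_ne_top hΛ)
  have hθ1 : θ ≤ 1 := ENNReal.inv_le_one.2 (one_le_mul (by norm_num) hΛ1)
  have hΛθ : Λ * θ = 2⁻¹ := by
    rw [hθ, ENNReal.mul_inv (Or.inl two_ne_zero) (Or.inl ENNReal.ofNat_ne_top), mul_left_comm,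
      ENNReal.mul_inv_cancel hΛ0 hΛ, mul_one]
  choose! Z hZ1 hZ2 using happrox
  let x : ℕ → {x : E // ν x ≠ ∞} := fun n => Nat.rec ⟨x₀, hx₀⟩
    (fun n y => ⟨Z y (C * θ ^ n), hZ1 y y.2 _ (ENNReal.mul_pos hC0.ne' (ENNReal.pow_pos hθ0 n).ne')⟩) n
  have hstep : ∀ n, ν (Q (Q (x (n + 1)).1) - Q (x n).1) ≤ C * θ ^ n := fun n =>
    hZ2 _ (x n).2 _ (ENNReal.mul_pos hC0.ne' (ENNReal.pow_pos hθ0 n).ne')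
  have hpow : ∀ (k : ℕ) y, ν ((Q ^ k) y) ≤ Λ ^ k * ν y := by
    intro k
    induction k with
    | zero => intro y; simp
    | succ k ih =>
      intro y
      rw [pow_succ', mul_apply_eq_comp, pow_succ', mul_assoc]
      exact (hQ _).trans (mul_le_mul_right (ih y) Λ)
  -- The sequence satisfies `Q² x_(n+1) ≈ Q x_n`, so `g n k = Q^(k+1) x_(n+k)` is Cauchy in `k`.
  -- Since `Q (g (n+1) k) = g n (k+1)` exactly, the limits form a backward orbit.
  let g : ℕ → ℕ → E := fun n k => (Q ^ k) (Q (x (n + k)).1)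
  have hgdiff : ∀ n k, ν (g n (k + 1) - g n k) ≤ C / 2 ^ k := by
    intro n k
    have h1 : g n (k + 1) - g n k = (Q ^ k) (Q (Q (x (n + k + 1))) - Q (x (n + k)).1) := by
      simp only [g, map_sub, pow_succ, mul_apply_eq_comp, add_assoc]
    rw [h1]
    calc ν _ ≤ Λ ^ k * (C * θ ^ (n + k)) :=
          (hpow k _).trans (mul_le_mul_right (hstep (n + k)) _)
      _ ≤ Λ ^ k * (C * θ ^ k) := by
          exact mul_le_mul_right (mul_le_mul_right
            (pow_le_pow_right_of_le_one' hθ1 (Nat.le_add_left k n)) _) _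
      _ = C / 2 ^ k := by
          rw [mul_left_comm, ← mul_pow, hΛθ, ← ENNReal.inv_pow, div_eq_mul_inv]
  have hedist : ∀ n k, edist (g n k) (g n (k + 1)) ≤ C / 2 ^ k := fun n k => by
    rw [edist_comm, edist_eq_enorm_sub]
    exact (hle _).trans (hgdiff n k)
  have hlim : ∀ n, ∃ a, Tendsto (g n) atTop (𝓝 a) := fun n =>
    cauchySeq_tendsto_of_complete (cauchySeq_of_edist_le_geometric_two C hCtop (hedist n))
  choose f hf using hlim
  refine ⟨f, fun n => ?_, fun n => ?_, fun h0 => ?_⟩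
  · have h1 : Tendsto (fun k => Q (g (n + 1) k)) atTop (𝓝 (Q (f (n + 1)))) :=
      (Q.continuous.tendsto _).comp (hf (n + 1))
    have h2 : (fun k => Q (g (n + 1) k)) = fun k => g n (k + 1) := by
      funext k
      simp only [g, pow_succ', mul_apply_eq_comp]
      rw [add_right_comm, add_assoc]
    rw [h2] at h1
    exact tendsto_nhds_unique h1 ((hf n).comp (tendsto_add_atTop_nat 1))
  · refine hlsc (g n) (f n) (hf n) ⟨ν (Q (x n).1) + 2 * C, ?_, fun k => ?_⟩
    · refine ENNReal.add_ne_top.2 ⟨?_, ENNReal.mul_ne_top ENNReal.ofNat_ne_top hCtop⟩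
      exact ne_top_of_le_ne_top (ENNReal.mul_ne_top hΛ (x n).2) (hQ _)
    · have key : ν (g n k) + 2 * (C / 2 ^ k) ≤ ν (Q (x n).1) + 2 * C := by
        induction k with
        | zero => simp [g]
        | succ k ih =>
          refine le_trans ?_ ih
          have h3 : ν (g n (k + 1)) ≤ C / 2 ^ k + ν (g n k) := by
            have := hadd (g n (k + 1) - g n k) (g n k)
            rw [sub_add_cancel] at this
            exact this.trans (add_le_add_left (hgdiff n k) _)
          have h4 : 2 * (C / 2 ^ (k + 1)) = C / 2 ^ k := by
            rw [pow_succ, div_eq_mul_inv, ENNReal.mul_inv (by simp) (by simp), mul_left_comm,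
              mul_comm (2 : ℝ≥0∞), mul_assoc, ENNReal.inv_mul_cancel two_ne_zero
              ENNReal.ofNat_ne_top, mul_one, div_eq_mul_inv]
          rw [h4, two_mul]
          calc _ ≤ C / 2 ^ k + ν (g n k) + C / 2 ^ k := by gcongr
            _ = _ := by ring
      exact le_self_add.trans key
  · have h1 := edist_le_of_edist_le_geometric_two_of_tendsto₀ C (hedist 0) (hf 0)
    rw [h0, edist_zero_right] at h1
    exact absurd h1 (not_le.2 hC)

/-! ### Resolvents on the intersection of `L¹` and `L²` -/

variable {α : Type*} [MeasurableSpace α] {μ : Measure α}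

/-- The norm of `L¹ ∩ L²`. -/
noncomputable def l1l2Norm (f : Lp ℂ 2 μ) : ℝ≥0∞ := ‖f‖ₑ + eLpNorm f 1 μ

lemma l1l2Norm_add_le (f g : Lp ℂ 2 μ) : l1l2Norm (f + g) ≤ l1l2Norm f + l1l2Norm g := by
  have h1 : eLpNorm (f + g : Lp ℂ 2 μ) 1 μ ≤ eLpNorm f 1 μ + eLpNorm g 1 μ := by
    rw [eLpNorm_congr_ae (Lp.coeFn_add f g)]
    exact eLpNorm_add_le (Lp.aestronglyMeasurable f) (Lp.aestronglyMeasurable g) le_rfl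
  calc l1l2Norm (f + g) ≤ (‖f‖ₑ + ‖g‖ₑ) + (eLpNorm f 1 μ + eLpNorm g 1 μ) :=
        add_le_add (enorm_add_le _ _) h1
    _ = _ := by simp only [l1l2Norm]; ring

lemma l1l2Norm_smul (a : ℂ) (f : Lp ℂ 2 μ) : l1l2Norm (a • f) = ‖a‖ₑ * l1l2Norm f := by
  rw [l1l2Norm, eLpNorm_congr_ae (Lp.coeFn_smul a f), eLpNorm_const_smul, enorm_smul, l1l2Norm,
    mul_add]

lemma l1l2Norm_neg (f : Lp ℂ 2 μ) : l1l2Norm (-f) = l1l2Norm f := by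
  rw [← neg_one_smul ℂ f, l1l2Norm_smul]
  simp

lemma l1l2Norm_sub_le (f g : Lp ℂ 2 μ) : l1l2Norm (f - g) ≤ l1l2Norm f + l1l2Norm g := by
  rw [sub_eq_add_neg, ← l1l2Norm_neg g]
  exact l1l2Norm_add_le f (-g)

lemma l1l2Norm_ne_top_iff {f : Lp ℂ 2 μ} : l1l2Norm f ≠ ∞ ↔ MemLp f 1 μ := by
  rw [l1l2Norm, ENNReal.add_ne_top, MemLp, lt_top_iff_ne_top]
  simp [Lp.aestronglyMeasurable f]

lemma eLpNorm_le_of_tendsto_L2 {f : ℕ → Lp ℂ 2 μ} {a : Lp ℂ 2 μ} {p b : ℝ≥0∞}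
    (hf : Tendsto f atTop (𝓝 a)) (hb : ∀ n, eLpNorm (f n) p μ ≤ b) : eLpNorm a p μ ≤ b :=
  eLpNorm_le_of_tendstoInMeasure (Eventually.of_forall hb) (tendstoInMeasure_of_tendsto_Lp hf)
    fun n => Lp.aestronglyMeasurable (f n)

lemma isClosed_eLpNorm_one_le (b : ℝ≥0∞) : IsClosed {f : Lp ℂ 2 μ | eLpNorm f 1 μ ≤ b} :=
  isSeqClosed_iff_isClosed.1 fun _ _ hx hlim => eLpNorm_le_of_tendsto_L2 hlim hx

lemma convex_eLpNorm_one_le (b : ℝ≥0∞) : Convex ℝ {f : Lp ℂ 2 μ | eLpNorm f 1 μ ≤ b} := by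
  intro f hf g hg s t hs ht hst
  have hsm : ∀ (s : ℝ) (_ : 0 ≤ s) (f : Lp ℂ 2 μ), eLpNorm (s • f : Lp ℂ 2 μ) 1 μ =
      ENNReal.ofReal s * eLpNorm f 1 μ := fun s hs f => by
    rw [eLpNorm_congr_ae (Lp.coeFn_smul s f), eLpNorm_const_smul, ← ofReal_norm,
      Real.norm_of_nonneg hs]
  calc eLpNorm (s • f + t • g : Lp ℂ 2 μ) 1 μ
      ≤ eLpNorm (s • f : Lp ℂ 2 μ) 1 μ + eLpNorm (t • g : Lp ℂ 2 μ) 1 μ := by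
        rw [eLpNorm_congr_ae (Lp.coeFn_add _ _)]
        exact eLpNorm_add_le (Lp.aestronglyMeasurable _) (Lp.aestronglyMeasurable _) le_rfl
    _ ≤ ENNReal.ofReal s * b + ENNReal.ofReal t * b := by
        rw [hsm s hs, hsm t ht]
        gcongr
        · exact hf
        · exact hg
    _ = b := by
        rw [← add_mul, ← ENNReal.ofReal_add hs ht, hst, ENNReal.ofReal_one, one_mul]

lemma lintegral_exp_density {ε : ℝ} (hε : 0 < ε) :
    ∫⁻ t in Ioi (0 : ℝ), ((Real.toNNReal (ε * Real.exp (-ε * t)) : NNReal) : ℝ≥0∞) = 1 := by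
  have hint : IntegrableOn (fun t : ℝ => ε * Real.exp (-ε * t)) (Ioi 0) :=
    (exp_neg_integrableOn_Ioi 0 hε).const_mul ε
  have h := ofReal_integral_eq_lintegral_ofReal hint
    (Eventually.of_forall fun t => by positivity)
  refine h.symm.trans ?_
  rw [integral_const_mul, integral_exp_mul_Ioi (by linarith)]
  rw [mul_zero, Real.exp_zero, neg_div_neg_eq, mul_one_div_cancel hε.ne', ENNReal.ofReal_one]

namespace IsDominatedBy

variable [SFinite μ] {M : Lp ℂ 2 μ →ₗ.[ℂ] Lp ℂ 2 μ} {T : ℝ → Lp ℂ 2 μ →L[ℂ] Lp ℂ 2 μ}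
  {k : ℝ → α → α → ℝ≥0∞} {σ : ℝ} {c D : ℝ≥0∞}

/-- The resolvents are bounded on `L¹`. -/
lemma eLpNorm_one_resolvent_le (h : IsDominatedBy T k) (hT : IsSemigroupOf M T)
    (hk : IsUltracontractiveKernel μ k σ c D) {ε : ℝ} (hε : 0 < ε)
    {R : Lp ℂ 2 μ →L[ℂ] Lp ℂ 2 μ} (hR : IsResolvent M ε R) (f : Lp ℂ 2 μ) :
    ENNReal.ofReal ε * eLpNorm (R f) 1 μ ≤ c * eLpNorm f 1 μ := by
  have hC := h.norm_le_max hT hk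
  set ρ : ℝ → NNReal := fun t => Real.toNNReal (ε * Real.exp (-ε * t)) with hρ
  have hρm : Measurable ρ := by fun_prop
  have hρv : ∀ t, (ρ t : ℝ) = ε * Real.exp (-ε * t) := fun t =>
    Real.coe_toNNReal _ (by positivity)
  -- Against this exponential probability law, `ε R f` is the mean of `T t f`. Each `T t f` with `t
  -- > 0` lies in a fixed `L¹` ball, which is convex and closed in `L²`, so the mean lies there too.
  set m : Measure ℝ := (volume.restrict (Ioi (0 : ℝ))).withDensity (fun t => (ρ t : ℝ≥0∞)) with hm
  have hprob : IsProbabilityMeasure m := ⟨by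
    rw [hm, withDensity_apply _ MeasurableSet.univ, Measure.restrict_univ]
    exact lintegral_exp_density hε⟩
  have hsmul : ∀ t, ρ t • T t f = ε • (Real.exp (-ε * t) • T t f) := fun t => by
    rw [NNReal.smul_def, hρv, mul_smul]
  have hint : Integrable (fun t => T t f) m := by
    rw [hm, integrable_withDensity_iff_integrable_smul hρm]
    simp_rw [hsmul]
    exact (hT.integrableOn_exp_smul hC hε f).smul ε
  have hval : ∫ t, T t f ∂m = ε • R f := by
    rw [hm, integral_withDensity_eq_integral_smul hρm]
    simp_rw [hsmul]
    rw [integral_smul, hT.resolvent_eq_integral hC hε hR f]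
    rfl
  have hmem := (convex_eLpNorm_one_le (μ := μ) (c * eLpNorm f 1 μ)).integral_mem
    (isClosed_eLpNorm_one_le _) (μ := m) (f := fun t => T t f) (by
      refine (withDensity_absolutelyContinuous _ _).ae_le ?_
      exact (ae_restrict_iff' measurableSet_Ioi).2
        (Eventually.of_forall fun t ht => h.eLpNorm_one_le hk ht f)) hint
  rw [hval, mem_ofPred_eq, eLpNorm_congr_ae (Lp.coeFn_smul ε (R f)), eLpNorm_const_smul,
    ← ofReal_norm, Real.norm_of_nonneg hε.le] at hmem
  exact hmem

lemma l1l2Norm_resolvent_le (h : IsDominatedBy T k) (hT : IsSemigroupOf M T)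
    (hM : IsNonnegSelfAdjoint M) (hk : IsUltracontractiveKernel μ k σ c D) {ε : ℝ} (hε : 0 < ε)
    {R : Lp ℂ 2 μ →L[ℂ] Lp ℂ 2 μ} (hR : IsResolvent M ε R) (f : Lp ℂ 2 μ) :
    ENNReal.ofReal ε * l1l2Norm (R f) ≤ (1 + c) * l1l2Norm f := by
  have h1 : ENNReal.ofReal ε * ‖R f‖ₑ ≤ ‖f‖ₑ := by
    rw [← ofReal_norm, ← ofReal_norm, ← ENNReal.ofReal_mul hε.le]
    refine ENNReal.ofReal_le_ofReal ?_
    have h2 := norm_sq_add_le_of_re_inner_nonneg hε (hM.re_inner_nonneg (hR.mem_graph f))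
    rw [add_sub_cancel] at h2
    refine (sq_le_sq₀ (by positivity) (norm_nonneg _)).1 ?_
    nlinarith [sq_nonneg ‖f - (ε : ℂ) • R f‖]
  calc ENNReal.ofReal ε * l1l2Norm (R f) ≤ ‖f‖ₑ + c * eLpNorm f 1 μ := by
        rw [l1l2Norm, mul_add]
        exact add_le_add h1 (h.eLpNorm_one_resolvent_le hT hk hε hR f)
    _ ≤ (1 + c) * l1l2Norm f := by
        rw [l1l2Norm, add_mul, one_mul]
        gcongr
        · exact le_self_add
        · exact le_add_self

/-- `R (1 - R) x` is approximated in `L¹ ∩ L²` by elements of the range of `(R (1 - R))²`. -/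
lemma exists_approx (h : IsDominatedBy T k) (hT : IsSemigroupOf M T)
    (hM : IsNonnegSelfAdjoint M) (hk : IsUltracontractiveKernel μ k σ c D)
    {R : Lp ℂ 2 μ →L[ℂ] Lp ℂ 2 μ} (hR : IsResolvent M 1 R) {x : Lp ℂ 2 μ} (hx : l1l2Norm x ≠ ∞)
    {δ : ℝ≥0∞} (hδ : 0 < δ) :
    ∃ z, l1l2Norm z ≠ ∞ ∧
      l1l2Norm ((R * (1 - R)) ((R * (1 - R)) z) - (R * (1 - R)) x) ≤ δ := by
  set Λ : ℝ≥0∞ := 1 + c with hΛdef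
  have hΛ : Λ ≠ ∞ := ENNReal.add_ne_top.2 ⟨ENNReal.one_ne_top, hk.ne_top_left⟩
  have hres : ∀ {ε : ℝ}, 0 < ε → ∀ {S : Lp ℂ 2 μ →L[ℂ] Lp ℂ 2 μ}, IsResolvent M ε S → ∀ f,
      ENNReal.ofReal ε * l1l2Norm (S f) ≤ Λ * l1l2Norm f := fun hε S hS f =>
    h.l1l2Norm_resolvent_le hT hM hk hε hS f
  have hfin : ∀ {ε : ℝ}, 0 < ε → ∀ {S : Lp ℂ 2 μ →L[ℂ] Lp ℂ 2 μ}, IsResolvent M ε S → ∀ f,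
      l1l2Norm f ≠ ∞ → l1l2Norm (S f) ≠ ∞ := fun {ε} hε S hS f hf htop => by
    have h1 := hres hε hS f
    rw [htop, ENNReal.mul_top (by simpa using hε), top_le_iff] at h1
    exact ENNReal.mul_ne_top hΛ hf h1
  set Y := l1l2Norm ((1 - R) ((1 - R) x)) + l1l2Norm (R (R x)) with hY
  have hsub : ∀ f, l1l2Norm f ≠ ∞ → l1l2Norm ((1 - R) f) ≠ ∞ := fun f hf =>
    ne_top_of_le_ne_top (ENNReal.add_ne_top.2 ⟨hf, hfin one_pos hR f hf⟩)
      (l1l2Norm_sub_le f (R f))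
  have hYtop : Y ≠ ∞ := ENNReal.add_ne_top.2 ⟨hsub _ (hsub _ hx),
    hfin one_pos hR _ (hfin one_pos hR _ hx)⟩
  obtain ⟨ε, hεδ, hε⟩ : ∃ ε : ℝ, ENNReal.ofReal ε * ((1 + Λ) * (Λ * Y + Y)) ≤ δ ∧ 0 < ε := by
    have h1 : Tendsto (fun ε : ℝ => ENNReal.ofReal ε * ((1 + Λ) * (Λ * Y + Y))) (𝓝[>] 0)
        (𝓝 0) := by
      have h2 : Tendsto (fun ε : ℝ => ENNReal.ofReal ε) (𝓝[>] 0) (𝓝 0) := by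
        simpa using (ENNReal.continuous_ofReal.tendsto 0).mono_left
          (nhdsWithin_le_nhds (s := Ioi 0))
      have h3 : (1 + Λ) * (Λ * Y + Y) ≠ ∞ := by
        refine ENNReal.mul_ne_top (ENNReal.add_ne_top.2 ⟨ENNReal.one_ne_top, hΛ⟩)
          (ENNReal.add_ne_top.2 ⟨ENNReal.mul_ne_top hΛ hYtop, hYtop⟩)
      simpa using ENNReal.Tendsto.mul_const h2 (Or.inr h3)
    exact ((h1.eventually_le_const hδ).and self_mem_nhdsWithin).exists
  have hε' : 0 < ε⁻¹ := inv_pos.2 hε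
  obtain ⟨S, hS⟩ := hM.exists_isResolvent hε
  obtain ⟨U, hU⟩ := hM.exists_isResolvent hε'
  have cRS := hR.commute hS
  have cRU := hR.commute hU
  have cSU := hS.commute hU
  have eS : S - R = ((1 - ε : ℝ) : ℂ) • (S * R) := by
    ext1 v; exact hS.sub_eq hR v
  have eU : U - R = ((1 - ε⁻¹ : ℝ) : ℂ) • (U * R) := by
    ext1 v; exact hU.sub_eq hR v
  set a : Lp ℂ 2 μ →L[ℂ] Lp ℂ 2 μ := 1 - (ε : ℂ) • S with ha
  -- With `Q = R (1 - R) = M (1 + M)⁻²`, the operator `Z` is `ε⁻¹ (1 + M)² (ε + M)⁻¹ (ε⁻¹ + M)⁻¹`,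
  -- so that `Q Z = M (ε + M)⁻¹ (1 + ε M)⁻¹` approximates the identity. It is written through
  -- resolvents, hence bounded on `L¹ ∩ L²`.
  set Z : Lp ℂ 2 μ →L[ℂ] Lp ℂ 2 μ := (1 + ((1 - ε : ℝ) : ℂ) • S) *
    ((ε⁻¹ : ℝ) : ℂ) • (1 + ((1 - ε⁻¹ : ℝ) : ℂ) • U) with hZ
  have e1 : (1 - R) * (1 + ((1 - ε : ℝ) : ℂ) • S) = a := by
    have : (1 - R) * (1 + ((1 - ε : ℝ) : ℂ) • S) =
        1 - R + ((1 - ε : ℝ) : ℂ) • S - ((1 - ε : ℝ) : ℂ) • (R * S) := by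
      rw [sub_mul, one_mul, mul_add, mul_one, mul_smul_comm]
      abel
    rw [this, cRS, ← eS, ha]
    push_cast
    module
  have e2 : R * (1 + ((1 - ε⁻¹ : ℝ) : ℂ) • U) = U := by
    rw [mul_add, mul_one, mul_smul_comm, cRU, ← eU, add_sub_cancel]
  have e3 : U * (1 - R) = -(((ε⁻¹ : ℝ) : ℂ) • (U * R) - R) := by
    have h1 : ((ε⁻¹ : ℝ) : ℂ) • (U * R) = U * R - (U - R) := by
      rw [eU]; push_cast; module
    rw [h1, mul_sub, mul_one]
    abel
  have e4 : S * (1 - R) = a * R := by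
    have h1 : (ε : ℂ) • (S * R) = S * R - (S - R) := by
      rw [eS]; push_cast; module
    rw [ha, sub_mul, one_mul, smul_mul_assoc, h1, mul_sub, mul_one]
    abel
  have cR1 : Commute R (1 - R) := (Commute.one_right R).sub_right (Commute.refl R)
  have cRa : Commute R a := (Commute.one_right R).sub_right
    (((show Commute R S from cRS)).smul_right _)
  clear_value a
  have cRZ : Commute R (1 + ((1 - ε : ℝ) : ℂ) • S) := (Commute.one_right R).add_right
    (((show Commute R S from cRS)).smul_right _)
  -- Both error terms are of order `ε` in `L¹ ∩ L²`: `U = (ε⁻¹ + M)⁻¹` has norm at most `ε Λ`, the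
  -- second term carries `ε` explicitly, and `a = M (ε + M)⁻¹` is bounded uniformly in `ε`.
  have key : (R * (1 - R)) * ((R * (1 - R)) * Z) - R * (1 - R) =
      -(a * U * ((1 - R) * (1 - R)) + (ε : ℂ) • (a * (R * R))) := by
    have h1 : (R * (1 - R)) * Z = ((ε⁻¹ : ℝ) : ℂ) • (a * U) := by
      rw [hZ, cR1.eq, mul_smul_comm, mul_smul_comm]
      congr 1
      rw [mul_assoc, ← mul_assoc R, cRZ.eq, mul_assoc (1 + _) R, e2, ← mul_assoc, e1]
    have h2 : R * (1 - R) * (a * U) = a * (U * R) * (1 - R) := by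
      have c1 : Commute (R * (1 - R)) a :=
        cRa.mul_left ((Commute.one_left a).sub_left cRa)
      have c2 : R * (1 - R) * U = U * R * (1 - R) := by
        have : Commute (R * (1 - R)) U :=
          (show Commute R U from cRU).mul_left
            ((Commute.one_left U).sub_left (show Commute R U from cRU))
        rw [this.eq, mul_assoc]
      rw [← mul_assoc, c1.eq, mul_assoc, c2, ← mul_assoc]
    have h3 : a * U * ((1 - R) * (1 - R)) =
        -(((ε⁻¹ : ℝ) : ℂ) • (a * (U * R) * (1 - R)) - a * (R * (1 - R))) := by
      rw [mul_assoc a U, ← mul_assoc U, e3, neg_mul, mul_neg, sub_mul, smul_mul_assoc,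
        mul_sub a, mul_smul_comm, mul_assoc a (U * R)]
    have h4 : (ε : ℂ) • (a * (R * R)) = (1 - a) * (R * (1 - R)) := by
      have : (1 : Lp ℂ 2 μ →L[ℂ] Lp ℂ 2 μ) - a = (ε : ℂ) • S := by rw [ha]; abel
      rw [this, smul_mul_assoc, cR1.eq, ← mul_assoc S, e4, mul_assoc]
    rw [h1, mul_smul_comm, h2, h3, h4, sub_mul 1 a, one_mul]
    module
  have haν : ∀ f, l1l2Norm (a f) ≤ (1 + Λ) * l1l2Norm f := fun f => by
    rw [ha]
    refine (l1l2Norm_sub_le f ((ε : ℂ) • S f)).trans ?_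
    rw [l1l2Norm_smul, enorm_ofReal_of_pos hε, add_mul, one_mul]
    exact add_le_add le_rfl (hres hε hS f)
  refine ⟨Z x, ?_, ?_⟩
  · have hone : ∀ {ε : ℝ}, 0 < ε → ∀ {S : Lp ℂ 2 μ →L[ℂ] Lp ℂ 2 μ}, IsResolvent M ε S →
        ∀ (b : ℂ) f, l1l2Norm f ≠ ∞ →
        l1l2Norm ((1 + b • S) f) ≠ ∞ := fun hε S hS b f hf => by
      refine ne_top_of_le_ne_top (ENNReal.add_ne_top.2 ⟨hf, ?_⟩) (l1l2Norm_add_le f (b • S f))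
      rw [l1l2Norm_smul]
      exact ENNReal.mul_ne_top enorm_ne_top (hfin hε hS f hf)
    rw [hZ, mul_apply_eq_comp]
    refine hone hε hS _ _ ?_
    rw [smul_apply, l1l2Norm_smul]
    exact ENNReal.mul_ne_top enorm_ne_top (hone hε' hU _ _ hx)
  · have e5 : (R * (1 - R)) ((R * (1 - R)) (Z x)) - (R * (1 - R)) x =
        -(a (U ((1 - R) ((1 - R) x)) + (ε : ℂ) • R (R x))) := by
      have := congrArg (fun A : Lp ℂ 2 μ →L[ℂ] Lp ℂ 2 μ => A x) key
      simpa only [mul_apply_eq_comp, sub_apply, neg_apply, add_apply, smul_apply,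
        map_add, map_smul, smul_add] using this
    rw [e5, l1l2Norm_neg]
    refine (haν _).trans (le_trans ?_ hεδ)
    rw [mul_left_comm (ENNReal.ofReal ε)]
    gcongr
    refine (l1l2Norm_add_le _ _).trans ?_
    rw [mul_add]
    refine add_le_add ?_ ?_
    · have h1 := hres hε' hU ((1 - R) ((1 - R) x))
      calc l1l2Norm (U ((1 - R) ((1 - R) x)))
          = ENNReal.ofReal ε * (ENNReal.ofReal ε⁻¹ * l1l2Norm (U ((1 - R) ((1 - R) x)))) := by
            rw [← mul_assoc, ← ENNReal.ofReal_mul hε.le, mul_inv_cancel₀ hε.ne',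
              ENNReal.ofReal_one, one_mul]
        _ ≤ ENNReal.ofReal ε * (Λ * Y) := by
            exact mul_le_mul_right (h1.trans (mul_le_mul_right le_self_add _)) _
    · rw [l1l2Norm_smul, enorm_ofReal_of_pos hε]
      gcongr
      exact le_add_self

/-- There is a non-zero bi-infinite sequence in `L¹ ∩ L²` that is shifted by `M`. -/
theorem exists_orbit (h : IsDominatedBy T k) (hT : IsSemigroupOf M T)
    (hM : IsNonnegSelfAdjoint M) (hk : IsUltracontractiveKernel μ k σ c D)
    (hinj : ∀ x, (x, (0 : Lp ℂ 2 μ)) ∈ M.graph → x = 0)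
    {x₀ : Lp ℂ 2 μ} (hx₀ : MemLp x₀ 1 μ) (hx₀' : x₀ ≠ 0) :
    ∃ F : ℤ → Lp ℂ 2 μ, (∀ m, (F m, F (m + 1)) ∈ M.graph) ∧ (∀ m, MemLp (F m) 1 μ) ∧
      F 0 ≠ 0 := by
  obtain ⟨R, hR⟩ := hM.exists_isResolvent one_pos
  have hgraph : ∀ z, (R z, (1 - R) z) ∈ M.graph := fun z => by
    simpa using hR.mem_graph z
  have hRν : ∀ f, l1l2Norm (R f) ≤ (1 + c) * l1l2Norm f := fun f => by
    simpa using h.l1l2Norm_resolvent_le hT hM hk one_pos hR f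
  have hRν' : ∀ f, l1l2Norm ((1 - R) f) ≤ (2 + c) * l1l2Norm f := fun f => by
    refine (l1l2Norm_sub_le f (R f)).trans ((add_le_add_right (hRν f) _).trans (le_of_eq ?_))
    ring
  have hc := hk.ne_top_left
  have hfin1 : ∀ f, l1l2Norm f ≠ ∞ → l1l2Norm (R f) ≠ ∞ := fun f hf =>
    ne_top_of_le_ne_top (ENNReal.mul_ne_top (by simp [hc]) hf) (hRν f)
  have hfin2 : ∀ f, l1l2Norm f ≠ ∞ → l1l2Norm ((1 - R) f) ≠ ∞ := fun f hf =>
    ne_top_of_le_ne_top (ENNReal.mul_ne_top (by simp [hc]) hf) (hRν' f)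
  have hpow : ∀ (A : Lp ℂ 2 μ →L[ℂ] Lp ℂ 2 μ), (∀ f, l1l2Norm f ≠ ∞ → l1l2Norm (A f) ≠ ∞) →
      ∀ (n : ℕ) f, l1l2Norm f ≠ ∞ → l1l2Norm ((A ^ n) f) ≠ ∞ := by
    intro A hA n
    induction n with
    | zero => intro f hf; simpa using hf
    | succ n ih => intro f hf; rw [pow_succ', mul_apply_eq_comp]; exact hA _ (ih f hf)
  have hQinj : (R * (1 - R)) x₀ ≠ 0 := by
    intro h0
    have h1 : (1 - R) x₀ = 0 := hR.eq_zero_of_apply_eq_zero h0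
    have h2 := hgraph x₀
    rw [h1] at h2
    exact hx₀' (hR.eq_zero_of_apply_eq_zero (hinj _ h2))
  obtain ⟨f, hf, hfν, hf0⟩ := exists_backward_orbit l1l2Norm (R * (1 - R))
    (Λ := (1 + c) * (2 + c)) (ENNReal.mul_ne_top (by simp [hc]) (by simp [hc]))
    (one_le_mul le_self_add ((by norm_num : (1 : ℝ≥0∞) ≤ 2).trans le_self_add))
    l1l2Norm_add_le (fun x => le_self_add)
    (fun x a hxa ⟨b, hb, hxb⟩ => by
      refine ENNReal.add_ne_top.2 ⟨enorm_ne_top, ne_top_of_le_ne_top hb ?_⟩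
      exact eLpNorm_le_of_tendsto_L2 hxa fun n => le_add_self.trans (hxb n))
    (fun x => by
      rw [mul_apply_eq_comp, mul_assoc]
      exact (hRν _).trans (by gcongr; exact hRν' x))
    (fun x hx δ hδ => h.exists_approx hT hM hk hR hx hδ)
    (l1l2Norm_ne_top_iff.2 hx₀) hQinj
  have cR : Commute R (1 - R) := (Commute.one_right R).sub_right (Commute.refl R)
  -- Formally `f n = Q⁻ⁿ (f 0)` with `Q = M (1 + M)⁻²`. Hence `(1 - R)^(2n) (f n)` is `Mⁿ (f 0)` and
  -- `R^(2n) (f n)` is `M⁻ⁿ (f 0)`; the constructor `Int.negSucc n` stands for `-(n+1)`.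
  let F : ℤ → Lp ℂ 2 μ := fun m => match m with
    | Int.ofNat n => ((1 - R) ^ (2 * n)) (f n)
    | Int.negSucc n => (R ^ (2 * (n + 1))) (f (n + 1))
  have hneg : ∀ n : ℕ, ((R ^ (2 * (n + 1))) (f (n + 1)), (R ^ (2 * n)) (f n)) ∈ M.graph := by
    intro n
    have h1 : (R ^ (2 * n)) (f n) = (1 - R) ((R ^ (2 * n + 1)) (f (n + 1))) := by
      rw [← hf n, ← mul_apply_eq_comp, ← mul_apply_eq_comp,
        ← (cR.pow_left _).eq, pow_succ, mul_assoc]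
    rw [h1, show 2 * (n + 1) = (2 * n + 1) + 1 by ring, pow_succ', mul_apply_eq_comp]
    exact hgraph _
  refine ⟨F, fun m => ?_, fun m => ?_, by simpa [F] using hf0⟩
  · match m with
    | Int.ofNat n =>
      change (((1 - R) ^ (2 * n)) (f n), ((1 - R) ^ (2 * (n + 1))) (f (n + 1))) ∈ M.graph
      have h1 : ((1 - R) ^ (2 * n)) (f n) = R (((1 - R) ^ (2 * n + 1)) (f (n + 1))) := by
        rw [← hf n, ← mul_apply_eq_comp, ← mul_apply_eq_comp, pow_succ,
          ← mul_assoc, ← mul_assoc, (cR.pow_right _).eq]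
      rw [h1, show 2 * (n + 1) = (2 * n + 1) + 1 by ring, pow_succ' (1 - R) (2 * n + 1),
        mul_apply_eq_comp]
      exact hgraph _
    | Int.negSucc 0 => exact hneg 0
    | Int.negSucc (n + 1) => exact hneg (n + 1)
  · rw [← l1l2Norm_ne_top_iff]
    match m with
    | Int.ofNat n => exact hpow _ hfin2 _ _ (hfν n)
    | Int.negSucc n => exact hpow _ hfin1 _ _ (hfν (n + 1))

end IsDominatedBy

end BackwardOrbits

/-! ### The energy-critical case -/

section Critical

local notation "⟪" x ", " y "⟫" => inner ℂ x y

/-- The constant `a + 1` instead of `a` keeps the factor non-zero: if no index is admissible the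
infimum is `∞`, and `0 * ∞ = 0` would spoil the bound. -/
lemma le_add_one_mul_iInf₂ {ι : Type*} {P : ι → Prop} {f : ι → ℝ≥0∞} {a x : ℝ≥0∞} (ha : a ≠ ∞)
    (h : ∀ i, P i → x ≤ a * f i) : x ≤ (a + 1) * ⨅ (i) (_ : P i), f i := by
  have h1 : a + 1 ≠ ∞ := ENNReal.add_ne_top.2 ⟨ha, ENNReal.one_ne_top⟩
  rw [ENNReal.mul_iInf_of_ne (by simp) h1]
  refine le_iInf fun i => ?_
  rw [ENNReal.mul_iInf_of_ne (by simp) h1]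
  exact le_iInf fun hi => (h i hi).trans (mul_le_mul_left le_self_add _)

lemma eq_ofReal_mul_of_le {V : Type*} [AddCommGroup V] [Module ℂ V] {N : V → ℝ≥0∞}
    (hN : ∀ s : ℝ, 0 < s → ∀ u, N ((s : ℂ) • u) ≤ ENNReal.ofReal s * N u) {s : ℝ} (hs : 0 < s)
    (u : V) : N ((s : ℂ) • u) = ENNReal.ofReal s * N u := by
  refine le_antisymm (hN s hs u) ?_
  have h1 := hN s⁻¹ (inv_pos.2 hs) ((s : ℂ) • u)
  rw [smul_smul, ← Complex.ofReal_mul, inv_mul_cancel₀ hs.ne', Complex.ofReal_one, one_smul] at h1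
  calc ENNReal.ofReal s * N u
      ≤ ENNReal.ofReal s * (ENNReal.ofReal s⁻¹ * N ((s : ℂ) • u)) := mul_le_mul_right h1 _
    _ = N ((s : ℂ) • u) := by
      rw [← mul_assoc, ← ENNReal.ofReal_mul hs.le, mul_inv_cancel₀ hs.ne', ENNReal.ofReal_one,
        one_mul]

/-- The orthogonal complement of the range of a self-adjoint operator is its kernel, so injectivity
gives dense range. -/
lemma IsSelfAdjoint.exists_seq_tendsto {H : Type*} [NormedAddCommGroup H] [InnerProductSpace ℂ H]
    [CompleteSpace H] {B : H →ₗ.[ℂ] H} (hB : IsSelfAdjoint B)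
    (hinj : ∀ x, (x, (0 : H)) ∈ B.graph → x = 0) (h : H) :
    ∃ f g : ℕ → H, (∀ n, (f n, g n) ∈ B.graph) ∧ Tendsto g atTop (𝓝 h) := by
  set W : Submodule ℂ H := B.graph.map (LinearMap.snd ℂ H H) with hW
  have hWo : Wᗮ = ⊥ := by
    refine (Submodule.eq_bot_iff _).2 fun v hv => hinj v ?_
    refine ((LinearPMap.isSelfAdjoint_iff_graph.1 hB).2 v 0).2 fun a b hab => ?_
    rw [inner_zero_right]
    exact (Submodule.mem_orthogonal W v).1 hv b ⟨(a, b), hab, rfl⟩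
  have hcl : h ∈ closure (W : Set H) := by
    have := Submodule.topologicalClosure_eq_top_iff.2 hWo
    rw [← Submodule.topologicalClosure_coe, this]
    trivial
  obtain ⟨g, hg, hlim⟩ := mem_closure_iff_seq_limit.1 hcl
  choose x hx hxg using hg
  refine ⟨fun n => (x n).1, g, fun n => ?_, hlim⟩
  rw [← hxg n]
  exact hx n

/-! ### Pairings and limits in Lebesgue spaces -/

section Lebesgue

variable {α : Type*} [MeasurableSpace α] {μ : Measure α}

lemma eLpNorm_ne_top_of_memLp_one {f : Lp ℂ 2 μ} (hf : MemLp f 1 μ) {r : ℝ} (h1 : 1 ≤ r)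
    (h2 : r ≤ 2) : eLpNorm f (ENNReal.ofReal r) μ ≠ ∞ := by
  have hr0 : 0 < r := by linarith
  have hf1 : ∫⁻ x, ‖f x‖ₑ ∂μ ≠ ∞ := by
    rw [← eLpNorm_one_eq_lintegral_enorm]; exact hf.2.ne
  have hf2 : ∫⁻ x, ‖f x‖ₑ ^ (2 : ℝ) ∂μ ≠ ∞ := by
    have := (lintegral_rpow_enorm_lt_top_of_eLpNorm_lt_top two_ne_zero ENNReal.ofNat_ne_top
      (Lp.memLp f).2).ne
    simpa using this
  rw [eLpNorm_eq_lintegral_rpow_enorm_toReal (by simpa using hr0) ENNReal.ofReal_ne_top,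
    ENNReal.toReal_ofReal hr0.le]
  refine ENNReal.rpow_ne_top_of_nonneg (by positivity) ?_
  refine ne_top_of_le_ne_top (ENNReal.add_ne_top.2 ⟨hf1, hf2⟩) ?_
  rw [← lintegral_add_left (Lp.stronglyMeasurable f).measurable.enorm]
  refine lintegral_mono fun x => ?_
  rcases le_total ‖f x‖ₑ 1 with h | h
  · exact (ENNReal.rpow_le_rpow_of_exponent_ge h h1).trans
      ((ENNReal.rpow_one _).le.trans le_self_add)
  · exact (ENNReal.rpow_le_rpow_of_exponent_le h h2).trans le_add_self

lemma enorm_integral_mul_conj_le {q r : ℝ} (hqr : q.HolderConjugate r) {u v : α → ℂ}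
    (hu : AEStronglyMeasurable u μ) (hv : AEStronglyMeasurable v μ) :
    ‖∫ x, u x * starRingEnd ℂ (v x) ∂μ‖ₑ ≤
      eLpNorm u (ENNReal.ofReal q) μ * eLpNorm v (ENNReal.ofReal r) μ := by
  refine (enorm_integral_le_lintegral_enorm _).trans
    (le_trans (lintegral_mono fun x => ?_) (lintegral_enorm_mul_le_eLpNorm hqr hu hv))
  rw [enorm_mul, RCLike.enorm_conj]

/-- A Sobolev inequality for the pairs `(f, g)` of a graph yields functions in `L^q` for all limits
of the `g`. -/
lemma exists_lp_limit {B : Lp ℂ 2 μ →ₗ.[ℂ] Lp ℂ 2 μ} {q r : ℝ} (hqr : q.HolderConjugate r)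
    {K : ℝ≥0∞} (hK : K ≠ ∞)
    (hsob : ∀ f g, (f, g) ∈ B.graph → eLpNorm f (ENNReal.ofReal q) μ ≤ K * ‖g‖ₑ)
    {f g : ℕ → Lp ℂ 2 μ} (hfg : ∀ n, (f n, g n) ∈ B.graph) {h : Lp ℂ 2 μ}
    (hg : Tendsto g atTop (𝓝 h)) :
    ∃ u : Lp ℂ (ENNReal.ofReal q) μ, eLpNorm u (ENNReal.ofReal q) μ ≤ K * ‖h‖ₑ ∧
      ∀ v : Lp ℂ 2 μ, eLpNorm v (ENNReal.ofReal r) μ ≠ ∞ →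
        Tendsto (fun n => ⟪v, f n⟫) atTop (𝓝 (∫ x, u x * starRingEnd ℂ (v x) ∂μ)) := by
  have : Fact (1 ≤ ENNReal.ofReal q) := ⟨by
    rw [← ENNReal.ofReal_one]; exact ENNReal.ofReal_le_ofReal hqr.lt.le⟩
  have hmem : ∀ n, MemLp (f n) (ENNReal.ofReal q) μ := fun n =>
    ⟨Lp.aestronglyMeasurable _, (hsob _ _ (hfg n)).trans_lt
      (ENNReal.mul_lt_top hK.lt_top enorm_lt_top)⟩
  set w : ℕ → Lp ℂ (ENNReal.ofReal q) μ := fun n => (hmem n).toLp (f n) with hw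
  -- The Sobolev inequality, applied to differences of graph elements, turns convergence of `g` in
  -- `L²` into a Cauchy sequence in `L^q`.
  have hwd : ∀ n m, edist (w n) (w m) ≤ K * edist (g n) (g m) := fun n m => by
    rw [hw, Lp.edist_toLp_toLp, edist_eq_enorm_sub, ← eLpNorm_congr_ae (Lp.coeFn_sub (f n) (f m))]
    exact hsob _ _ (B.graph.sub_mem (hfg n) (hfg m))
  have hcauchy : CauchySeq w := by
    rw [EMetric.cauchySeq_iff]
    intro ε hε
    have hK1 : K + 1 ≠ ∞ := ENNReal.add_ne_top.2 ⟨hK, ENNReal.one_ne_top⟩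
    obtain ⟨n₀, hn₀⟩ := EMetric.cauchySeq_iff.1 hg.cauchySeq (ε / (K + 1))
      (ENNReal.div_pos hε.ne' hK1)
    refine ⟨n₀, fun m hm n hn => (hwd m n).trans_lt ?_⟩
    have h1 := hn₀ m hm n hn
    rw [ENNReal.lt_div_iff_mul_lt (Or.inl (by simp)) (Or.inl hK1), mul_comm] at h1
    exact (mul_le_mul_left le_self_add _).trans_lt h1
  obtain ⟨u, hu⟩ := cauchySeq_tendsto_of_complete hcauchy
  refine ⟨u, ?_, fun v hv => ?_⟩
  · rw [← Lp.enorm_def]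
    refine le_of_tendsto_of_tendsto' ((continuous_enorm.tendsto u).comp hu)
      (ENNReal.Tendsto.const_mul ((continuous_enorm.tendsto h).comp hg) (Or.inr hK)) fun n => ?_
    simp only [Function.comp_apply]
    rw [hw, Lp.enorm_toLp]
    exact hsob _ _ (hfg n)
  · have hlim : Tendsto (fun n => eLpNorm (f n - u : α → ℂ) (ENNReal.ofReal q) μ) atTop (𝓝 0) := by
      rw [← Lp.tendsto_Lp_iff_tendsto_eLpNorm'' _ hmem u (Lp.memLp u), Lp.toLp_coeFn]
      exact hu
    have hvm := Lp.aestronglyMeasurable v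
    have hvc : AEStronglyMeasurable (fun x => starRingEnd ℂ (v x)) μ :=
      Complex.continuous_conj.comp_aestronglyMeasurable hvm
    have hinner : ∀ n, ⟪v, f n⟫ = ∫ x, f n x * starRingEnd ℂ (v x) ∂μ := fun n => by
      rw [L2.inner_def]
      rfl
    simp_rw [hinner]
    have hint : ∀ {φ : α → ℂ}, MemLp φ (ENNReal.ofReal q) μ →
        Integrable (fun x => φ x * starRingEnd ℂ (v x)) μ := fun {φ} hφ => by
      refine ⟨hφ.1.mul hvc, ?_⟩
      refine lt_of_le_of_lt ?_ (ENNReal.mul_lt_top hφ.2 hv.lt_top)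
      refine le_trans (lintegral_mono fun x => ?_) (lintegral_enorm_mul_le_eLpNorm hqr hφ.1 hvm)
      rw [enorm_mul, RCLike.enorm_conj]
    refine tendsto_integral_of_L1 _ (hint (Lp.memLp u)).1
      (Eventually.of_forall fun n => hint (hmem n)) ?_
    have hlim' := ENNReal.Tendsto.mul_const (b := eLpNorm v (ENNReal.ofReal r) μ) hlim (Or.inr hv)
    rw [zero_mul] at hlim'
    refine tendsto_of_tendsto_of_tendsto_of_le_of_le tendsto_const_nhds hlim'
      (fun n => zero_le) fun n => ?_
    refine le_trans (lintegral_mono fun x => ?_) (lintegral_enorm_mul_le_eLpNorm hqr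
      ((Lp.aestronglyMeasurable (f n)).sub (Lp.aestronglyMeasurable u)) hvm)
    rw [← sub_mul, enorm_mul, RCLike.enorm_conj]
    rfl

end Lebesgue

/-! ### The homogeneous energy space -/

section HomogeneousSpace

variable {d : ℕ} {Ω : Set (EuclideanSpace ℝ (Fin d))} {L : L2 Ω →ₗ.[ℂ] L2 Ω}

lemma TestSpace.eLpNorm_ne_top (F : TestSpace L) {r : ℝ} (h1 : 1 ≤ r) (h2 : r ≤ 2) :
    eLpNorm (F.1 0) (ENNReal.ofReal r) (volume.restrict Ω) ≠ ∞ :=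
  eLpNorm_ne_top_of_memLp_one (F.2 0).2 h1 h2

/-- `F 0 = L (F (-1))`, and `L` is the square of its root. So a functional is determined by its
image under `L^(1/2)`. -/
lemma TestSpace.exists_opSqrt (hL : IsNonnegSelfAdjoint L) (F : TestSpace L) :
    ∃ g, (g, F.1 0) ∈ (opSqrt L).graph := by
  have h1 := (F.2 (-1)).1
  rw [neg_add_cancel] at h1
  obtain ⟨z, -, hz⟩ := (hL.isOpSqrt_opSqrt.2 _ _).1 h1
  exact ⟨z, hz⟩

lemma TestDual.ext_apply {φ : TestDual L} (h : ∀ F, φ.1 F = 0) : φ = 0 :=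
  Subtype.ext (LinearMap.ext h)

lemma homH1Norm_smul {s : ℝ} (hs : 0 < s) (φ : TestDual L) :
    homH1Norm L ((s : ℂ) • φ) = ENNReal.ofReal s * homH1Norm L φ := by
  refine eq_ofReal_mul_of_le (fun s hs φ => ?_) hs φ
  have hs0 : ENNReal.ofReal s ≠ 0 := by simpa using hs
  rw [homH1Norm, homH1Norm, ENNReal.mul_iInf_of_ne hs0 ENNReal.ofReal_ne_top]
  refine le_iInf fun h => ?_
  rw [ENNReal.mul_iInf_of_ne hs0 ENNReal.ofReal_ne_top]
  refine le_iInf fun hφ => ?_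
  refine (iInf₂_le ((s : ℂ) • h) fun F g hg => ?_).trans
    (by rw [enorm_smul, enorm_ofReal_of_pos hs])
  rw [inner_smul_right, ← hφ F g hg]
  rfl

lemma dualLpNorm_smul {q : ℝ≥0∞} {s : ℝ} (hs : 0 < s) (φ : TestDual L) :
    dualLpNorm L q ((s : ℂ) • φ) = ENNReal.ofReal s * dualLpNorm L q φ := by
  refine eq_ofReal_mul_of_le (fun s hs φ => ?_) hs φ
  have hs0 : ENNReal.ofReal s ≠ 0 := by simpa using hs
  rw [dualLpNorm, dualLpNorm, ENNReal.mul_iInf_of_ne hs0 ENNReal.ofReal_ne_top]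
  refine le_iInf fun u => ?_
  rw [ENNReal.mul_iInf_of_ne hs0 ENNReal.ofReal_ne_top]
  refine le_iInf fun hu => ?_
  refine (iInf₂_le ((s : ℂ) • u) fun F => ?_).trans (le_of_eq ?_)
  · have h1 : ∫ x in Ω, ((s : ℂ) • u : Lp ℂ q (volume.restrict Ω)) x * starRingEnd ℂ (F.1 0 x) =
        ∫ x in Ω, (s : ℂ) * (u x * starRingEnd ℂ (F.1 0 x)) := by
      refine integral_congr_ae ?_
      filter_upwards [Lp.coeFn_smul (s : ℂ) u] with x hx
      rw [hx, Pi.smul_apply, smul_eq_mul, mul_assoc]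
    rw [h1, integral_const_mul, ← hu F]
    rfl
  · rw [eLpNorm_congr_ae (Lp.coeFn_smul (s : ℂ) u), eLpNorm_const_smul, enorm_ofReal_of_pos hs]

lemma homH1Norm_zero : homH1Norm L 0 = 0 := by
  refine le_antisymm ((iInf₂_le 0 fun F g _ => ?_).trans enorm_zero.le) zero_le
  rw [inner_zero_right]
  rfl

lemma dualLpNorm_zero {q : ℝ≥0∞} : dualLpNorm L q 0 = 0 := by
  refine le_antisymm ((iInf₂_le 0 fun F => ?_).trans ?_) zero_le
  · have h1 : ∫ x in Ω, (0 : Lp ℂ q (volume.restrict Ω)) x * starRingEnd ℂ (F.1 0 x) =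
        ∫ _ in Ω, (0 : ℂ) := by
      refine integral_congr_ae ?_
      filter_upwards [Lp.coeFn_zero ℂ q (volume.restrict Ω)] with x hx
      rw [hx, Pi.zero_apply, zero_mul]
    rw [h1, integral_zero]
    rfl
  · rw [eLpNorm_congr_ae (Lp.coeFn_zero _ _ _), eLpNorm_zero]

lemma eq_zero_of_homH1Norm_eq_zero (hL : IsNonnegSelfAdjoint L) {φ : TestDual L}
    (h : homH1Norm L φ = 0) : φ = 0 := by
  refine TestDual.ext_apply fun F => ?_
  obtain ⟨g, hg⟩ := TestSpace.exists_opSqrt hL F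
  have h1 : ‖φ.1 F‖ₑ ≤ (‖g‖ₑ + 1) * homH1Norm L φ :=
    le_add_one_mul_iInf₂ enorm_ne_top fun h hh => by
      rw [hh F g hg, ← ofReal_norm, ← ofReal_norm, ← ofReal_norm,
        ← ENNReal.ofReal_mul (norm_nonneg _)]
      exact ENNReal.ofReal_le_ofReal (norm_inner_le_norm g h)
  rw [h, mul_zero] at h1
  exact enorm_eq_zero.1 (le_antisymm h1 zero_le)

lemma eq_zero_of_dualLpNorm_eq_zero {q r : ℝ} (hqr : q.HolderConjugate r) (hr : r ≤ 2)
    {φ : TestDual L} (h : dualLpNorm L (ENNReal.ofReal q) φ = 0) : φ = 0 := by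
  refine TestDual.ext_apply fun F => ?_
  have h1 : ‖φ.1 F‖ₑ ≤ (eLpNorm (F.1 0) (ENNReal.ofReal r) (volume.restrict Ω) + 1) *
      dualLpNorm L (ENNReal.ofReal q) φ :=
    le_add_one_mul_iInf₂ (TestSpace.eLpNorm_ne_top F hqr.symm.lt.le hr) fun u hu => by
      rw [hu F, mul_comm]
      exact enorm_integral_mul_conj_le hqr (Lp.aestronglyMeasurable _) (Lp.aestronglyMeasurable _)
  rw [h, mul_zero] at h1
  exact enorm_eq_zero.1 (le_antisymm h1 zero_le)

/-- If `h = L^(1/2) φ`, choose `f n` with `L^(1/2) (f n) → h` in `L²`. The `f n` converge in `L^q`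
to a function `u`, and symmetry of `L^(1/2)` identifies `u` with `φ` on test elements. -/
lemma dualLpNorm_le_mul_homH1Norm (hL : IsNonnegSelfAdjoint L) {q r : ℝ}
    (hqr : q.HolderConjugate r) (hr : r ≤ 2) {K : ℝ≥0∞} (hK : K ≠ ∞)
    (hsob : ∀ f g, (f, g) ∈ (opSqrt L).graph →
      eLpNorm f (ENNReal.ofReal q) (volume.restrict Ω) ≤ K * ‖g‖ₑ) (φ : TestDual L) :
    dualLpNorm L (ENNReal.ofReal q) φ ≤ (K + 1) * homH1Norm L φ := by
  refine le_add_one_mul_iInf₂ hK fun h hh => ?_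
  have hB := hL.isOpSqrt_opSqrt.1.1
  obtain ⟨f, g, hfg, hg⟩ := hB.exists_seq_tendsto (fun x hx => by
    refine lp_eq_zero_of_eLpNorm_eq_zero hqr.pos (le_antisymm ?_ zero_le)
    simpa using hsob x 0 hx) h
  obtain ⟨u, hu, hlim⟩ := exists_lp_limit hqr hK hsob hfg hg
  refine (iInf₂_le u fun F => ?_).trans hu
  obtain ⟨z, hz⟩ := TestSpace.exists_opSqrt hL F
  rw [hh F z hz]
  refine tendsto_nhds_unique (tendsto_const_nhds.inner hg) ?_
  simp_rw [← hB.inner_graph hz (hfg _)]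
  exact hlim _ (TestSpace.eLpNorm_ne_top F hqr.symm.lt.le hr)

/-- The functional `G ↦ ⟨w, G⟩` for a function `w ∈ L²(Ω)` that is bounded on `L¹(Ω) ∩ L²(Ω)`. -/
noncomputable def TestDual.ofBounded (w : L2 Ω) {C : ℝ≥0∞} (hC : C ≠ ∞)
    (hw : ∀ v : L2 Ω, ‖⟪v, w⟫‖ₑ ≤ C * eLpNorm v 1 (volume.restrict Ω)) : TestDual L :=
  ⟨{ toFun := fun G => ⟪G.1 0, w⟫
     map_add' := fun G H => inner_add_left _ _ _
     map_smul' := fun c G => inner_smul_left _ _ _ }, C.toReal, 0, fun G => by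
    have h1 := ENNReal.toReal_mono (ENNReal.mul_ne_top hC (G.2 0).2.2.ne) (hw (G.1 0))
    rw [ENNReal.toReal_mul, toReal_enorm] at h1
    simpa using h1⟩

/-- The functional is `T t (F 0)` for a non-zero orbit `F` and small `t`: smoothing by `T t` makes
it continuous for the `L¹` seminorm, and `⟨F 0, T t (F 0)⟩` is close to `‖F 0‖²`, so it does not
vanish on `F`. -/
lemma AssumptionB.nonempty_energyPunctured (hB : AssumptionB Ω L) (hΩ : IsOpen Ω)
    (hne : Ω.Nonempty) (hinj : ∀ x, (x, (0 : L2 Ω)) ∈ L.graph → x = 0) :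
    (energyPunctured (homH1Norm L)).Nonempty := by
  obtain ⟨T, k, c, D, hT, hk, hdom⟩ := hB.exists_kernel
  have hL := hB.1
  obtain ⟨x₀, hx₀, hx₀'⟩ := exists_memLp_one_ne_zero hΩ hne
  obtain ⟨F, hF, hF1, hF0⟩ := hdom.exists_orbit hT hL hk hinj hx₀ hx₀'
  have hlim : Tendsto (fun t => ⟪F 0, T t (F 0)⟫) (𝓝[>] 0) (𝓝 ⟪F 0, F 0⟫) :=
    tendsto_const_nhds.inner (hT.tendsto_zero (F 0))
  obtain ⟨t, ht, ht0⟩ := ((hlim.eventually_ne (inner_self_ne_zero.2 hF0)).and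
    self_mem_nhdsWithin).exists
  have hmem : (T t (F 0), T t (F 1)) ∈ L.graph := hT.map_mem_graph (le_of_lt ht0) (hF 0)
  obtain ⟨h, hh, -⟩ := (hL.isOpSqrt_opSqrt.2 _ _).1 hmem
  have hC : D * ENNReal.ofReal (t ^ (-((d : ℝ) / 2))) * eLpNorm (F 0) 1 (volume.restrict Ω) ≠ ∞ :=
    ENNReal.mul_ne_top (ENNReal.mul_ne_top hk.ne_top_right ENNReal.ofReal_ne_top) (hF1 0).2.ne
  refine ⟨TestDual.ofBounded (T t (F 0)) hC fun v => ?_, ?_, fun h0 => ht ?_⟩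
  · refine (hdom.enorm_inner_le_eLpNorm_one hk ht0 v (F 0)).trans (le_of_eq ?_)
    ring
  · refine ne_top_of_le_ne_top (enorm_ne_top (x := h)) (iInf₂_le h fun G g hg => ?_)
    exact hL.isOpSqrt_opSqrt.1.1.inner_graph hg hh
  · have := congrArg (fun φ : TestDual L => φ.1 ⟨F, fun m => ⟨hF m, hF1 m⟩⟩) h0
    exact this

/-- Under Assumption B, the norms of `Ḣ¹(L)` and `L^{p+1}` form a Sobolev pair. -/
theorem AssumptionB.isSobolevPair (hB : AssumptionB Ω L) (hd : 3 ≤ d) (hΩ : IsOpen Ω)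
    (hne : Ω.Nonempty) {p : ℝ} (hp : (p : EReal) = critExp d) :
    1 < p ∧ IsSobolevPair (homH1Norm L) (dualLpNorm L (ENNReal.ofReal (p + 1))) := by
  have hd3 : (3 : ℝ) ≤ d := by exact_mod_cast hd
  have hd2 : (d : ℝ) - 2 ≠ 0 := by linarith
  obtain rfl : p = ((d : ℝ) + 2) / (d - 2) := by
    rw [critExp, if_pos hd] at hp
    exact_mod_cast hp
  have hq : ((d : ℝ) + 2) / (d - 2) + 1 = 2 * d / (d - 2) := by field_simp; ring
  have hqr : (2 * (d : ℝ) / (d - 2)).HolderConjugate (2 * d / (d + 2)) := by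
    rw [Real.holderConjugate_iff]
    refine ⟨?_, ?_⟩
    · rw [lt_div_iff₀ (by linarith)]; linarith
    · field_simp; ring
  have hq2 : 2 ≤ 2 * (d : ℝ) / (d - 2) := by
    rw [le_div_iff₀ (by linarith)]; linarith
  have hr2 : 2 * (d : ℝ) / (d + 2) ≤ 2 := by
    rw [div_le_iff₀ (by linarith)]; linarith
  rw [hq]
  refine ⟨by rw [lt_div_iff₀ (by linarith)]; linarith, ?_⟩
  have hL := hB.1
  obtain ⟨K, hK, hsob⟩ : ∃ K : ℝ≥0∞, K ≠ ∞ ∧ ∀ f g, (f, g) ∈ (opSqrt L).graph →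
      eLpNorm f (ENNReal.ofReal (2 * d / (d - 2))) (volume.restrict Ω) ≤ K * ‖g‖ₑ := by
    obtain ⟨T, k, c, D, hT, hk, hdom⟩ := hB.exists_kernel
    -- With `r = 2d/(d+2)` and `σ = d/2` the quotient `σ / r` is `(d+2)/4`, and `2 - 4/(d+2)` is
    -- again `r`. The condition `s > 1` is `d > 2`.
    refine hdom.exists_sobolev hT hL hk hL.isOpSqrt_opSqrt hqr hq2 (s := ((d : ℝ) + 2) / 4)
      (by linarith) ?_ ?_
    · field_simp; ring
    · field_simp; ring
  have hinjB : ∀ x, (x, (0 : L2 Ω)) ∈ (opSqrt L).graph → x = 0 := fun x hx => by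
    refine lp_eq_zero_of_eLpNorm_eq_zero hqr.pos (le_antisymm ?_ zero_le)
    simpa using hsob x 0 hx
  have hinj : ∀ x, (x, (0 : L2 Ω)) ∈ L.graph → x = 0 := fun x hx => by
    obtain ⟨z, hz, hz0⟩ := (hL.isOpSqrt_opSqrt.2 _ _).1 hx
    rw [hinjB z hz0] at hz
    exact hinjB x hz
  refine ⟨fun s hs φ => homH1Norm_smul hs φ, fun s hs φ => dualLpNorm_smul hs φ, homH1Norm_zero,
    dualLpNorm_zero, fun φ hφ h0 => hφ.2 (eq_zero_of_homH1Norm_eq_zero hL h0),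
    fun φ hφ h0 => hφ.2 (eq_zero_of_dualLpNorm_eq_zero hqr hr2 h0),
    hB.nonempty_energyPunctured hΩ hne hinj, (K + 1).toReal, ENNReal.toReal_nonneg, fun φ _ => ?_⟩
  rw [ENNReal.ofReal_toReal (ENNReal.add_ne_top.2 ⟨hK, ENNReal.one_ne_top⟩)]
  exact dualLpNorm_le_mul_homH1Norm hL hqr hr2 hK hsob φ

end HomogeneousSpace

end Critical

/-! ### The mountain pass level in both cases -/

theorem mainTheorem5 (d : ℕ) (hd : 1 ≤ d) (Ω : Set (EuclideanSpace ℝ (Fin d)))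
    (hΩ : IsOpen Ω) (hne : Ω.Nonempty) (L : L2 Ω →ₗ.[ℂ] L2 Ω) :
    -- the energy-subcritical case, with the energy space `H¹(L)`
    (AssumptionA Ω L → ∀ p : ℝ, 1 < p → (p : EReal) < critExp d →
      let N : L2 Ω → ℝ≥0∞ := h1Norm L
      let P : L2 Ω → ℝ≥0∞ := lqNorm (ENNReal.ofReal (p + 1))
      -- the best constant is finite, admissible and positive
      IsLeast (sobolevConstants N P) (sobolevBest N P) ∧ 0 < sobolevBest N P ∧
      -- the maximum in the mountain pass level is attained
      (∀ u ∈ energyPunctured N,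
        ∃ s₀ ∈ Ici (0 : ℝ), IsMaxOn (fun s : ℝ => energy N P p ((s : ℂ) • u)) (Ici 0) s₀) ∧
      mountainPassLevel N P p = ⨅ f ∈ nehariManifold N P p, (energy N P p f : EReal) ∧
      mountainPassLevel N P p =
        (((p - 1) / (2 * (p + 1)) *
          sobolevBest N P ^ (-(2 * (p + 1) / (p - 1))) : ℝ) : EReal)) ∧
    -- the energy-critical case, with the energy space `Ḣ¹(L)`
    (3 ≤ d → AssumptionB Ω L → ∀ p : ℝ, (p : EReal) = critExp d →
      let N : TestDual L → ℝ≥0∞ := homH1Norm L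
      let P : TestDual L → ℝ≥0∞ := dualLpNorm L (ENNReal.ofReal (p + 1))
      IsLeast (sobolevConstants N P) (sobolevBest N P) ∧ 0 < sobolevBest N P ∧
      (∀ u ∈ energyPunctured N,
        ∃ s₀ ∈ Ici (0 : ℝ), IsMaxOn (fun s : ℝ => energy N P p ((s : ℂ) • u)) (Ici 0) s₀) ∧
      mountainPassLevel N P p = ⨅ f ∈ nehariManifold N P p, (energy N P p f : EReal) ∧
      mountainPassLevel N P p =
        (((p - 1) / (2 * (p + 1)) *
          sobolevBest N P ^ (-(2 * (p + 1) / (p - 1))) : ℝ) : EReal)) := by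
  refine ⟨fun hA p hp hpc => (hA.isSobolevPair hd hΩ hne hp hpc).mountainPass hp,
    fun h3 hB p hp => ?_⟩
  obtain ⟨hp1, h⟩ := hB.isSobolevPair h3 hΩ hne hp
  exact h.mountainPass hp1
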